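/- **Setting.** Let $d\ge 1$. A (labelled) tile in $\mathbb R^d$ is a pair $T=(S,\ell)$ of a non-empty compact set $S=\operatorname{supp}T$ with $S=\overline{S^\circ}$ and a label $\ell$; $T+x=(S+x,\ell)$. A patch is a set of tiles with pairwise disjoint interiors, a tiling is a patch covering $\mathbb R^d$, and $\mathcal P+x=\{T+x: T\in\mathcal P\}$. Let $\mathcal A=\{T_1,\dots,T_{n}\}$ be a finite alphabet of tiles, no two of which are translates of each other. Let $\rho_1,\dots,\rho_{m}$ be substitution rules with alphabet $\mathcal A$: each $\rho_s$ has a linear expansion map $\phi_s$ with $\min_{\|v\|=1}\|\phi_s(v)\|>1$ and assigns to $T_j$ a patch $\rho_s(T_j)=\{T_i+x : 1\le i\le n,\ x\in T^{(s)}_{i,j}\}$ with support $\phi_s(\operatorname{supp}T_j)$, where $T^{(s)}_{i,j}\subset\mathbb R^d$ are the (finite) digit sets; it acts on patches by $\rho_s(\mathcal P)=\bigcup_{T_j+x\in\mathcal P}(\rho_s(T_j)+\phi_s(x))$. The Fourier matrix is $B^{(s)}(t)=\bigl(\sum_{x\in T^{(s)}_{i,j}}e^{2\pi \mathrm i\langle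 x,t\rangle}\bigr)_{i,j}$. Assume that the family has finite local complexity: for every compact $K$, the patches consisting of those tiles of $\rho_{j_1}\circ\dots\circ\rho_{j_r}(T)$ that meet $K+x$ ($T\in\mathcal A$, $r>0$, $1\le j_1,\dots,j_r\le m$, $x\in\mathbb R^d$) are finitely many up to translation. Let $(i_k)_{k\ge1}$ be a sequence in $\{1,\dots,m\}$, let $N_1<N_2<\cdots$ be integers and let $\mathcal P_l$ be patches each of which has a translate included in some $\rho_{j_1}\circ\dots\circ\rho_{j_r}(T)$ ($T\in\mathcal A$, $r>0$), such that for every $k\ge1$ the limit $$\mathcal T^{(k)}=\lim_{l\to\infty}\rho_{i_k}\circ\rho_{i_{k+1}}\circ\cdots\circ\rho_{i_{N_l-1}}(\mathcal P_l)$$ exists in the local matching topology and $\mathcal T^{(1)}$ is a tiling. (Thus $\mathcal T^{(1)}$ is an S-adic tiling, and $\mathcal T^{(2)},\mathcal T^{(3)},\dots$ are its de-substituted tilings.) Let $\mu_L$ be Lebesgue measure and $B_R$ the closed ball of radius $R$ about $0$. Assume that the patch frequencies converge: for every $k$ and every finite non-empty patch $\mathcal P$ the limit $$\operatorname{freq}_{\mathcal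 T^{(k)}}\mathcal P=\lim_{R\to\infty}\frac{\#\{t\in B_R:\mathcal P+t\subset\mathcal T^{(k)}\}}{\mu_L(B_R)}$$ exists; and assume that averaging $\mathcal T^{(k+1)}$ along the ellipsoids $\phi_{i_k}^{-1}(B_R)$, $R\to\infty$, instead of the balls $B_R$ gives the same frequencies. (The latter is automatic if $\phi_{i_k}$ is a similarity, in particular if $d=1$, or if the frequencies of $\mathcal T^{(k+1)}$ are uniform with respect to translations.) Put $D^{(k)}_i=\{t:T_i+t\in\mathcal T^{(k)}\}$, $\nu^{(k)}_{i,j}(z)=\operatorname{freq}_{\mathcal T^{(k)}}\{T_i,T_j+z\}$ and $\Upsilon^{(k)}_{i,j}=\sum_{z\in D^{(k)}_j-D^{(k)}_i}\nu^{(k)}_{i,j}(z)\,\delta_z$. For a (complex) Radon measure $\mu$, a homeomorphism $g$ of $\mathbb R^d$ and a continuous function $\xi$ put $\langle g.\mu,\varphi\rangle=\langle\mu,\varphi\circ g\rangle$ and $\langle\xi\mu,\varphi\rangle=\langle\mu,\xi\varphi\rangle$, and let $\exp_a(t)=e^{2\pi\mathrm i\langle t,a\rangle}$. A Radon measure $\hat\mu$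 is the Fourier transform of $\mu$ if for all $\varphi,\psi\in C_c(\mathbb R^d)$ the inverse Fourier transform of $\varphi*\psi$ is in $L^1(\hat\mu)$ and its integral with respect to $\hat\mu$ is $\langle\varphi*\psi,\mu\rangle$. **Statement.** For all $k\ge1$ and $1\le i,j\le n$: 1. $D^{(k)}_j-D^{(k)}_i$ is locally finite, so that $\Upsilon^{(k)}_{i,j}$ is a well-defined Radon measure, and $$\Upsilon^{(k)}_{i,j}=\frac1{|\det\phi_{i_k}|}\sum_{p,q=1}^{n}\ \sum_{x\in T^{(i_k)}_{i,p}}\ \sum_{y\in T^{(i_k)}_{j,q}}\delta_{y-x}*\bigl(\phi_{i_k}.\Upsilon^{(k+1)}_{p,q}\bigr).$$ 2. $\Upsilon^{(k)}_{i,j}$ is Fourier transformable, and $$\widehat{\Upsilon^{(k)}_{i,j}}=\frac1{(\det\phi_{i_k})^2}\sum_{p,q=1}^{n}\ \sum_{x\in T^{(i_k)}_{i,p}}\ \sum_{y\in T^{(i_k)}_{j,q}}\exp_{x-y}\,\bigl((\phi_{i_k}^*)^{-1}.\widehat{\Upsilon^{(k+1)}_{p,q}}\bigr).$$ 3. The absolutely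 continuous part of $\widehat{\Upsilon^{(k)}_{i,j}}$ with respect to Lebesgue measure has a Radon–Nikodym derivative $h^{(k)}_{i,j}\in L^1_{\rm loc}(\mathbb R^d)$, and, for any choice of these derivatives, the matrices $H^{(k)}(t)=(h^{(k)}_{i,j}(t))_{i,j}$ satisfy, for every $k\ge 1$ and Lebesgue-almost every $t\in\mathbb R^d$, $$H^{(k)}(t)=\frac1{|\det\phi_{i_k}|}\,B^{(i_k)}(t)\,H^{(k+1)}(\phi_{i_k}^*t)\,B^{(i_k)}(t)^*.$$ -/

import Mathlib

open MeasureTheory Filter Topology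

noncomputable section

namespace SAdic

/-! ### Tiles, patches, tilings -/

/-- Euclidean space of dimension `d`. -/
abbrev Rd (d : ℕ) : Type := EuclideanSpace ℝ (Fin d)

/-- A (labelled) tile: a non-empty compact set which is the closure of its interior, with a label.
Unlabelled tiles are the case where the type `L` of labels has a single element. -/
structure Tile (d : ℕ) (L : Type*) where
  supp : Set (Rd d)
  label : L
  isCompact : IsCompact supp
  closure_interior : closure (interior supp) = supp
  nonempty : supp.Nonempty

variable {d : ℕ} {L : Type*}

theorem Tile.ext_of {S T : Tile d L} (h : S.supp = T.supp) (hl : S.label = T.label) : S = T := by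
  cases S; cases T; simp_all

/-- The translate `T + x` of a tile. -/
def Tile.shift (T : Tile d L) (x : Rd d) : Tile d L where
  supp := Homeomorph.addRight x '' T.supp
  label := T.label
  isCompact := T.isCompact.image (Homeomorph.addRight x).continuous
  closure_interior := by
    rw [← Homeomorph.image_interior, ← Homeomorph.image_closure, T.closure_interior]
  nonempty := T.nonempty.image _

/-- A patch: a set of tiles with pairwise disjoint interiors. -/
def IsPatch (P : Set (Tile d L)) : Prop :=
  P.Pairwise fun S T => Disjoint (interior S.supp) (interior T.supp)

/-- The region covered by a set of tiles. -/
def patchSupp (P : Set (Tile d L)) : Set (Rd d) := ⋃ T ∈ P, T.supp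

/-- A tiling: a patch that covers the whole space. -/
def IsTiling (P : Set (Tile d L)) : Prop := IsPatch P ∧ patchSupp P = Set.univ

/-- The translate `P + x` of a set of tiles. -/
def shiftPatch (P : Set (Tile d L)) (x : Rd d) : Set (Tile d L) := (fun T => T.shift x) '' P

/-- `P ⊓ K`: the tiles of `P` whose support meets `K`. -/
def meets (P : Set (Tile d L)) (K : Set (Rd d)) : Set (Tile d L) :=
  {T | T ∈ P ∧ (T.supp ∩ K).Nonempty}

/-- Convergence in the local matching topology: for every `R` and `ε`, eventually `P l` and `Q`
agree inside the ball of radius `R` about `0` after displacements of norm less than `ε`. -/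
def TendsLocalMatching (P : ℕ → Set (Tile d L)) (Q : Set (Tile d L)) : Prop :=
  ∀ R > (0 : ℝ), ∀ ε > (0 : ℝ), ∀ᶠ l in atTop, ∃ x y : Rd d, ‖x‖ < ε ∧ ‖y‖ < ε ∧
    meets (shiftPatch (P l) x) (Metric.closedBall 0 R) =
      meets (shiftPatch Q y) (Metric.closedBall 0 R)

/-! ### Substitution rules -/

/-- Distinct elements of the alphabet are not translates of each other. -/
def TranslationInequivalent {n : ℕ} (A : Fin n → Tile d L) : Prop :=
  ∀ i j x, (A i).shift x = A j → i = j

/-- A substitution rule with alphabet `A`: an expansion map `φ` with `min_{‖v‖ = 1} ‖φ v‖ > 1`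
(in particular invertible), and for every element `A j` of the alphabet a patch `rule j`, consisting
of translates of elements of the alphabet, that covers exactly `φ (supp (A j))`. -/
structure Substitution {n : ℕ} (A : Fin n → Tile d L) where
  φ : Rd d ≃L[ℝ] Rd d
  expanding : ∀ v : Rd d, ‖v‖ = 1 → 1 < ‖φ v‖
  rule : Fin n → Set (Tile d L)
  rule_isPatch : ∀ j, IsPatch (rule j)
  rule_translates : ∀ j, ∀ T ∈ rule j, ∃ i x, T = (A i).shift x
  rule_supp : ∀ j, patchSupp (rule j) = φ '' (A j).supp

variable {n : ℕ} {A : Fin n → Tile d L}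

/-- The absolute value of the determinant of the expansion map. -/
def Substitution.absDet (σ : Substitution A) : ℝ :=
  |LinearMap.det (σ.φ.toLinearEquiv : Rd d →ₗ[ℝ] Rd d)|

/-- The digit set `T_{i,j} = {x | T_i + x ∈ ρ(T_j)}`. -/
def Substitution.digitSet (σ : Substitution A) (i j : Fin n) : Set (Rd d) :=
  {x | (A i).shift x ∈ σ.rule j}

theorem Tile.interior_nonempty (T : Tile d L) : (interior T.supp).Nonempty := by
  by_contra h
  rw [Set.not_nonempty_iff_eq_empty] at h
  have h1 := T.closure_interior
  rw [h, closure_empty] at h1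
  exact T.nonempty.ne_empty h1.symm

theorem Tile.shift_injective (T : Tile d L) : Function.Injective (T.shift) := by
  intro x y h
  have hs : Homeomorph.addRight x '' T.supp = Homeomorph.addRight y '' T.supp :=
    congrArg Tile.supp h
  have hc : Continuous fun z : Rd d => inner ℝ z (x - y) := by fun_prop
  obtain ⟨z, hz, hmax⟩ := T.isCompact.exists_isMaxOn T.nonempty hc.continuousOn
  have hzx : z + x ∈ Homeomorph.addRight y '' T.supp := hs ▸ ⟨z, hz, rfl⟩
  obtain ⟨w, hw, hwz⟩ := hzx
  have hw2 : w = z + (x - y) := by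
    have : w + y = z + x := hwz
    rw [eq_sub_of_add_eq this]; abel
  have h3 : inner ℝ w (x - y) ≤ inner ℝ z (x - y) := hmax hw
  rw [hw2, inner_add_left, real_inner_self_eq_norm_sq] at h3
  have h4 : ‖x - y‖ = 0 := by nlinarith [norm_nonneg (x - y)]
  exact sub_eq_zero.mp (norm_eq_zero.mp h4)

theorem Substitution.digitSet_finite (σ : Substitution A) (i j : Fin n) :
    (σ.digitSet i j).Finite := by
  set U : Set (Rd d) := interior (A i).supp with hU
  let V : σ.digitSet i j → Set (Rd d) := fun x => interior ((A i).shift x.1).supp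
  have hV : ∀ x, V x = Homeomorph.addRight x.1 '' U := fun x =>
    ((Homeomorph.addRight x.1).image_interior _).symm
  have hvol : ∀ x, volume (V x) = volume U := by
    intro x
    rw [hV]
    have : (Homeomorph.addRight x.1 : Rd d → Rd d) '' U = (fun z => z + x.1) '' U := rfl
    rw [this, Set.image_add_right, measure_preimage_add_right]
  have hsub : (⋃ x, V x) ⊆ σ.φ '' (A j).supp := by
    rw [← σ.rule_supp j]
    refine Set.iUnion_subset fun x => ?_
    exact interior_subset.trans (Set.subset_biUnion_of_mem (u := fun T : Tile d L => T.supp) x.2)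
  have hcpt : IsCompact (σ.φ '' (A j).supp) := (A j).isCompact.image σ.φ.continuous
  have hfin := Measure.finite_const_le_meas_of_disjoint_iUnion (volume : Measure (Rd d))
    (ε := volume U) (isOpen_interior.measure_pos _ (A i).interior_nonempty)
    (As := V) (fun x => isOpen_interior.measurableSet)
    (fun x y hxy => σ.rule_isPatch j x.2 y.2 fun h =>
      hxy (Subtype.ext ((A i).shift_injective h)))
    (ne_top_of_le_ne_top hcpt.measure_lt_top.ne (measure_mono hsub))
  have huniv : {x | volume U ≤ volume (V x)} = Set.univ := by
    ext x; simp [hvol]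
  rw [huniv] at hfin
  exact Set.finite_coe_iff.mp (Set.finite_univ_iff.mp hfin)

/-- The digit set as a finite set. -/
def Substitution.digits (σ : Substitution A) (i j : Fin n) : Finset (Rd d) :=
  (σ.digitSet_finite i j).toFinset

/-- The Fourier matrix `B(t)`, with entries `∑_{s ∈ T_{i,j}} exp(2π𝐢⟨s, t⟩)`. -/
def Substitution.fourierMatrix (σ : Substitution A) (t : Rd d) : Matrix (Fin n) (Fin n) ℂ :=
  fun i j => ∑ s ∈ σ.digits i j, Complex.exp (2 * Real.pi * Complex.I * (inner ℝ s t : ℝ))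

/-- The substitution acting on sets of tiles: `ρ(P) = ⋃_{T_j + x ∈ P} (ρ(T_j) + φ(x))`. -/
def Substitution.apply (σ : Substitution A) (P : Set (Tile d L)) : Set (Tile d L) :=
  {S | ∃ j x, (A j).shift x ∈ P ∧ S ∈ shiftPatch (σ.rule j) (σ.φ x)}

variable {m : ℕ}

/-- `ρ_{j₁} ∘ ρ_{j₂} ∘ ⋯ ∘ ρ_{jₙ}` for the word `[j₁, …, jₙ]`. -/
def applyWord (ρ : Fin m → Substitution A) (w : List (Fin m)) (P : Set (Tile d L)) :
    Set (Tile d L) :=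
  w.foldr (fun a Q => (ρ a).apply Q) P

/-- Finite local complexity of a family of substitution rules. -/
def HasFLC (ρ : Fin m → Substitution A) : Prop :=
  ∀ K : Set (Rd d), IsCompact K → ∃ F : Set (Set (Tile d L)), F.Finite ∧
    ∀ (a : Fin n) (w : List (Fin m)) (x : Rd d), w ≠ [] →
      ∃ Q ∈ F, ∃ v, meets (applyWord ρ w {A a}) ((fun y => y + x) '' K) = shiftPatch Q v

/-- A legal patch: a translate of it is included in some `ρ_{j₁} ∘ ⋯ ∘ ρ_{jₙ}(P)`, `n > 0`,
`P` in the alphabet. -/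
def IsLegal (ρ : Fin m → Substitution A) (P : Set (Tile d L)) : Prop :=
  ∃ (w : List (Fin m)) (a : Fin n) (v : Rd d), w ≠ [] ∧ P ⊆ shiftPatch (applyWord ρ w {A a}) v

/-- The word `i_k, i_{k+1}, …, i_{N-1}`. -/
def segment (i : ℕ → Fin m) (k N : ℕ) : List (Fin m) := (List.range' k (N - k)).map i

/-- `𝒯 0` is an S-adic tiling belonging to the directive sequence `i` for the family `ρ`, and
`𝒯 1, 𝒯 2, …` are its de-substituted tilings, along common sequences `N_l` and `P_l`:
`𝒯 k = lim_l ρ_{i_k} ∘ ⋯ ∘ ρ_{i_{N_l - 1}}(P_l)` for every `k`. Indices start at `0`. -/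
def IsSAdicTower (ρ : Fin m → Substitution A) (i : ℕ → Fin m) (𝒯 : ℕ → Set (Tile d L)) : Prop :=
  IsTiling (𝒯 0) ∧ ∃ (N : ℕ → ℕ) (P : ℕ → Set (Tile d L)), StrictMono N ∧ (∀ l, IsLegal ρ (P l)) ∧
    ∀ k, TendsLocalMatching (fun l => applyWord ρ (segment i k (N l)) (P l)) (𝒯 k)

/-! ### Patch frequencies -/

/-- The number of `t ∈ W` with `P + t ⊆ T`, divided by the Lebesgue measure of `W`. -/
def patchAverage (T P : Set (Tile d L)) (W : Set (Rd d)) : ℝ :=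
  ({t | t ∈ W ∧ shiftPatch P t ⊆ T}.ncard : ℝ) / volume.real W

/-- The patch frequencies of `T` converge: the averages over balls about the origin have a limit,
for every finite non-empty patch. -/
def HasPatchFrequencies (T : Set (Tile d L)) : Prop :=
  ∀ P : Set (Tile d L), P.Finite → P.Nonempty → IsPatch P →
    ∃ c : ℝ, Tendsto (fun R : ℝ => patchAverage T P (Metric.closedBall 0 R)) atTop (𝓝 c)

/-- The frequency of `P` in `T`. -/
def freq (T P : Set (Tile d L)) : ℝ :=
  limUnder atTop fun R : ℝ => patchAverage T P (Metric.closedBall 0 R)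

/-- The frequencies of `T` are also obtained by averaging over the ellipsoids `g⁻¹(B_R)`. -/
def FrequenciesAlong (T : Set (Tile d L)) (g : Rd d → Rd d) : Prop :=
  ∀ P : Set (Tile d L), P.Finite → P.Nonempty → IsPatch P →
    Tendsto (fun R : ℝ => patchAverage T P (g ⁻¹' Metric.closedBall 0 R)) atTop (𝓝 (freq T P))

/-- `D_i = {t | T_i + t ∈ T}`. -/
def locations (A : Fin n → Tile d L) (T : Set (Tile d L)) (i : Fin n) : Set (Rd d) :=
  {t | (A i).shift t ∈ T}

/-- The difference set `D_j - D_i`. -/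
def differences (A : Fin n → Tile d L) (T : Set (Tile d L)) (i j : Fin n) : Set (Rd d) :=
  {z | ∃ s ∈ locations A T j, ∃ t ∈ locations A T i, z = s - t}

/-- `ν_{i,j}(z)`, the frequency of `{T_i, T_j + z}` in `T`. -/
def pairFreq (A : Fin n → Tile d L) (T : Set (Tile d L)) (i j : Fin n) (z : Rd d) : ℝ :=
  freq T {A i, (A j).shift z}

/-! ### Complex Radon measures -/

/-- Continuous functions `ℝᵈ → ℂ` with compact support. -/
abbrev TestFun (d : ℕ) : Type := CompactlySupportedContinuousMap (Rd d) ℂ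

/-- Complex Radon measures on `ℝᵈ`, in the sense of Bourbaki: linear functionals on the space of
compactly supported continuous functions which, on the functions supported in a given compact set,
are bounded for the supremum norm. -/
def radon (d : ℕ) : Submodule ℂ (TestFun d →ₗ[ℂ] ℂ) where
  carrier := {μ | ∀ K : Set (Rd d), IsCompact K → ∃ C : ℝ, ∀ f : TestFun d,
    (∀ x, x ∉ K → f x = 0) → ∀ M : ℝ, (∀ x, ‖f x‖ ≤ M) → ‖μ f‖ ≤ C * M}
  zero_mem' := fun K _ => ⟨0, fun f _ M _ => by simp⟩
  add_mem' := by
    intro μ ν hμ hν K hK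
    obtain ⟨C, hC⟩ := hμ K hK
    obtain ⟨D, hD⟩ := hν K hK
    refine ⟨C + D, fun f hf M hM => ?_⟩
    rw [LinearMap.add_apply, add_mul]
    exact (norm_add_le _ _).trans (add_le_add (hC f hf M hM) (hD f hf M hM))
  smul_mem' := by
    intro c μ hμ K hK
    obtain ⟨C, hC⟩ := hμ K hK
    refine ⟨‖c‖ * C, fun f hf M hM => ?_⟩
    rw [LinearMap.smul_apply, norm_smul, mul_assoc]
    exact mul_le_mul_of_nonneg_left (hC f hf M hM) (norm_nonneg _)

/-- The type of complex Radon measures on `ℝᵈ`. -/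
abbrev RadonMeasure (d : ℕ) : Type := radon d

/-- The function `f ∘ g` for a homeomorphism `g`. -/
def TestFun.compHomeo (f : TestFun d) (g : Rd d ≃ₜ Rd d) : TestFun d :=
  ⟨⟨f ∘ g, f.continuous.comp g.continuous⟩, f.hasCompactSupport.comp_homeomorph g⟩

/-- The pointwise product `ξ f` with a continuous function. -/
def TestFun.mulLeft (ξ : C(Rd d, ℂ)) (f : TestFun d) : TestFun d :=
  ⟨⟨fun x => ξ x * f x, ξ.continuous.mul f.continuous⟩, f.hasCompactSupport.mul_left⟩

/-- The convolution of two compactly supported continuous functions. -/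
def TestFun.conv (f g : TestFun d) : TestFun d :=
  ⟨⟨convolution f g (ContinuousLinearMap.mul ℝ ℂ) volume,
    f.hasCompactSupport.continuous_convolution_left _ f.continuous
      (g.continuous.locallyIntegrable)⟩,
    f.hasCompactSupport.convolution _ g.hasCompactSupport⟩

/-- `g.μ`, given by `⟨g.μ, f⟩ = ⟨μ, f ∘ g⟩`. -/
def RadonMeasure.push (g : Rd d ≃ₜ Rd d) (μ : RadonMeasure d) : RadonMeasure d :=
  ⟨{ toFun := fun f => μ.1 (f.compHomeo g)
     map_add' := fun f₁ f₂ => μ.1.map_add (TestFun.compHomeo f₁ g) (TestFun.compHomeo f₂ g)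
     map_smul' := fun c f => μ.1.map_smul c (TestFun.compHomeo f g) }, by
    intro K hK
    obtain ⟨C, hC⟩ := μ.2 (g ⁻¹' K) (g.isCompact_preimage.mpr hK)
    exact ⟨C, fun f hf M hM => hC (f.compHomeo g) (fun x hx => hf (g x) hx) M fun x => hM (g x)⟩⟩

/-- `ξμ`, given by `⟨ξμ, f⟩ = ⟨μ, ξf⟩`, for a continuous function `ξ`. -/
def RadonMeasure.mulFun (ξ : C(Rd d, ℂ)) (μ : RadonMeasure d) : RadonMeasure d :=
  ⟨{ toFun := fun f => μ.1 (f.mulLeft ξ)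
     map_add' := fun f₁ f₂ => by
       rw [← map_add]; congr 1; ext x; exact mul_add _ _ _
     map_smul' := fun c f => by
       rw [← map_smul]; congr 1; ext x; exact mul_left_comm _ _ _ }, by
    intro K hK
    obtain ⟨C, hC⟩ := μ.2 K hK
    obtain ⟨B, hB⟩ := hK.exists_bound_of_continuousOn ξ.continuous.continuousOn
    refine ⟨C * |B|, fun f hf M hM => ?_⟩
    rw [mul_assoc]
    refine hC (f.mulLeft ξ) (fun x hx => ?_) _ fun x => ?_
    · show ξ x * f x = 0
      rw [hf x hx, mul_zero]
    · show ‖ξ x * f x‖ ≤ _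
      by_cases hx : x ∈ K
      · rw [norm_mul]
        exact mul_le_mul ((hB x hx).trans (le_abs_self B)) (hM x) (norm_nonneg _) (abs_nonneg _)
      · rw [hf x hx, mul_zero, norm_zero]
        exact mul_nonneg (abs_nonneg _) ((norm_nonneg _).trans (hM x))⟩

/-- The convolution `δ_a * μ`: `⟨δ_a * μ, f⟩ = ∫∫ f(s + t) dδ_a(s) dμ(t) = ∫ f(a + t) dμ(t)`. -/
def RadonMeasure.diracConv (a : Rd d) (μ : RadonMeasure d) : RadonMeasure d :=
  μ.push (Homeomorph.addLeft a)

theorem RadonMeasure.diracConv_apply (a : Rd d) (μ : RadonMeasure d) (f : TestFun d) :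
    (RadonMeasure.diracConv a μ).1 f =
      ∫ s, μ.1 (f.compHomeo (Homeomorph.addLeft s)) ∂(Measure.dirac a) := by
  rw [integral_dirac]; rfl

/-- The set `S` meets every compact set in a finite set. -/
def IsLocallyFiniteSet (S : Set (Rd d)) : Prop :=
  ∀ K : Set (Rd d), IsCompact K → (K ∩ S).Finite

open scoped Classical in
/-- The Radon measure `∑_{z ∈ S} c(z) δ_z` for a locally finite set `S` (and `0` otherwise). -/
def diracComb (S : Set (Rd d)) (c : Rd d → ℂ) : RadonMeasure d :=
  if h : IsLocallyFiniteSet S then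
    ⟨{ toFun := fun f => ∑ z ∈ (h (tsupport f) f.hasCompactSupport).toFinset, c z * f z
       map_add' := fun f g => by
         have key : ∀ (e : TestFun d) (s : Finset (Rd d)), (∀ z ∈ s, z ∈ S) →
             (h (tsupport e) e.hasCompactSupport).toFinset ⊆ s →
             ∑ z ∈ (h (tsupport e) e.hasCompactSupport).toFinset, c z * e z =
               ∑ z ∈ s, c z * e z := by
           intro e s hs hsub
           refine Finset.sum_subset hsub fun z hz hz2 => ?_
           have : z ∉ tsupport e := fun hze => hz2 (by simpa using ⟨hze, hs z hz⟩)
           rw [image_eq_zero_of_notMem_tsupport this, mul_zero]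
         let s := (h (tsupport (f + g)) (f + g).hasCompactSupport).toFinset ∪
           ((h (tsupport f) f.hasCompactSupport).toFinset ∪
             (h (tsupport g) g.hasCompactSupport).toFinset)
         have hs : ∀ z ∈ s, z ∈ S := by
           intro z hz
           simp only [s, Finset.mem_union, Set.Finite.mem_toFinset, Set.mem_inter_iff] at hz
           tauto
         rw [key (f + g) s hs Finset.subset_union_left,
           key f s hs (Finset.subset_union_left.trans Finset.subset_union_right),
           key g s hs (Finset.subset_union_right.trans Finset.subset_union_right),
           ← Finset.sum_add_distrib]
         exact Finset.sum_congr rfl fun z _ => mul_add _ _ _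
       map_smul' := fun a f => by
         have hsub : (h (tsupport (a • f)) (a • f).hasCompactSupport).toFinset ⊆
             (h (tsupport f) f.hasCompactSupport).toFinset := by
           intro z hz
           simp only [Set.Finite.mem_toFinset, Set.mem_inter_iff] at hz ⊢
           refine ⟨closure_mono (fun x hx => ?_) hz.1, hz.2⟩
           intro hfx
           exact hx (by simp [hfx])
         rw [Finset.sum_subset hsub fun z hz hz2 => ?_]
         · rw [RingHom.id_apply, smul_eq_mul, Finset.mul_sum]
           exact Finset.sum_congr rfl fun z _ => mul_left_comm _ _ _
         · simp only [Set.Finite.mem_toFinset, Set.mem_inter_iff] at hz hz2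
           have : z ∉ tsupport (a • f) := fun hze => hz2 ⟨hze, hz.2⟩
           rw [image_eq_zero_of_notMem_tsupport this, mul_zero] }, by
      intro K hK
      refine ⟨∑ z ∈ (h K hK).toFinset, ‖c z‖, fun f hf M hM => ?_⟩
      have hKs : tsupport f ⊆ K :=
        closure_minimal (fun x hx => by_contra fun hxK => hx (hf x hxK)) hK.isClosed
      refine (norm_sum_le _ _).trans ?_
      rw [Finset.sum_mul]
      refine (Finset.sum_le_sum fun z _ => ?_).trans
        (Finset.sum_le_sum_of_subset_of_nonneg (fun z hz => ?_) fun z _ _ => ?_)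
      · rw [norm_mul]
        exact mul_le_mul_of_nonneg_left (hM z) (norm_nonneg _)
      · simp only [Set.Finite.mem_toFinset, Set.mem_inter_iff] at hz ⊢
        exact ⟨hKs hz.1, hz.2⟩
      · exact mul_nonneg (norm_nonneg _) ((norm_nonneg _).trans (hM z))⟩
  else 0

/-- The pair-correlation measure `Υ_{i,j} = ∑_{z ∈ D_j - D_i} ν_{i,j}(z) δ_z` of `T`. -/
def pairCorrelation (A : Fin n → Tile d L) (T : Set (Tile d L)) (i j : Fin n) : RadonMeasure d :=
  diracComb (differences A T i j) fun z => (pairFreq A T i j z : ℂ)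

/-! ### Fourier transform and Lebesgue decomposition -/

/-- The polar decomposition `μ = u·m` of a complex Radon measure: `m = |μ|` is the total variation
and `u` has modulus one. Every complex Radon measure has one, with `m` unique and `u` unique
`m`-almost everywhere; `L¹(μ)` is `L¹(m)` and `∫ f dμ = ∫ f u dm`. -/
def IsPolar (μ : RadonMeasure d) (m : Measure (Rd d)) (u : Rd d → ℂ) : Prop :=
  IsLocallyFiniteMeasure m ∧ Measurable u ∧ (∀ x, ‖u x‖ = 1) ∧
    ∀ f : TestFun d, μ.1 f = ∫ x, f x * u x ∂m

/-- `ν` is a Fourier transform of `μ`: for all `f, g ∈ C_c`, the inverse Fourier transform of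
`f * g` is in `L¹(ν)` and its integral against `ν` is `⟨f * g, μ⟩`. -/
def IsFourierTransform (μ ν : RadonMeasure d) : Prop :=
  ∃ m u, IsPolar ν m u ∧ ∀ f g : TestFun d,
    Integrable (FourierTransformInv.fourierInv (f.conv g : Rd d → ℂ)) m ∧
    μ.1 (f.conv g) = ∫ t, FourierTransformInv.fourierInv (f.conv g : Rd d → ℂ) t * u t ∂m

/-- `μ` is Fourier transformable. -/
def FourierTransformable (μ : RadonMeasure d) : Prop := ∃ ν, IsFourierTransform μ ν

open scoped Classical in
/-- The Fourier transform of a Fourier transformable Radon measure (and `0` otherwise). -/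
def fourierTransform (μ : RadonMeasure d) : RadonMeasure d :=
  if h : FourierTransformable μ then h.choose else 0

/-- `h ∈ L¹_loc` is the Radon--Nikodym derivative of the absolutely continuous part of `μ`: the
difference of `μ` and the measure with Lebesgue density `h` is singular with respect to Lebesgue
measure (it is the sum of the pure point and the singular continuous part of `μ`). -/
def IsACDensity (μ : RadonMeasure d) (h : Rd d → ℂ) : Prop :=
  LocallyIntegrable h volume ∧ ∃ (μs : RadonMeasure d) (m : Measure (Rd d)) (u : Rd d → ℂ),
    IsPolar μs m u ∧ m ⟂ₘ volume ∧ ∀ f : TestFun d, μ.1 f = μs.1 f + ∫ x, f x * h x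

/-- The exponential function `exp_t(s) = exp(2π𝐢⟨s, t⟩)`. -/
def expFun (t : Rd d) : C(Rd d, ℂ) :=
  ⟨fun s => Complex.exp (2 * Real.pi * Complex.I * (inner ℝ s t : ℝ)), by fun_prop⟩

/-- The adjoint of an invertible linear map, as an invertible linear map. -/
def adjointEquiv (φ : Rd d ≃L[ℝ] Rd d) : Rd d ≃L[ℝ] Rd d :=
  ContinuousLinearEquiv.equivOfInverse
    (ContinuousLinearMap.adjoint (φ : Rd d →L[ℝ] Rd d))
    (ContinuousLinearMap.adjoint (φ.symm : Rd d →L[ℝ] Rd d))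
    (fun x => by
      rw [← ContinuousLinearMap.comp_apply, ← ContinuousLinearMap.adjoint_comp]
      refine ext_inner_right ℝ fun z => ?_
      rw [ContinuousLinearMap.adjoint_inner_left]
      simp)
    (fun x => by
      rw [← ContinuousLinearMap.comp_apply, ← ContinuousLinearMap.adjoint_comp]
      refine ext_inner_right ℝ fun z => ?_
      rw [ContinuousLinearMap.adjoint_inner_left]
      simp)

end SAdic

end

open SAdic MeasureTheory Filter Topology

noncomputable section

namespace SAdic

open FourierTransform Convolution

variable {d : ℕ}

/-! ### Fourier analysis of compactly supported continuous functions -/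

/-! The equation for the measures is a count. The tilings of the tower satisfy `𝒯 k = (ρ (i
k)).apply (𝒯 (k + 1))` (`IsSAdicTower.eq_apply`): expansion maps do not shrink lengths, so one
substitution can be separated off under the limit, and a patch cannot contain two small distinct
translates of one tile. A tile at level `k` lies in exactly one supertile. Hence a pair of tiles
with difference `z` comes from exactly one pair of digits `x`, `y` and one pair of parents, with
difference `φ⁻¹(z - (y - x))`. Counting in large balls gives the equation for frequencies
(`ncard_pairLocations_apply`, `pairFreq_apply`), which is the equation for measures read off at each
atom (`pairCorrelation_apply`). Local finiteness follows from finite local complexity, because any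
two tiles of `𝒯 k` occur together in an iterate of a single tile (`IsSAdicTower.exists_word`).

Fourier transformability comes from positivity. For tile types `a`, `b` and a scalar `w`, a suitable
combination of the four pair-correlation measures is the limit of finite-window correlations, whose
Fourier transforms are the positive measures with density `|S_a + w S_b|² / V`, where `S_a`, `S_b`
are exponential sums (`isTransformLimit_pairCorrelation`). A Bochner-type theorem
(`IsTransformLimit.fourierTransformable`) passes to the limit: masses of balls stay bounded, so the
positive measures converge vaguely along an ultrafilter, and an approximate identity shows that no
mass weighted by `|𝓕⁻ f|²` escapes to infinity. Polarization over `w = ±1, ±𝐢` isolates each mixed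
measure.

The rest is a calculus. Fourier transforms of Radon measures are unique
(`IsFourierTransform.unique`), turn translations into multiplication by exponentials, and turn
linear images into images under the inverse adjoint. Densities of absolutely continuous parts are
unique almost everywhere and obey corresponding rules, and the digit sums then factor into `B H B*`.
Sums destroy the unimodular factor of a polar decomposition, so the calculus is carried out with
arbitrary bounded densities (`IsRep`). -/

theorem TestFun.integrable (f : TestFun d) : Integrable (f : Rd d → ℂ) :=
  f.continuous.integrable_of_hasCompactSupport f.hasCompactSupport

theorem TestFun.integrable' (f : TestFun d) (m : Measure (Rd d)) [IsLocallyFiniteMeasure m] :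
    Integrable (f : Rd d → ℂ) m :=
  f.continuous.integrable_of_hasCompactSupport f.hasCompactSupport

theorem TestFun.fourierInv_apply (f : TestFun d) (ξ : Rd d) :
    𝓕⁻ (f : Rd d → ℂ) ξ = ∫ x, Complex.exp (2 * Real.pi * Complex.I * (inner ℝ x ξ : ℝ)) * f x := by
  rw [Real.fourierInv_eq']
  refine integral_congr_ae (Eventually.of_forall fun x => ?_)
  simp only [smul_eq_mul]
  congr 2
  push_cast
  ring

theorem continuous_fourierInv {f : Rd d → ℂ} (hf : Integrable f) : Continuous (𝓕⁻ f) := by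
  rw [Real.fourierInv_eq_fourier_comp_neg]
  exact VectorFourier.fourierIntegral_continuous Real.continuous_fourierChar
    (by exact continuous_inner) hf.comp_neg

theorem TestFun.continuous_fourierInv (f : TestFun d) : Continuous (𝓕⁻ (f : Rd d → ℂ)) :=
  SAdic.continuous_fourierInv f.integrable

theorem TestFun.fourierInv_conv (f g : TestFun d) (ξ : Rd d) :
    𝓕⁻ (f.conv g : Rd d → ℂ) ξ = 𝓕⁻ (f : Rd d → ℂ) ξ * 𝓕⁻ (g : Rd d → ℂ) ξ := by
  simp only [Real.fourierInv_eq_fourier_neg]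
  exact Real.fourier_mul_convolution_eq (R := ℂ) f.integrable g.integrable (-ξ)

/-- Plancherel: the inverse Fourier transform of a continuous function with compact support is
square integrable. -/
theorem TestFun.memLp_fourierInv (f : TestFun d) : MemLp (𝓕⁻ (f : Rd d → ℂ)) 2 volume := by
  have hf2 : MemLp (f : Rd d → ℂ) 2 volume :=
    f.continuous.memLp_of_hasCompactSupport f.hasCompactSupport
  set F : Lp ℂ 2 (volume : Measure (Rd d)) := hf2.toLp f
  set G : Lp ℂ 2 (volume : Measure (Rd d)) := 𝓕⁻ F
  -- The inverse transform taken in `L²` is identified with the pointwise integral by testing both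
  -- against smooth compactly supported functions, where each side moves the transform onto the test
  -- function.
  have hG : ∀ᵐ x : Rd d, G x = 𝓕⁻ (f : Rd d → ℂ) x := by
    refine ae_eq_of_integral_contDiff_smul_eq (μ := (volume : Measure (Rd d)))
      ((Lp.memLp G).locallyIntegrable (by norm_num))
      (f.continuous_fourierInv.locallyIntegrable) fun g hg hgc => ?_
    have hgc' : HasCompactSupport (fun x => (g x : ℂ)) := hgc.comp_left Complex.ofReal_zero
    have hg' : ContDiff ℝ (⊤ : ℕ∞) (fun x => (g x : ℂ)) := Complex.ofRealCLM.contDiff.comp hg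
    set φ : SchwartzMap (Rd d) ℂ := hgc'.toSchwartzMap hg'
    have hφ : ∀ x, φ x = (g x : ℂ) := fun x => rfl
    have h1 := congrArg (fun T => T φ) (Lp.fourierInv_toTemperedDistribution_eq F)
    simp only [TemperedDistribution.fourierInv_apply, Lp.toTemperedDistribution_apply] at h1
    have h2 : ∫ x, g x • G x = ∫ x, φ x • G x := by
      refine integral_congr_ae (Eventually.of_forall fun x => ?_)
      simp only [hφ, smul_eq_mul, Complex.real_smul]
    have h3 : ∫ x, (𝓕⁻ φ) x • F x = ∫ x, (𝓕⁻ φ) x • f x := by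
      refine integral_congr_ae ?_
      filter_upwards [hf2.coeFn_toLp] with x hx
      rw [hx]
    have h4 : ∫ x, (𝓕⁻ φ) x • f x = ∫ x, φ x • 𝓕⁻ (f : Rd d → ℂ) x := by
      rw [SchwartzMap.fourierInv_coe]
      have := VectorFourier.integral_fourierIntegral_smul_eq_flip (μ := volume) (ν := volume)
        (L := -innerₗ (Rd d)) (f := φ) (g := f) Real.continuous_fourierChar
        (by exact continuous_inner.neg) φ.integrable f.integrable
      refine this.trans (integral_congr_ae (Eventually.of_forall fun x => ?_))
      simp only [smul_eq_mul]
      congr 1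
      rw [Real.fourierInv_eq, VectorFourier.fourierIntegral]
      refine integral_congr_ae (Eventually.of_forall fun y => ?_)
      simp [real_inner_comm]
    have h5 : ∫ x, g x • 𝓕⁻ (f : Rd d → ℂ) x = ∫ x, φ x • 𝓕⁻ (f : Rd d → ℂ) x := by
      refine integral_congr_ae (Eventually.of_forall fun x => ?_)
      simp only [hφ, smul_eq_mul, Complex.real_smul]
    rw [h2, h5, ← h4, ← h3]
    exact h1.symm
  exact (Lp.memLp G).ae_eq hG

/-- A product of two square integrable functions. The factors themselves need not be integrable,
which is why transforms are tested on convolutions only. -/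
theorem TestFun.integrable_fourierInv_conv (f g : TestFun d) :
    Integrable (𝓕⁻ (f.conv g : Rd d → ℂ)) := by
  have h : 𝓕⁻ (f.conv g : Rd d → ℂ) = fun ξ => 𝓕⁻ (f : Rd d → ℂ) ξ * 𝓕⁻ (g : Rd d → ℂ) ξ :=
    funext (f.fourierInv_conv g)
  rw [h]
  exact f.memLp_fourierInv.integrable_mul g.memLp_fourierInv

/-- Fourier inversion for convolutions of continuous functions with compact support. -/
theorem TestFun.integral_exp_mul_fourierInv_conv (f g : TestFun d) (x : Rd d) :
    ∫ ξ, Complex.exp (-(2 * Real.pi * Complex.I * (inner ℝ x ξ : ℝ))) *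
      𝓕⁻ (f.conv g : Rd d → ℂ) ξ = f.conv g x := by
  have h0 : Integrable (𝓕 (f.conv g : Rd d → ℂ)) := by
    have := (f.integrable_fourierInv_conv g).comp_neg
    refine this.congr (Eventually.of_forall fun ξ => ?_)
    simp [Real.fourierInv_eq_fourier_neg]
  have h := congrFun
    (Continuous.fourier_fourierInv_eq (f.conv g).continuous (f.conv g).integrable h0) x
  refine Eq.trans ?_ h
  rw [Real.fourier_eq']
  refine integral_congr_ae (Eventually.of_forall fun ξ => ?_)
  simp only [smul_eq_mul]
  congr 2
  rw [real_inner_comm]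
  push_cast
  ring

/-- The function `x ↦ conj (f (-x))`. -/
def TestFun.reflect (f : TestFun d) : TestFun d :=
  ⟨⟨fun x => (starRingEnd ℂ) (f (-x)), by fun_prop⟩, by
    have h := f.hasCompactSupport.comp_homeomorph (Homeomorph.neg (Rd d))
    exact h.comp_left (g := starRingEnd ℂ) (map_zero _)⟩

theorem TestFun.fourierInv_reflect (f : TestFun d) (ξ : Rd d) :
    𝓕⁻ (f.reflect : Rd d → ℂ) ξ = (starRingEnd ℂ) (𝓕⁻ (f : Rd d → ℂ) ξ) := by
  rw [TestFun.fourierInv_apply, TestFun.fourierInv_apply, ← integral_conj,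
    ← integral_neg_eq_self]
  refine integral_congr_ae (Eventually.of_forall fun x => ?_)
  simp only [map_mul, ← Complex.exp_conj, Complex.conj_I, Complex.conj_ofReal, inner_neg_left]
  congr 1
  · congr 1
    simp [Complex.conj_ofNat]
  · change (starRingEnd ℂ) (f (- -x)) = _
    rw [neg_neg]

/-- The source of positivity: integrating this function against a positive measure gives a squared
`L²` norm. -/
theorem TestFun.fourierInv_conv_reflect (f : TestFun d) (ξ : Rd d) :
    𝓕⁻ (f.conv f.reflect : Rd d → ℂ) ξ = ((‖𝓕⁻ (f : Rd d → ℂ) ξ‖ ^ 2 : ℝ) : ℂ) := by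
  rw [TestFun.fourierInv_conv, TestFun.fourierInv_reflect, Complex.mul_conj,
    Complex.normSq_eq_norm_sq]

/-- A normalized bump function of radius `r` as a test function. -/
theorem exists_normed_bump {r : ℝ} (hr : 0 < r) : ∃ (φ : ContDiffBump (0 : Rd d)) (ρ : TestFun d),
    φ.rOut = r ∧ ∀ x, ρ x = (φ.normed volume x : ℂ) := by
  refine ⟨⟨r / 2, r, by positivity, by linarith⟩, ⟨⟨fun x => (ContDiffBump.normed _ volume x : ℂ),
    Complex.continuous_ofReal.comp (ContDiffBump.continuous_normed _)⟩, ?_⟩, rfl, fun x => rfl⟩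
  exact (ContDiffBump.hasCompactSupport_normed _).comp_left Complex.ofReal_zero

theorem norm_fourierInv_le_one {φ : ContDiffBump (0 : Rd d)} {ρ : TestFun d}
    (h : ∀ x, ρ x = (φ.normed volume x : ℂ)) (ξ : Rd d) : ‖𝓕⁻ (ρ : Rd d → ℂ) ξ‖ ≤ 1 := by
  rw [Real.fourierInv_eq]
  refine (norm_integral_le_integral_norm _).trans ?_
  rw [← φ.integral_normed (μ := volume)]
  refine (integral_congr_ae (Eventually.of_forall fun x => ?_)).le
  simp only [Circle.norm_smul, h, Complex.norm_real, Real.norm_eq_abs]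
  exact abs_of_nonneg (φ.nonneg_normed x)

theorem tendsto_fourierInv_cocompact (f : TestFun d) :
    Tendsto (𝓕⁻ (f : Rd d → ℂ)) (cocompact (Rd d)) (𝓝 0) := by
  rw [Real.fourierInv_eq_fourier_comp_neg]
  exact tendsto_integral_exp_inner_smul_cocompact _

/-- For every radius there is a test function whose inverse Fourier transform does not vanish
on the ball with that radius. -/
theorem exists_half_le_norm_fourierInv (M : ℝ) : ∃ f : TestFun d,
    ∀ ξ : Rd d, ‖ξ‖ ≤ M → 1 / 2 ≤ ‖𝓕⁻ (f : Rd d → ℂ) ξ‖ := by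
  -- With this radius `2π‖x‖‖ξ‖ ≤ 1/2` on the support of the bump, so the character, and with it its
  -- average, stays within `1/2` of one.
  set r : ℝ := 1 / (2 * (2 * Real.pi * (|M| + 1))) with hr
  have hπ := Real.pi_pos
  have hr0 : 0 < r := by positivity
  obtain ⟨φ, ρ, hφ, hρ⟩ := exists_normed_bump (d := d) hr0
  refine ⟨ρ, fun ξ hξ => ?_⟩
  -- The minus sign compensates that the convolution at `0` evaluates `g` at `0 - x`.
  set g : Rd d → ℂ := fun x => Complex.exp (-(2 * Real.pi * Complex.I * (inner ℝ x ξ : ℝ))) with hg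
  have hgc : Continuous g := by fun_prop
  have key := ContDiffBump.dist_normed_convolution_le (φ := φ) (μ := volume) (g := g) (x₀ := 0)
    (ε := 1 / 2) hgc.aestronglyMeasurable (fun x hx => ?_)
  · have h1 : (φ.normed volume ⋆[ContinuousLinearMap.lsmul ℝ ℝ, volume] g) 0 =
        𝓕⁻ (ρ : Rd d → ℂ) ξ := by
      rw [TestFun.fourierInv_apply]
      refine integral_congr_ae (Eventually.of_forall fun x => ?_)
      simp only [ContinuousLinearMap.lsmul_apply, Complex.real_smul, hg, hρ, zero_sub,
        inner_neg_left]
      rw [mul_comm]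
      congr 2
      push_cast
      ring
    have h2 : g 0 = 1 := by simp [hg]
    rw [h1, h2, dist_eq_norm] at key
    have h3 : ‖(1 : ℂ)‖ ≤ ‖𝓕⁻ (ρ : Rd d → ℂ) ξ‖ + ‖𝓕⁻ (ρ : Rd d → ℂ) ξ - 1‖ := by
      have := norm_sub_le (𝓕⁻ (ρ : Rd d → ℂ) ξ) (𝓕⁻ (ρ : Rd d → ℂ) ξ - 1)
      simpa using this
    rw [norm_one] at h3
    linarith
  · rw [hφ, mem_ball_zero_iff] at hx
    have h2 : g 0 = 1 := by simp [hg]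
    rw [h2, dist_eq_norm]
    have h3 : g x = Complex.exp (Complex.I * ((-(2 * Real.pi * inner ℝ x ξ) : ℝ) : ℂ)) := by
      simp only [hg]
      congr 1
      push_cast
      ring
    rw [h3]
    refine Real.norm_exp_I_mul_ofReal_sub_one_le.trans ?_
    rw [norm_neg, norm_mul, Real.norm_of_nonneg (by positivity)]
    have h4 : ‖inner ℝ x ξ‖ ≤ r * (|M| + 1) := by
      refine (norm_inner_le_norm x ξ).trans ?_
      exact mul_le_mul hx.le (by linarith [le_abs_self M]) (norm_nonneg _) hr0.le
    calc 2 * Real.pi * ‖inner ℝ x ξ‖ ≤ 2 * Real.pi * (r * (|M| + 1)) := by gcongr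
      _ = 1 / 2 := by rw [hr]; field_simp

/-- By uniform continuity, convolution with a narrow bump changes `h` uniformly little and only
inside a fixed compact set, on which `μ` is bounded. The bound on the transform of the bump is what
tightness needs later. -/
theorem exists_approxIdentity (μ : RadonMeasure d) (h : TestFun d) {δ : ℝ} (hδ : 0 < δ) :
    ∃ ρ : TestFun d, (∀ ξ, ‖𝓕⁻ (ρ : Rd d → ℂ) ξ‖ ≤ 1) ∧ ‖μ.1 h - μ.1 (h.conv ρ)‖ ≤ δ := by
  set K := Metric.cthickening 1 (tsupport h) with hK
  obtain ⟨C, hC⟩ := μ.2 K h.hasCompactSupport.isCompact.cthickening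
  set η := δ / (|C| + 1) with hη
  have hη0 : 0 < η := by positivity
  have huc := h.hasCompactSupport.uniformContinuous_of_continuous h.continuous
  obtain ⟨r, hr, hr'⟩ := Metric.uniformContinuous_iff.mp huc η hη0
  -- Capping the radius at one keeps the support of the convolution in the 1-thickening `K`, on
  -- which `C` was chosen beforehand.
  obtain ⟨φ, ρ, hφ, hρ⟩ := exists_normed_bump (d := d) (lt_min hr one_pos)
  refine ⟨ρ, norm_fourierInv_le_one hρ, ?_⟩
  have hconv : ∀ x, h.conv ρ x =
      (φ.normed volume ⋆[ContinuousLinearMap.lsmul ℝ ℝ, volume] (h : Rd d → ℂ)) x := by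
    intro x
    change (convolution h ρ (ContinuousLinearMap.mul ℝ ℂ) volume) x = _
    rw [convolution_eq_swap]
    refine integral_congr_ae (Eventually.of_forall fun t => ?_)
    simp [hρ, mul_comm]
  have hsub : ∀ x, ‖(h - h.conv ρ) x‖ ≤ η := by
    intro x
    have := ContDiffBump.dist_normed_convolution_le (φ := φ) (μ := volume) (g := (h : Rd d → ℂ))
      (x₀ := x) (ε := η) h.continuous.aestronglyMeasurable (fun y hy => by
        refine (hr' ?_).le
        rw [hφ] at hy
        exact lt_of_lt_of_le hy (min_le_left _ _))
    rw [← hconv, dist_comm, dist_eq_norm] at this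
    exact this
  have hsupp : ∀ x, x ∉ K → (h - h.conv ρ) x = 0 := by
    intro x hx
    have h1 : ∀ y, dist y x ≤ 1 → h y = 0 := by
      intro y hy
      by_contra hne
      exact hx (Metric.mem_cthickening_of_dist_le x y 1 _ (subset_tsupport _ hne)
        (by rwa [dist_comm]))
    have h2 : h.conv ρ x = 0 := by
      rw [hconv]
      refine integral_eq_zero_of_ae (Eventually.of_forall fun t => ?_)
      simp only [ContinuousLinearMap.lsmul_apply, Pi.zero_apply]
      by_cases ht : ‖t‖ ≤ 1
      · rw [h1 (x - t) (by simpa [dist_eq_norm] using ht), smul_zero]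
      · have : φ.normed volume t = 0 := by
          rw [← Function.notMem_support, φ.support_normed_eq, mem_ball_zero_iff, hφ]
          intro h3
          exact ht (h3.le.trans (min_le_right _ _))
        rw [this, zero_smul]
    change h x - h.conv ρ x = 0
    rw [h1 x (by simp), h2, sub_zero]
  have := hC (h - h.conv ρ) hsupp η hsub
  rw [map_sub] at this
  refine this.trans ?_
  calc C * η ≤ (|C| + 1) * η := by gcongr; linarith [le_abs_self C]
    _ = δ := by rw [hη]; field_simp

/-! ### Translations and linear changes of variables -/

theorem TestFun.fourierInv_compHomeo_addLeft (f : TestFun d) (a ξ : Rd d) :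
    𝓕⁻ (f.compHomeo (Homeomorph.addLeft a) : Rd d → ℂ) ξ = expFun (-a) ξ * 𝓕⁻ (f : Rd d → ℂ) ξ := by
  rw [TestFun.fourierInv_apply, TestFun.fourierInv_apply, ← integral_const_mul,
    ← integral_add_left_eq_self (fun x => expFun (-a) ξ * _) a]
  refine integral_congr_ae (Eventually.of_forall fun x => ?_)
  change _ * f (a + x) = Complex.exp _ * (_ * f (a + x))
  rw [← mul_assoc, ← Complex.exp_add, inner_add_left, inner_neg_right, real_inner_comm a ξ]
  congr 2
  push_cast
  ring

theorem TestFun.conv_compHomeo_addLeft (f g : TestFun d) (a : Rd d) :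
    (f.conv g).compHomeo (Homeomorph.addLeft a) = (f.compHomeo (Homeomorph.addLeft a)).conv g := by
  ext x
  change ∫ t, f t * g (a + x - t) = ∫ t, f (a + t) * g (x - t)
  rw [← integral_add_left_eq_self (fun t => f t * g (a + x - t)) a]
  simp only [add_sub_add_left_eq_sub]

/-- The absolute value of the determinant. -/
def absDet (φ : Rd d ≃L[ℝ] Rd d) : ℝ := |LinearMap.det (φ.toLinearEquiv : Rd d →ₗ[ℝ] Rd d)|

theorem absDet_pos (φ : Rd d ≃L[ℝ] Rd d) : 0 < absDet φ :=
  abs_pos.mpr (LinearEquiv.isUnit_det' φ.toLinearEquiv).ne_zero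

theorem map_clEquiv_volume (φ : Rd d ≃L[ℝ] Rd d) :
    Measure.map φ (volume : Measure (Rd d)) = ENNReal.ofReal (absDet φ)⁻¹ • volume := by
  have := Measure.map_linearMap_addHaar_eq_smul_addHaar (volume : Measure (Rd d))
    (f := (φ.toLinearEquiv : Rd d →ₗ[ℝ] Rd d)) (LinearEquiv.isUnit_det' φ.toLinearEquiv).ne_zero
  rw [abs_inv] at this
  exact this

theorem integral_comp_clEquiv (φ : Rd d ≃L[ℝ] Rd d) (f : Rd d → ℂ) :
    ∫ x, f (φ x) = ((absDet φ : ℂ))⁻¹ * ∫ x, f x := by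
  have h2 : ∫ x, f (φ x) = ∫ x, f x ∂(Measure.map φ volume) :=
    (φ.toHomeomorph.measurableEmbedding.integral_map f).symm
  rw [h2, map_clEquiv_volume, integral_smul_measure, ENNReal.toReal_ofReal (inv_nonneg.mpr (absDet_pos φ).le)]
  simp

theorem TestFun.conv_compHomeo_clEquiv (f g : TestFun d) (φ : Rd d ≃L[ℝ] Rd d) :
    (f.conv g).compHomeo φ.toHomeomorph =
      (absDet φ : ℂ) • (f.compHomeo φ.toHomeomorph).conv (g.compHomeo φ.toHomeomorph) := by
  ext x
  have hne : (absDet φ : ℂ) ≠ 0 := by exact_mod_cast (absDet_pos φ).ne'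
  change ∫ t, f t * g (φ x - t) = (absDet φ : ℂ) * ∫ t, f (φ t) * g (φ (x - t))
  simp only [map_sub]
  rw [integral_comp_clEquiv φ (fun t => f t * g (φ x - t)), mul_inv_cancel_left₀ hne]

theorem adjointEquiv_apply (φ : Rd d ≃L[ℝ] Rd d) (x : Rd d) :
    adjointEquiv φ x = ContinuousLinearMap.adjoint (φ : Rd d →L[ℝ] Rd d) x := rfl

theorem inner_adjointEquiv (φ : Rd d ≃L[ℝ] Rd d) (x y : Rd d) :
    inner ℝ x (adjointEquiv φ y) = inner ℝ (φ x) y := by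
  rw [adjointEquiv_apply, ContinuousLinearMap.adjoint_inner_right]
  rfl

theorem absDet_adjointEquiv (φ : Rd d ≃L[ℝ] Rd d) : absDet (adjointEquiv φ) = absDet φ := by
  unfold absDet
  congr 1
  have h : ((adjointEquiv φ).toLinearEquiv : Rd d →ₗ[ℝ] Rd d) =
      LinearMap.adjoint (φ.toLinearEquiv : Rd d →ₗ[ℝ] Rd d) := by
    rw [LinearMap.eq_adjoint_iff]
    intro x y
    have := inner_adjointEquiv φ y x
    rw [real_inner_comm, real_inner_comm x] at this
    exact this
  let b := (EuclideanSpace.basisFun (Fin d) ℝ)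
  rw [h, ← LinearMap.det_toMatrix b.toBasis, LinearMap.toMatrix_adjoint, Matrix.det_conjTranspose,
    LinearMap.det_toMatrix]
  simp

theorem TestFun.fourierInv_compHomeo_clEquiv (f : TestFun d) (φ : Rd d ≃L[ℝ] Rd d) (ξ : Rd d) :
    𝓕⁻ (f.compHomeo φ.toHomeomorph : Rd d → ℂ) ξ =
      (absDet φ : ℂ)⁻¹ * 𝓕⁻ (f : Rd d → ℂ) ((adjointEquiv φ).symm ξ) := by
  rw [TestFun.fourierInv_apply, TestFun.fourierInv_apply, ← integral_comp_clEquiv φ]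
  refine integral_congr_ae (Eventually.of_forall fun x => ?_)
  change _ * f (φ x) = _ * f (φ x)
  congr 4
  rw [← inner_adjointEquiv, ContinuousLinearEquiv.apply_symm_apply]

end SAdic

end

noncomputable section

namespace SAdic

open FourierTransform Convolution
open scoped NNReal ENNReal

variable {d : ℕ}

/-! ### Representations of complex Radon measures by bounded densities -/

/-- `μ = w·m` with `m` locally finite and `w` bounded and measurable. -/
structure IsRep (μ : RadonMeasure d) (m : Measure (Rd d)) (w : Rd d → ℂ) : Prop where
  finite : IsLocallyFiniteMeasure m
  meas : Measurable w
  bdd : ∃ C, ∀ x, ‖w x‖ ≤ C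
  apply : ∀ f : TestFun d, μ.1 f = ∫ x, f x * w x ∂m

theorem IsPolar.isRep {μ : RadonMeasure d} {m : Measure (Rd d)} {u : Rd d → ℂ}
    (h : IsPolar μ m u) : IsRep μ m u :=
  ⟨h.1, h.2.1, ⟨1, fun x => (h.2.2.1 x).le⟩, h.2.2.2⟩

theorem RadonMeasure.ext {μ ν : RadonMeasure d} (h : ∀ f, μ.1 f = ν.1 f) : μ = ν :=
  Subtype.ext (LinearMap.ext h)

theorem RadonMeasure.add_apply (μ ν : RadonMeasure d) (f : TestFun d) :
    (μ + ν).1 f = μ.1 f + ν.1 f := rfl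

theorem RadonMeasure.smul_apply (c : ℂ) (μ : RadonMeasure d) (f : TestFun d) :
    (c • μ).1 f = c * μ.1 f := rfl

theorem RadonMeasure.sum_apply {ι : Type*} (s : Finset ι) (μ : ι → RadonMeasure d) (f : TestFun d) :
    (∑ i ∈ s, μ i).1 f = ∑ i ∈ s, (μ i).1 f := by
  classical
  induction s using Finset.induction_on with
  | empty => rfl
  | insert a s ha ih => rw [Finset.sum_insert ha, Finset.sum_insert ha, ← ih]; rfl

/-- The Radon–Nikodym derivative is at most one almost everywhere; truncation makes the bound hold
at every point, as `IsRep` demands. -/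
theorem exists_density_of_le {m M : Measure (Rd d)} [SigmaFinite M] [SigmaFinite m] (h : m ≤ M) :
    ∃ r : Rd d → ℝ≥0, Measurable r ∧ (∀ x, r x ≤ 1) ∧ m = M.withDensity (fun x => (r x : ℝ≥0∞)) := by
  refine ⟨fun x => min 1 (m.rnDeriv M x).toNNReal,
    measurable_const.min (Measure.measurable_rnDeriv m M).ennreal_toNNReal,
    fun x => min_le_left _ _, ?_⟩
  have hac : m ≪ M := Measure.absolutelyContinuous_of_le h
  conv_lhs => rw [← Measure.withDensity_rnDeriv_eq m M hac]
  refine withDensity_congr_ae ?_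
  filter_upwards [Measure.rnDeriv_le_one_of_le h] with x hx
  have hx' : m.rnDeriv M x ≤ 1 := hx
  have hne : m.rnDeriv M x ≠ ⊤ := ne_top_of_le_ne_top ENNReal.one_ne_top hx'
  rw [min_eq_right, ENNReal.coe_toNNReal hne]
  rw [← ENNReal.coe_le_coe, ENNReal.coe_toNNReal hne]
  exact hx'

theorem integrable_mul_of_bdd {m : Measure (Rd d)} {φ w : Rd d → ℂ} (hφ : Integrable φ m)
    (hw : Measurable w) (hb : ∃ C, ∀ x, ‖w x‖ ≤ C) : Integrable (fun x => φ x * w x) m := by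
  obtain ⟨C, hC⟩ := hb
  exact hφ.mul_bdd (c := C) hw.aestronglyMeasurable (Eventually.of_forall hC)

theorem exists_isRep (m : Measure (Rd d)) [IsLocallyFiniteMeasure m] {w : Rd d → ℂ}
    (hw : Measurable w) (hb : ∃ C, ∀ x, ‖w x‖ ≤ C) : ∃ μ : RadonMeasure d, IsRep μ m w := by
  have hi : ∀ f : TestFun d, Integrable (fun x => f x * w x) m := fun f =>
    integrable_mul_of_bdd (f.integrable' m) hw hb
  refine ⟨⟨{ toFun := fun f => ∫ x, f x * w x ∂m, map_add' := ?_, map_smul' := ?_ }, ?_⟩,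
    inferInstance, hw, hb, fun f => rfl⟩
  · intro f g
    rw [← integral_add (hi f) (hi g)]
    exact integral_congr_ae (Eventually.of_forall fun x => add_mul (f x) (g x) (w x))
  · intro c f
    rw [RingHom.id_apply, smul_eq_mul, ← integral_const_mul]
    exact integral_congr_ae (Eventually.of_forall fun x => mul_assoc c (f x) (w x))
  · intro K hK
    obtain ⟨C, hC⟩ := hb
    refine ⟨C * m.real K, fun f hf M hM => ?_⟩
    have h1 : ∫ x, f x * w x ∂m = ∫ x in K, f x * w x ∂m :=
      (setIntegral_eq_integral_of_forall_compl_eq_zero fun x hx => by rw [hf x hx, zero_mul]).symm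
    have h2 := norm_setIntegral_le_of_norm_le_const (μ := m) (s := K) (C := M * C)
      (f := fun x => f x * w x) hK.measure_lt_top (fun x _ => by
        rw [norm_mul]
        exact mul_le_mul (hM x) (hC x) (norm_nonneg _) ((norm_nonneg _).trans (hM x)))
    change ‖∫ x, f x * w x ∂m‖ ≤ _
    rw [h1]
    refine h2.trans (le_of_eq ?_)
    ring

theorem IsRep.zero : IsRep (0 : RadonMeasure d) 0 0 :=
  ⟨inferInstance, measurable_zero, ⟨0, fun x => by simp⟩, fun f => by simp⟩

theorem IsRep.smul {μ : RadonMeasure d} {m : Measure (Rd d)} {w : Rd d → ℂ} (h : IsRep μ m w)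
    (c : ℂ) : IsRep (c • μ) m (fun x => c * w x) := by
  obtain ⟨C, hC⟩ := h.bdd
  refine ⟨h.finite, h.meas.const_mul c, ⟨‖c‖ * C, fun x => ?_⟩, fun f => ?_⟩
  · rw [norm_mul]
    exact mul_le_mul_of_nonneg_left (hC x) (norm_nonneg _)
  · rw [RadonMeasure.smul_apply, h.apply, ← integral_const_mul]
    simp only [mul_left_comm]

theorem IsRep.mulFun {μ : RadonMeasure d} {m : Measure (Rd d)} {w : Rd d → ℂ} (h : IsRep μ m w)
    {ξ : C(Rd d, ℂ)} (hξ : ∀ x, ‖ξ x‖ ≤ 1) :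
    IsRep (RadonMeasure.mulFun ξ μ) m (fun x => ξ x * w x) := by
  obtain ⟨C, hC⟩ := h.bdd
  refine ⟨h.finite, ξ.continuous.measurable.mul h.meas, ⟨C, fun x => ?_⟩, fun f => ?_⟩
  · rw [norm_mul]
    exact (mul_le_of_le_one_left (norm_nonneg _) (hξ x)).trans (hC x)
  · change μ.1 (f.mulLeft ξ) = _
    rw [h.apply]
    refine integral_congr_ae (Eventually.of_forall fun x => ?_)
    change ξ x * f x * w x = f x * (ξ x * w x)
    ring

theorem isLocallyFiniteMeasure_map_homeomorph (g : Rd d ≃ₜ Rd d) (m : Measure (Rd d))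
    [IsLocallyFiniteMeasure m] : IsLocallyFiniteMeasure (m.map g) := by
  refine ⟨fun x => ?_⟩
  obtain ⟨s, hs, hms⟩ := m.finiteAt_nhds (g.symm x)
  refine ⟨g '' s, ?_, ?_⟩
  · have := (g.isOpenMap.image_mem_nhds hs)
    rwa [g.apply_symm_apply] at this
  · rwa [g.measurableEmbedding.map_apply, g.injective.preimage_image]

theorem IsRep.push {μ : RadonMeasure d} {m : Measure (Rd d)} {w : Rd d → ℂ} (h : IsRep μ m w)
    (g : Rd d ≃ₜ Rd d) : IsRep (RadonMeasure.push g μ) (m.map g) (fun x => w (g.symm x)) := by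
  obtain ⟨C, hC⟩ := h.bdd
  have := h.finite
  refine ⟨isLocallyFiniteMeasure_map_homeomorph g m, h.meas.comp g.symm.continuous.measurable,
    ⟨C, fun x => hC _⟩, fun f => ?_⟩
  change μ.1 (f.compHomeo g) = _
  rw [h.apply, g.measurableEmbedding.integral_map]
  simp only [g.symm_apply_apply]
  rfl

theorem integral_density {m M : Measure (Rd d)} {r : Rd d → ℝ≥0} (hr : Measurable r)
    (h : m = M.withDensity (fun x => (r x : ℝ≥0∞))) (φ : Rd d → ℂ) :
    ∫ x, φ x ∂m = ∫ x, φ x * (r x : ℂ) ∂M := by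
  rw [h, integral_withDensity_eq_integral_smul hr]
  refine integral_congr_ae (Eventually.of_forall fun x => ?_)
  change (r x : ℝ) • φ x = _
  rw [Complex.real_smul, mul_comm]

theorem integrable_density {m M : Measure (Rd d)} {r : Rd d → ℝ≥0} (hr : Measurable r)
    (h : m = M.withDensity (fun x => (r x : ℝ≥0∞))) {φ : Rd d → ℂ} (hφ : Integrable φ m) :
    Integrable (fun x => φ x * (r x : ℂ)) M := by
  rw [h, integrable_withDensity_iff_integrable_smul hr] at hφ
  refine hφ.congr (Eventually.of_forall fun x => ?_)
  change (r x : ℝ) • φ x = _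
  rw [Complex.real_smul, mul_comm]

theorem isLocallyFiniteMeasure_add (m₁ m₂ : Measure (Rd d)) [IsLocallyFiniteMeasure m₁]
    [IsLocallyFiniteMeasure m₂] : IsLocallyFiniteMeasure (m₁ + m₂) := by
  refine ⟨fun x => ?_⟩
  obtain ⟨s, hs, hs'⟩ := m₁.finiteAt_nhds x
  obtain ⟨t, ht, ht'⟩ := m₂.finiteAt_nhds x
  refine ⟨s ∩ t, inter_mem hs ht, ?_⟩
  rw [Measure.add_apply]
  exact ENNReal.add_lt_top.mpr ⟨(measure_mono Set.inter_subset_left).trans_lt hs',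
    (measure_mono Set.inter_subset_right).trans_lt ht'⟩

/-- Both measures have density at most one with respect to their sum, so weighting `w₁` and `w₂` by
these densities gives a bounded density. The integral formula covers all functions integrable
against both measures, because transforms of test functions lack compact support. -/
theorem IsRep.add {μ₁ μ₂ : RadonMeasure d} {m₁ m₂ : Measure (Rd d)} {w₁ w₂ : Rd d → ℂ}
    (h₁ : IsRep μ₁ m₁ w₁) (h₂ : IsRep μ₂ m₂ w₂) :
    ∃ w, IsRep (μ₁ + μ₂) (m₁ + m₂) w ∧ ∀ φ : Rd d → ℂ, Integrable φ m₁ → Integrable φ m₂ →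
      ∫ x, φ x * w x ∂(m₁ + m₂) = ∫ x, φ x * w₁ x ∂m₁ + ∫ x, φ x * w₂ x ∂m₂ := by
  have := h₁.finite
  have := h₂.finite
  have : IsLocallyFiniteMeasure (m₁ + m₂) := isLocallyFiniteMeasure_add m₁ m₂
  obtain ⟨r₁, hr₁, hb₁, hm₁⟩ := exists_density_of_le (m := m₁) (M := m₁ + m₂)
    (Measure.le_add_right le_rfl)
  obtain ⟨r₂, hr₂, hb₂, hm₂⟩ := exists_density_of_le (m := m₂) (M := m₁ + m₂)
    (Measure.le_add_left le_rfl)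
  set w : Rd d → ℂ := fun x => w₁ x * (r₁ x : ℂ) + w₂ x * (r₂ x : ℂ) with hw
  have key : ∀ φ : Rd d → ℂ, Integrable φ m₁ → Integrable φ m₂ →
      ∫ x, φ x * w x ∂(m₁ + m₂) = ∫ x, φ x * w₁ x ∂m₁ + ∫ x, φ x * w₂ x ∂m₂ := by
    intro φ hφ₁ hφ₂
    rw [integral_density hr₁ hm₁, integral_density hr₂ hm₂, ← integral_add
      (integrable_density hr₁ hm₁ (integrable_mul_of_bdd hφ₁ h₁.meas h₁.bdd))
      (integrable_density hr₂ hm₂ (integrable_mul_of_bdd hφ₂ h₂.meas h₂.bdd))]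
    refine integral_congr_ae (Eventually.of_forall fun x => ?_)
    simp only [hw]
    ring
  refine ⟨w, ⟨inferInstance, ?_, ?_, fun f => ?_⟩, key⟩
  · have e₁ : Measurable fun x => (r₁ x : ℂ) :=
      Complex.measurable_ofReal.comp (measurable_coe_nnreal_real.comp hr₁)
    have e₂ : Measurable fun x => (r₂ x : ℂ) :=
      Complex.measurable_ofReal.comp (measurable_coe_nnreal_real.comp hr₂)
    exact (h₁.meas.mul e₁).add (h₂.meas.mul e₂)
  · obtain ⟨C₁, hC₁⟩ := h₁.bdd
    obtain ⟨C₂, hC₂⟩ := h₂.bdd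
    have hn : ∀ r : ℝ≥0, ‖((r : ℝ) : ℂ)‖ = r := fun r => by simp
    refine ⟨C₁ + C₂, fun x => (norm_add_le _ _).trans (add_le_add ?_ ?_)⟩
    · rw [norm_mul, hn]
      exact (mul_le_of_le_one_right (norm_nonneg _) (hb₁ x)).trans (hC₁ x)
    · rw [norm_mul, hn]
      exact (mul_le_of_le_one_right (norm_nonneg _) (hb₂ x)).trans (hC₂ x)
  · rw [key f (f.integrable' m₁) (f.integrable' m₂), RadonMeasure.add_apply, h₁.apply, h₂.apply]

/-- Every representation by a bounded density gives a polar decomposition. -/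
theorem IsRep.exists_polar {μ : RadonMeasure d} {m : Measure (Rd d)} {w : Rd d → ℂ}
    (h : IsRep μ m w) : ∃ m' u, IsPolar μ m' u ∧ m' ≪ m ∧ ∀ φ : Rd d → ℂ, Integrable φ m →
      Integrable φ m' ∧ ∫ x, φ x * u x ∂m' = ∫ x, φ x * w x ∂m := by
  classical
  have := h.finite
  obtain ⟨C, hC⟩ := h.bdd
  set r : Rd d → ℝ≥0 := fun x => ‖w x‖₊ with hr
  have hrm : Measurable r := h.meas.nnnorm
  set m' := m.withDensity (fun x => (r x : ℝ≥0∞)) with hm'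
  -- The value one on the zero set of `w` keeps `u` unimodular everywhere; `m'` does not charge that
  -- set.
  set u : Rd d → ℂ := fun x => if w x = 0 then 1 else w x / (‖w x‖ : ℂ) with hu
  have hw : ∀ x, u x * (r x : ℂ) = w x := by
    intro x
    by_cases hx : w x = 0
    · simp [hu, hr, hx]
    · simp only [hu, hr, if_neg hx, coe_nnnorm]
      exact div_mul_cancel₀ _ (by simpa using hx)
  have key : ∀ φ : Rd d → ℂ, ∫ x, φ x * u x ∂m' = ∫ x, φ x * w x ∂m := by
    intro φ
    rw [integral_density hrm hm']
    simp only [mul_assoc, hw]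
  have hle : m' ≤ (Real.toNNReal C) • m := by
    have hconst : Real.toNNReal C • m = m.withDensity fun _ => ((Real.toNNReal C : ℝ≥0) : ℝ≥0∞) := by
      rw [withDensity_const]
      rfl
    rw [hm', hconst]
    refine withDensity_mono (Eventually.of_forall fun x => ?_)
    change ((r x : ℝ≥0) : ℝ≥0∞) ≤ ((Real.toNNReal C : ℝ≥0) : ℝ≥0∞)
    rw [ENNReal.coe_le_coe]
    exact NNReal.le_toNNReal_of_coe_le (hC x)
  refine ⟨m', u, ⟨Measure.isLocallyFiniteMeasure_of_le hle, ?_, fun x => ?_, fun f => ?_⟩,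
    withDensity_absolutelyContinuous _ _, fun φ hφ => ⟨?_, key φ⟩⟩
  · exact Measurable.ite (h.meas (measurableSet_singleton 0)) measurable_const
      (h.meas.div (Complex.measurable_ofReal.comp h.meas.norm))
  · by_cases hx : w x = 0
    · simp [hu, hx]
    · simp only [hu, if_neg hx, norm_div, Complex.norm_real, norm_norm]
      exact div_self (by simpa using hx)
  · rw [key, h.apply]
  · exact hφ.of_measure_le_smul (by simp) hle

/-! ### Calculus of Fourier transforms of Radon measures -/

/-- `IsRep.exists_polar` preserves integrability and integrals, so unimodularity of the density may
be dropped. All rules below are proved in this form. -/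
theorem isFourierTransform_iff {μ ν : RadonMeasure d} : IsFourierTransform μ ν ↔
    ∃ m w, IsRep ν m w ∧ ∀ f g : TestFun d,
      Integrable (𝓕⁻ (f.conv g : Rd d → ℂ)) m ∧
      μ.1 (f.conv g) = ∫ t, 𝓕⁻ (f.conv g : Rd d → ℂ) t * w t ∂m := by
  constructor
  · rintro ⟨m, u, h, h'⟩
    exact ⟨m, u, h.isRep, h'⟩
  · rintro ⟨m, w, h, h'⟩
    obtain ⟨m', u, hp, -, hi⟩ := h.exists_polar
    refine ⟨m', u, hp, fun f g => ⟨(hi _ (h' f g).1).1, ?_⟩⟩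
    rw [(h' f g).2, (hi _ (h' f g).1).2]

theorem IsFourierTransform.zero : IsFourierTransform (0 : RadonMeasure d) 0 :=
  isFourierTransform_iff.mpr ⟨0, 0, IsRep.zero, fun f g => ⟨integrable_zero_measure, by simp⟩⟩

theorem IsFourierTransform.add {μ₁ μ₂ ν₁ ν₂ : RadonMeasure d} (h₁ : IsFourierTransform μ₁ ν₁)
    (h₂ : IsFourierTransform μ₂ ν₂) : IsFourierTransform (μ₁ + μ₂) (ν₁ + ν₂) := by
  obtain ⟨m₁, w₁, hr₁, hi₁⟩ := isFourierTransform_iff.mp h₁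
  obtain ⟨m₂, w₂, hr₂, hi₂⟩ := isFourierTransform_iff.mp h₂
  obtain ⟨w, hw, hi⟩ := hr₁.add hr₂
  refine isFourierTransform_iff.mpr ⟨m₁ + m₂, w, hw, fun f g => ⟨?_, ?_⟩⟩
  · exact (hi₁ f g).1.add_measure (hi₂ f g).1
  · rw [hi _ (hi₁ f g).1 (hi₂ f g).1, RadonMeasure.add_apply, (hi₁ f g).2, (hi₂ f g).2]

theorem IsFourierTransform.smul {μ ν : RadonMeasure d} (h : IsFourierTransform μ ν) (c : ℂ) :
    IsFourierTransform (c • μ) (c • ν) := by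
  obtain ⟨m, w, hr, hi⟩ := isFourierTransform_iff.mp h
  refine isFourierTransform_iff.mpr ⟨m, _, hr.smul c, fun f g => ⟨(hi f g).1, ?_⟩⟩
  rw [RadonMeasure.smul_apply, (hi f g).2, ← integral_const_mul]
  simp only [mul_left_comm]

theorem IsFourierTransform.sum {ι : Type*} (s : Finset ι) {μ ν : ι → RadonMeasure d}
    (h : ∀ i ∈ s, IsFourierTransform (μ i) (ν i)) :
    IsFourierTransform (∑ i ∈ s, μ i) (∑ i ∈ s, ν i) := by
  classical
  induction s using Finset.induction_on with
  | empty => exact IsFourierTransform.zero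
  | insert a s ha ih =>
    rw [Finset.sum_insert ha, Finset.sum_insert ha]
    exact (h a (Finset.mem_insert_self a s)).add
      (ih fun i hi => h i (Finset.mem_insert_of_mem hi))

theorem norm_expFun (a x : Rd d) : ‖expFun a x‖ = 1 := by
  change ‖Complex.exp _‖ = 1
  rw [show (2 * Real.pi * Complex.I * (inner ℝ x a : ℝ) : ℂ) =
    ((2 * Real.pi * inner ℝ x a : ℝ) : ℂ) * Complex.I by push_cast; ring]
  exact Complex.norm_exp_ofReal_mul_I _

/-- The translation is absorbed by the first factor, so a translated convolution is again a
convolution. -/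
theorem IsFourierTransform.diracConv {μ ν : RadonMeasure d} (h : IsFourierTransform μ ν)
    (a : Rd d) :
    IsFourierTransform (RadonMeasure.diracConv a μ) (RadonMeasure.mulFun (expFun (-a)) ν) := by
  obtain ⟨m, w, hr, hi⟩ := isFourierTransform_iff.mp h
  refine isFourierTransform_iff.mpr ⟨m, _, hr.mulFun fun x => (norm_expFun (-a) x).le,
    fun f g => ⟨(hi f g).1, ?_⟩⟩
  change μ.1 ((f.conv g).compHomeo (Homeomorph.addLeft a)) = _
  rw [TestFun.conv_compHomeo_addLeft, (hi _ g).2]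
  refine integral_congr_ae (Eventually.of_forall fun x => ?_)
  simp only
  rw [TestFun.fourierInv_conv, TestFun.fourierInv_conv, TestFun.fourierInv_compHomeo_addLeft]
  ring

/-- Composing a convolution with `φ` produces one factor `|det φ|`, and each of the two inverse
transforms one factor `|det φ|⁻¹`; a single `|det φ|⁻¹` remains. -/
theorem IsFourierTransform.push {μ ν : RadonMeasure d} (h : IsFourierTransform μ ν)
    (φ : Rd d ≃L[ℝ] Rd d) :
    IsFourierTransform (RadonMeasure.push φ.toHomeomorph μ)
      (((absDet φ : ℂ))⁻¹ • RadonMeasure.push (adjointEquiv φ).symm.toHomeomorph ν) := by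
  obtain ⟨m, w, hr, hi⟩ := isFourierTransform_iff.mp h
  have hne : (absDet φ : ℂ) ≠ 0 := by exact_mod_cast (absDet_pos φ).ne'
  have key : ∀ f g : TestFun d, ∀ ξ, 𝓕⁻ (f.conv g : Rd d → ℂ) ((adjointEquiv φ).symm ξ) =
      (absDet φ : ℂ) ^ 2 * 𝓕⁻ ((f.compHomeo φ.toHomeomorph).conv
        (g.compHomeo φ.toHomeomorph) : Rd d → ℂ) ξ := by
    intro f g ξ
    rw [TestFun.fourierInv_conv, TestFun.fourierInv_conv, TestFun.fourierInv_compHomeo_clEquiv,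
      TestFun.fourierInv_compHomeo_clEquiv]
    field_simp
  refine isFourierTransform_iff.mpr ⟨_, _,
    (hr.push (adjointEquiv φ).symm.toHomeomorph).smul _, fun f g => ⟨?_, ?_⟩⟩
  · rw [(adjointEquiv φ).symm.toHomeomorph.measurableEmbedding.integrable_map_iff]
    refine ((hi (f.compHomeo φ.toHomeomorph) (g.compHomeo φ.toHomeomorph)).1.const_mul
      ((absDet φ : ℂ) ^ 2)).congr (Eventually.of_forall fun ξ => ?_)
    exact (key f g ξ).symm
  · change μ.1 ((f.conv g).compHomeo φ.toHomeomorph) = _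
    rw [TestFun.conv_compHomeo_clEquiv, map_smul, (hi _ _).2,
      (adjointEquiv φ).symm.toHomeomorph.measurableEmbedding.integral_map, smul_eq_mul,
      ← integral_const_mul]
    refine integral_congr_ae (Eventually.of_forall fun ξ => ?_)
    simp only [Homeomorph.symm_apply_apply]
    change _ = 𝓕⁻ (f.conv g : Rd d → ℂ) ((adjointEquiv φ).symm ξ) * _
    rw [key]
    field_simp

/-- Every smooth compactly supported `g` is `𝓕⁻` of the Schwartz function `𝓕 g`. By Fubini,
integrating `g W` amounts to integrating `𝓕 g` against the transform of `W m`, which vanishes. -/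
theorem ae_eq_zero_of_forall_integral_exp {m : Measure (Rd d)} [IsLocallyFiniteMeasure m]
    {W : Rd d → ℂ} (hW : Integrable W m)
    (h : ∀ x, ∫ ξ, Complex.exp (2 * Real.pi * Complex.I * (inner ℝ x ξ : ℝ)) * W ξ ∂m = 0) :
    ∀ᵐ ξ ∂m, W ξ = 0 := by
  refine ae_eq_zero_of_integral_contDiff_smul_eq_zero hW.locallyIntegrable fun g hg hgc => ?_
  have hgc' : HasCompactSupport (fun x => (g x : ℂ)) := hgc.comp_left Complex.ofReal_zero
  have hg' : ContDiff ℝ (⊤ : ℕ∞) (fun x => (g x : ℂ)) := Complex.ofRealCLM.contDiff.comp hg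
  set φ : SchwartzMap (Rd d) ℂ := hgc'.toSchwartzMap hg'
  have hφ : ∀ x, φ x = (g x : ℂ) := fun x => rfl
  set ψ : SchwartzMap (Rd d) ℂ := 𝓕 φ with hψ
  have hψφ : 𝓕⁻ ψ = φ := FourierTransform.fourierInv_fourier_eq φ
  have h1 := VectorFourier.integral_fourierIntegral_smul_eq_flip (μ := volume) (ν := m)
    (L := -innerₗ (Rd d)) (f := ψ) (g := W) Real.continuous_fourierChar
    (by exact continuous_inner.neg) ψ.integrable hW
  have h2 : ∀ ξ, VectorFourier.fourierIntegral Real.fourierChar volume (-innerₗ (Rd d)) (ψ) ξ =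
      (g ξ : ℂ) := by
    intro ξ
    rw [← hφ, ← hψφ, SchwartzMap.fourierInv_coe]
    rfl
  have h3 : ∀ x, VectorFourier.fourierIntegral Real.fourierChar m (-innerₗ (Rd d)).flip W x = 0 := by
    intro x
    rw [← h x, VectorFourier.fourierIntegral]
    refine integral_congr_ae (Eventually.of_forall fun y => ?_)
    simp only [Circle.smul_def, Real.fourierChar_apply, smul_eq_mul]
    congr 2
    simp
    ring
  simp only [h2, h3, smul_zero, integral_zero] at h1
  rw [← h1]
  refine integral_congr_ae (Eventually.of_forall fun x => ?_)
  simp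

/-- Translating one factor of `f.conv f` shows that all exponential integrals of the integrable
function `𝓕⁻(f.conv f) w` vanish, so it is zero almost everywhere. Countably many `f`, one per
integer radius with `𝓕⁻ f` nonzero on that ball, force `w = 0`. -/
theorem IsFourierTransform.eq_zero {ν : RadonMeasure d} (h : IsFourierTransform 0 ν) : ν = 0 := by
  obtain ⟨m, w, hr, hi⟩ := isFourierTransform_iff.mp h
  have := hr.finite
  have key : ∀ f : TestFun d, ∀ᵐ ξ ∂m, 𝓕⁻ (f : Rd d → ℂ) ξ = 0 ∨ w ξ = 0 := by
    intro f
    have h1 : ∀ᵐ ξ ∂m, 𝓕⁻ (f.conv f : Rd d → ℂ) ξ * w ξ = 0 := by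
      refine ae_eq_zero_of_forall_integral_exp
        (integrable_mul_of_bdd (hi f f).1 hr.meas hr.bdd) fun x => ?_
      have h2 := (hi (f.compHomeo (Homeomorph.addLeft (-x))) f).2
      rw [show (0 : RadonMeasure d).1 _ = 0 from rfl] at h2
      rw [h2]
      refine integral_congr_ae (Eventually.of_forall fun ξ => ?_)
      simp only
      rw [TestFun.fourierInv_conv, TestFun.fourierInv_conv, TestFun.fourierInv_compHomeo_addLeft,
        neg_neg, real_inner_comm]
      change _ = Complex.exp _ * _ * _ * _
      ring
    filter_upwards [h1] with ξ hξ
    rw [TestFun.fourierInv_conv] at hξ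
    rcases mul_eq_zero.mp hξ with h3 | h3
    · exact Or.inl (mul_self_eq_zero.mp h3)
    · exact Or.inr h3
  have hw : ∀ᵐ ξ ∂m, w ξ = 0 := by
    choose f hf using fun M : ℕ => exists_half_le_norm_fourierInv (d := d) M
    filter_upwards [ae_all_iff.mpr fun M => key (f M)] with ξ hξ
    obtain ⟨M, hM⟩ := exists_nat_ge ‖ξ‖
    refine (hξ M).resolve_left fun h0 => ?_
    have := hf M ξ hM
    rw [h0, norm_zero] at this
    norm_num at this
  refine RadonMeasure.ext fun f => ?_
  rw [hr.apply]
  refine integral_eq_zero_of_ae ?_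
  filter_upwards [hw] with ξ hξ
  simp [hξ]

/-- The Fourier transform of a Radon measure is unique. -/
theorem IsFourierTransform.unique {μ ν ν' : RadonMeasure d} (h : IsFourierTransform μ ν)
    (h' : IsFourierTransform μ ν') : ν = ν' := by
  have h1 := h.add (h'.smul (-1))
  rw [neg_one_smul ℂ μ, neg_one_smul ℂ ν', add_neg_cancel, ← sub_eq_add_neg] at h1
  exact sub_eq_zero.mp h1.eq_zero

theorem FourierTransformable.isFourierTransform {μ : RadonMeasure d} (h : FourierTransformable μ) :
    IsFourierTransform μ (fourierTransform μ) := by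
  unfold fourierTransform
  rw [dif_pos h]
  exact h.choose_spec

theorem IsFourierTransform.fourierTransform_eq {μ ν : RadonMeasure d}
    (h : IsFourierTransform μ ν) : fourierTransform μ = ν :=
  (FourierTransformable.isFourierTransform ⟨ν, h⟩).unique h

end SAdic

end

noncomputable section

namespace SAdic

open FourierTransform Convolution
open scoped NNReal ENNReal

variable {d : ℕ}

/-! ### Limits of positive measures on the Fourier side -/

/-- The positive measures `γ i` approximate the Fourier transform of `μ` along `l`: their
integrals against `𝓕⁻ (f * g)` converge to `⟨μ, f * g⟩`. -/
structure IsTransformLimit {ι : Type*} (μ : RadonMeasure d) (l : Filter ι)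
    (γ : ι → Measure (Rd d)) : Prop where
  finite : ∀ i, IsLocallyFiniteMeasure (γ i)
  integrable : ∀ i, ∀ f g : TestFun d, Integrable (𝓕⁻ (f.conv g : Rd d → ℂ)) (γ i)
  tendsto : ∀ f g : TestFun d,
    Tendsto (fun i => ∫ ξ, 𝓕⁻ (f.conv g : Rd d → ℂ) ξ ∂(γ i)) l (𝓝 (μ.1 (f.conv g)))

/-- A continuous cutoff function. -/
def cutoff (M : ℝ) (ξ : Rd d) : ℝ := max 0 (min 1 (M + 1 - ‖ξ‖))

theorem cutoff_nonneg (M : ℝ) (ξ : Rd d) : 0 ≤ cutoff M ξ := le_max_left _ _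

theorem cutoff_le_one (M : ℝ) (ξ : Rd d) : cutoff M ξ ≤ 1 :=
  max_le zero_le_one (min_le_left _ _)

theorem cutoff_eq_one {M : ℝ} {ξ : Rd d} (h : ‖ξ‖ ≤ M) : cutoff M ξ = 1 := by
  unfold cutoff
  rw [min_eq_left (by linarith), max_eq_right zero_le_one]

theorem continuous_cutoff (M : ℝ) : Continuous (cutoff M : Rd d → ℝ) := by
  unfold cutoff
  fun_prop

theorem hasCompactSupport_cutoff (M : ℝ) : HasCompactSupport (cutoff M : Rd d → ℝ) := by
  refine HasCompactSupport.intro (isCompact_closedBall 0 (M + 1)) fun ξ hξ => ?_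
  rw [mem_closedBall_zero_iff, not_le] at hξ
  unfold cutoff
  exact max_eq_left ((min_le_right _ _).trans (by linarith))

theorem TestFun.integrable_sq_norm_fourierInv {m : Measure (Rd d)} {f : TestFun d}
    (h : Integrable (𝓕⁻ (f.conv f.reflect : Rd d → ℂ)) m) :
    Integrable (fun ξ => ‖𝓕⁻ (f : Rd d → ℂ) ξ‖ ^ 2) m := by
  refine h.norm.congr (Eventually.of_forall fun ξ => ?_)
  simp only
  rw [TestFun.fourierInv_conv_reflect, Complex.norm_real, Real.norm_of_nonneg (by positivity)]

theorem TestFun.integral_fourierInv_conv_reflect (m : Measure (Rd d)) (f : TestFun d) :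
    ∫ ξ, 𝓕⁻ (f.conv f.reflect : Rd d → ℂ) ξ ∂m =
      ((∫ ξ, ‖𝓕⁻ (f : Rd d → ℂ) ξ‖ ^ 2 ∂m : ℝ) : ℂ) := by
  rw [← integral_complex_ofReal]
  exact integral_congr_ae (Eventually.of_forall fun ξ => f.fourierInv_conv_reflect ξ)

namespace IsTransformLimit

variable {ι : Type*} {μ : RadonMeasure d} {l : Filter ι} {γ : ι → Measure (Rd d)}

theorem mono (h : IsTransformLimit μ l γ) {l' : Filter ι} (hl : l' ≤ l) :
    IsTransformLimit μ l' γ :=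
  ⟨h.finite, h.integrable, fun f g => (h.tendsto f g).mono_left hl⟩

theorem tendsto_integral_sq (h : IsTransformLimit μ l γ) (f : TestFun d) :
    Tendsto (fun i => ∫ ξ, ‖𝓕⁻ (f : Rd d → ℂ) ξ‖ ^ 2 ∂(γ i)) l
      (𝓝 (μ.1 (f.conv f.reflect)).re) := by
  have h1 := (Complex.continuous_re.tendsto _).comp (h.tendsto f f.reflect)
  refine h1.congr fun i => ?_
  simp only [Function.comp, TestFun.integral_fourierInv_conv_reflect, Complex.ofReal_re]

/-- Choosing `f` with `|𝓕⁻ f| ≥ 1/2` on the ball, a quarter of its mass is at most the integral of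
`|𝓕⁻ f|²`, which converges along `l`. -/
theorem exists_measure_closedBall_le (h : IsTransformLimit μ l γ) (M : ℝ) :
    ∃ C : ℝ, ∀ᶠ i in l, (γ i).real (Metric.closedBall 0 M) ≤ C := by
  obtain ⟨f, hf⟩ := exists_half_le_norm_fourierInv (d := d) M
  refine ⟨4 * ((μ.1 (f.conv f.reflect)).re + 1), ?_⟩
  filter_upwards [(h.tendsto_integral_sq f).eventually (gt_mem_nhds (lt_add_one _))] with i hi
  have := h.finite i
  have hint := TestFun.integrable_sq_norm_fourierInv (h.integrable i f f.reflect)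
  have h1 : (γ i).real (Metric.closedBall 0 M) * (1 / 4) ≤
      ∫ ξ, ‖𝓕⁻ (f : Rd d → ℂ) ξ‖ ^ 2 ∂(γ i) := by
    calc (γ i).real (Metric.closedBall 0 M) * (1 / 4)
        = ∫ ξ in Metric.closedBall (0 : Rd d) M, (1 / 4 : ℝ) ∂(γ i) := by
          rw [setIntegral_const, smul_eq_mul]
      _ ≤ ∫ ξ in Metric.closedBall (0 : Rd d) M, ‖𝓕⁻ (f : Rd d → ℂ) ξ‖ ^ 2 ∂(γ i) := by
          refine setIntegral_mono_on (integrableOn_const (isCompact_closedBall _ _).measure_lt_top.ne)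
            hint.integrableOn Metric.isClosed_closedBall.measurableSet fun ξ hξ => ?_
          have := hf ξ (by simpa using hξ)
          nlinarith
      _ ≤ _ := setIntegral_le_integral hint (Eventually.of_forall fun ξ => by positivity)
  linarith

theorem exists_tendsto_integral {U : Ultrafilter ι} (h : IsTransformLimit μ (U : Filter ι) γ)
    (F : CompactlySupportedContinuousMap (Rd d) ℝ) :
    ∃ y : ℝ, Tendsto (fun i => ∫ ξ, F ξ ∂(γ i)) U (𝓝 y) := by
  obtain ⟨M, hM⟩ := F.hasCompactSupport.isCompact.isBounded.subset_closedBall 0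
  obtain ⟨C, hC⟩ := h.exists_measure_closedBall_le M
  obtain ⟨B, hB⟩ := F.hasCompactSupport.exists_bound_of_continuous F.continuous
  have hb : ∀ᶠ i in (U : Filter ι), ∫ ξ, F ξ ∂(γ i) ∈ Set.Icc (-(B * C)) (B * C) := by
    filter_upwards [hC] with i hi
    have := h.finite i
    have hB0 : 0 ≤ B := (norm_nonneg _).trans (hB 0)
    rw [Set.mem_Icc, ← abs_le, ← Real.norm_eq_abs]
    have h1 : ∫ ξ, F ξ ∂(γ i) = ∫ ξ in Metric.closedBall 0 M, F ξ ∂(γ i) :=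
      (setIntegral_eq_integral_of_forall_compl_eq_zero fun x hx =>
        image_eq_zero_of_notMem_tsupport fun h => hx (hM h)).symm
    rw [h1]
    refine (norm_setIntegral_le_of_norm_le_const (isCompact_closedBall _ _).measure_lt_top
      fun x _ => hB x).trans ?_
    exact mul_le_mul_of_nonneg_left hi hB0
  obtain ⟨y, -, hy⟩ := isCompact_Icc.ultrafilter_le_nhds
    (U.map fun i => ∫ ξ, F ξ ∂(γ i)) (le_principal_iff.mpr hb)
  exact ⟨y, hy⟩

/-- Vague compactness: along an ultrafilter the measures `γ i` converge vaguely. -/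
theorem exists_vague_limit {U : Ultrafilter ι} (h : IsTransformLimit μ (U : Filter ι) γ) :
    ∃ ν : Measure (Rd d), IsLocallyFiniteMeasure ν ∧
      ∀ F : TestFun d, Tendsto (fun i => ∫ ξ, F ξ ∂(γ i)) U (𝓝 (∫ ξ, F ξ ∂ν)) := by
  choose T hT using h.exists_tendsto_integral
  have hi : ∀ i, ∀ F : CompactlySupportedContinuousMap (Rd d) ℝ, Integrable F (γ i) := by
    intro i F
    have := h.finite i
    exact F.continuous.integrable_of_hasCompactSupport F.hasCompactSupport
  -- Limits along `U` are linear and monotone in `F`, so the Riesz representation theorem supplies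
  -- the limit measure; complex test functions are split into real and imaginary parts.
  let Λ₀ : CompactlySupportedContinuousMap (Rd d) ℝ →ₗ[ℝ] ℝ :=
    { toFun := T
      map_add' := fun F G => by
        refine tendsto_nhds_unique (hT (F + G)) (((hT F).add (hT G)).congr fun i => ?_)
        exact (integral_add (hi i F) (hi i G)).symm
      map_smul' := fun c F => by
        refine tendsto_nhds_unique (hT (c • F)) (((hT F).const_mul c).congr fun i => ?_)
        exact (integral_const_mul c _).symm }
  let Λ : CompactlySupportedContinuousMap (Rd d) ℝ →ₚ[ℝ] ℝ :=
    PositiveLinearMap.mk₀ Λ₀ fun F hF =>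
      ge_of_tendsto (hT F) (Eventually.of_forall fun i => integral_nonneg hF)
  have hΛ : ∀ F, ∫ ξ, F ξ ∂(RealRMK.rieszMeasure Λ) = T F := fun F =>
    RealRMK.integral_rieszMeasure Λ F
  refine ⟨RealRMK.rieszMeasure Λ, inferInstance, fun F => ?_⟩
  let R : CompactlySupportedContinuousMap (Rd d) ℝ :=
    ⟨⟨fun x => (F x).re, Complex.continuous_re.comp F.continuous⟩,
      F.hasCompactSupport.comp_left Complex.zero_re⟩
  let I : CompactlySupportedContinuousMap (Rd d) ℝ :=
    ⟨⟨fun x => (F x).im, Complex.continuous_im.comp F.continuous⟩,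
      F.hasCompactSupport.comp_left Complex.zero_im⟩
  have key : ∀ m : Measure (Rd d), IsLocallyFiniteMeasure m →
      ∫ ξ, F ξ ∂m = ((∫ ξ, R ξ ∂m : ℝ) : ℂ) + ((∫ ξ, I ξ ∂m : ℝ) : ℂ) * Complex.I := by
    intro m hm
    exact (integral_re_add_im (𝕜 := ℂ) (F.integrable' m)).symm
  rw [key _ inferInstance, hΛ, hΛ]
  refine Tendsto.congr (fun i => (key _ (h.finite i)).symm) ?_
  exact ((Complex.continuous_ofReal.tendsto _).comp (hT R)).add
    (((Complex.continuous_ofReal.tendsto _).comp (hT I)).mul_const _)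

theorem integrable_cutoff_compl {m : Measure (Rd d)} {F : Rd d → ℝ} (hF : Integrable F m) (M : ℝ) :
    Integrable (fun ξ => (1 - cutoff M ξ) * F ξ) m := by
  refine hF.bdd_mul (c := 1) (continuous_const.sub (continuous_cutoff M)).aestronglyMeasurable
    (Eventually.of_forall fun ξ => ?_)
  rw [Real.norm_eq_abs, abs_le]
  constructor <;> linarith [cutoff_nonneg M ξ, cutoff_le_one M ξ]

/-- Uniform tightness of the measures `‖𝓕⁻ f‖² γ i`. -/
theorem eventually_integral_cutoff_compl_le (h : IsTransformLimit μ l γ) (f : TestFun d) {δ : ℝ}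
    (hδ : 0 < δ) : ∃ M₀ : ℝ, ∀ M ≥ M₀, ∀ᶠ i in l,
      ∫ ξ, (1 - cutoff M ξ) * ‖𝓕⁻ (f : Rd d → ℂ) ξ‖ ^ 2 ∂(γ i) ≤ δ := by
  set H := f.conv f.reflect with hH
  -- By Riemann–Lebesgue, `1 - cutoff M ≤ 2(1 - Re 𝓕⁻ ρ)` for large `M`. Multiplied by `|𝓕⁻ f|² = 𝓕⁻
  -- H` and integrated, the right side tends to `2 Re(μ(H) - μ(H * ρ))`; the choice `δ / 4` puts
  -- this at `δ / 2` or less.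
  obtain ⟨ρ, hρ1, hρ⟩ := exists_approxIdentity μ H (δ := δ / 4) (by positivity)
  have h0 := (tendsto_fourierInv_cocompact ρ).norm
  rw [norm_zero] at h0
  have h1 := h0.eventually (gt_mem_nhds (show (0 : ℝ) < 1 / 2 by norm_num))
  rw [← Metric.cobounded_eq_cocompact, ← comap_norm_atTop, eventually_comap] at h1
  obtain ⟨M₀, hM₀⟩ := eventually_atTop.mp h1
  refine ⟨M₀, fun M hM => ?_⟩
  have h2 : ∀ ξ : Rd d, (1 - cutoff M ξ) ≤ 2 * (1 - (𝓕⁻ (ρ : Rd d → ℂ) ξ).re) := by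
    intro ξ
    by_cases hξ : ‖ξ‖ ≤ M
    · rw [cutoff_eq_one hξ]
      linarith [(Complex.re_le_norm (𝓕⁻ (ρ : Rd d → ℂ) ξ)).trans (hρ1 ξ)]
    · have h3 := hM₀ ‖ξ‖ (by linarith) ξ rfl
      linarith [cutoff_nonneg M ξ, Complex.re_le_norm (𝓕⁻ (ρ : Rd d → ℂ) ξ)]
  have h3 : Tendsto (fun i => 2 * (∫ ξ, 𝓕⁻ (H : Rd d → ℂ) ξ ∂(γ i) -
      ∫ ξ, 𝓕⁻ (H.conv ρ : Rd d → ℂ) ξ ∂(γ i)).re) l (𝓝 (2 * (μ.1 H - μ.1 (H.conv ρ)).re)) :=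
    ((Complex.continuous_re.tendsto _).comp
      ((h.tendsto f f.reflect).sub (h.tendsto H ρ))).const_mul 2
  have h4 : 2 * (μ.1 H - μ.1 (H.conv ρ)).re < δ := by
    linarith [(Complex.re_le_norm (μ.1 H - μ.1 (H.conv ρ))).trans hρ]
  filter_upwards [h3.eventually (gt_mem_nhds h4)] with i hi
  refine le_trans ?_ hi.le
  have hsq := TestFun.integrable_sq_norm_fourierInv (h.integrable i f f.reflect)
  have hHi := h.integrable i f f.reflect
  have hρi := h.integrable i H ρ
  have hsub : Integrable (fun ξ => 𝓕⁻ (f.conv f.reflect : Rd d → ℂ) ξ -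
    𝓕⁻ (H.conv ρ : Rd d → ℂ) ξ) (γ i) := hHi.sub hρi
  rw [← integral_sub hHi hρi, ← RCLike.re_eq_complex_re, ← integral_re hsub, ← integral_const_mul]
  refine integral_mono (integrable_cutoff_compl hsq M) (hsub.re.const_mul 2) fun ξ => ?_
  simp only
  rw [TestFun.fourierInv_conv H ρ, hH, TestFun.fourierInv_conv_reflect, RCLike.re_eq_complex_re,
    Complex.sub_re, Complex.re_ofReal_mul, Complex.ofReal_re]
  have h5 := h2 ξ
  have h6 : 0 ≤ ‖𝓕⁻ (f : Rd d → ℂ) ξ‖ ^ 2 := by positivity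
  nlinarith [mul_le_mul_of_nonneg_right h5 h6]

/-- The inequality `|uv| ≤ (|u|² + |v|²)/2` reduces the mixed case to tightness for `f` and `g`
separately. -/
theorem norm_integral_cutoff_compl_le (h : IsTransformLimit μ l γ) (f g : TestFun d) {δ : ℝ}
    (hδ : 0 < δ) : ∃ M₀ : ℝ, ∀ M ≥ M₀, ∀ᶠ i in l,
      ‖∫ ξ, (1 - cutoff M ξ : ℝ) * 𝓕⁻ (f.conv g : Rd d → ℂ) ξ ∂(γ i)‖ ≤ δ := by
  obtain ⟨M₁, h₁⟩ := h.eventually_integral_cutoff_compl_le f hδ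
  obtain ⟨M₂, h₂⟩ := h.eventually_integral_cutoff_compl_le g hδ
  refine ⟨max M₁ M₂, fun M hM => ?_⟩
  filter_upwards [h₁ M ((le_max_left _ _).trans hM), h₂ M ((le_max_right _ _).trans hM)]
    with i hi₁ hi₂
  have hf := integrable_cutoff_compl
    (TestFun.integrable_sq_norm_fourierInv (h.integrable i f f.reflect)) M
  have hg := integrable_cutoff_compl
    (TestFun.integrable_sq_norm_fourierInv (h.integrable i g g.reflect)) M
  have h3 : ‖∫ ξ, (1 - cutoff M ξ : ℝ) * 𝓕⁻ (f.conv g : Rd d → ℂ) ξ ∂(γ i)‖ ≤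
      ∫ ξ, (1 / 2) * ((1 - cutoff M ξ) * ‖𝓕⁻ (f : Rd d → ℂ) ξ‖ ^ 2 +
        (1 - cutoff M ξ) * ‖𝓕⁻ (g : Rd d → ℂ) ξ‖ ^ 2) ∂(γ i) := by
    refine norm_integral_le_of_norm_le ((hf.add hg).const_mul _) (Eventually.of_forall fun ξ => ?_)
    have h0 : 0 ≤ 1 - cutoff M ξ := by linarith [cutoff_le_one M ξ]
    rw [TestFun.fourierInv_conv, norm_mul, norm_mul, Complex.norm_real, Real.norm_of_nonneg h0]
    nlinarith [mul_nonneg h0 (sq_nonneg (‖𝓕⁻ (f : Rd d → ℂ) ξ‖ - ‖𝓕⁻ (g : Rd d → ℂ) ξ‖))]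
  rw [integral_const_mul, integral_add hf hg] at h3
  linarith

/-- A Radon measure whose Fourier transform is approximated by positive measures is Fourier
transformable. -/
theorem fourierTransformable [l.NeBot] (h : IsTransformLimit μ l γ) : FourierTransformable μ := by
  -- One ultrafilter below `l` suffices, as the limits of the test integrals are already prescribed
  -- by `μ`.
  have hU : IsTransformLimit μ (Ultrafilter.of l : Filter ι) γ := h.mono (Ultrafilter.of_le l)
  set U := Ultrafilter.of l
  obtain ⟨ν, hν, hlim⟩ := hU.exists_vague_limit
  let cut : ℝ → C(Rd d, ℂ) → TestFun d := fun M Φ => ⟨⟨fun ξ => (cutoff M ξ : ℂ) * Φ ξ,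
    (Complex.continuous_ofReal.comp (continuous_cutoff M)).mul Φ.continuous⟩,
    ((hasCompactSupport_cutoff M).comp_left Complex.ofReal_zero).mul_right⟩
  have hcut : ∀ M Φ ξ, cut M Φ ξ = (cutoff M ξ : ℂ) * Φ ξ := fun M Φ ξ => rfl
  -- Truncated integrals against `ν` are limits of truncated integrals against `γ i`, which are
  -- dominated by full ones; the latter converge to `μ.1 (f.conv f.reflect)`, a bound independent of
  -- `M`.
  have hsq : ∀ f : TestFun d, Integrable (fun ξ => ‖𝓕⁻ (f : Rd d → ℂ) ξ‖ ^ 2) ν := by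
    intro f
    have hcont : Continuous fun ξ => ‖𝓕⁻ (f : Rd d → ℂ) ξ‖ ^ 2 :=
      f.continuous_fourierInv.norm.pow 2
    have hcont' : ∀ M, Integrable (fun ξ => cutoff M ξ * ‖𝓕⁻ (f : Rd d → ℂ) ξ‖ ^ 2) ν := fun M =>
      ((continuous_cutoff M).mul hcont).integrable_of_hasCompactSupport
        (hasCompactSupport_cutoff M).mul_right
    refine (aecover_closedBall (μ := ν) (x := (0 : Rd d))
      (tendsto_natCast_atTop_atTop (R := ℝ))).integrable_of_integral_norm_bounded
      (μ.1 (f.conv f.reflect)).re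
      (fun M => (hcont.locallyIntegrable).integrableOn_isCompact (isCompact_closedBall _ _))
      (Eventually.of_forall fun M => ?_)
    have h1 : ∫ ξ in Metric.closedBall (0 : Rd d) M, ‖‖𝓕⁻ (f : Rd d → ℂ) ξ‖ ^ 2‖ ∂ν ≤
        ∫ ξ, cutoff M ξ * ‖𝓕⁻ (f : Rd d → ℂ) ξ‖ ^ 2 ∂ν := by
      refine le_trans (le_of_eq ?_) (setIntegral_le_integral (s := Metric.closedBall (0 : Rd d) M)
        (hcont' M)
        (Eventually.of_forall fun ξ => mul_nonneg (cutoff_nonneg _ _) (by positivity)))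
      refine setIntegral_congr_fun Metric.isClosed_closedBall.measurableSet fun ξ hξ => ?_
      rw [cutoff_eq_one (by simpa using hξ), one_mul, Real.norm_of_nonneg (by positivity)]
    refine h1.trans ?_
    set Φ : C(Rd d, ℂ) := ⟨fun ξ => ((‖𝓕⁻ (f : Rd d → ℂ) ξ‖ ^ 2 : ℝ) : ℂ),
      Complex.continuous_ofReal.comp hcont⟩
    have h2 : ∀ m : Measure (Rd d), ∫ ξ, cut M Φ ξ ∂m =
        ((∫ ξ, cutoff M ξ * ‖𝓕⁻ (f : Rd d → ℂ) ξ‖ ^ 2 ∂m : ℝ) : ℂ) := by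
      intro m
      rw [← integral_complex_ofReal]
      refine integral_congr_ae (Eventually.of_forall fun ξ => ?_)
      simp only [hcut]
      exact (Complex.ofReal_mul _ _).symm
    have h3 := (Complex.continuous_re.tendsto _).comp (hlim (cut M Φ))
    simp only [Function.comp_def, h2, Complex.ofReal_re] at h3
    refine le_of_tendsto_of_tendsto' h3 (hU.tendsto_integral_sq f) fun i => ?_
    have := h.finite i
    refine integral_mono (((continuous_cutoff M).mul hcont).integrable_of_hasCompactSupport
      (hasCompactSupport_cutoff M).mul_right)
      (TestFun.integrable_sq_norm_fourierInv (h.integrable i f f.reflect)) fun ξ => ?_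
    exact mul_le_of_le_one_left (by positivity) (cutoff_le_one _ _)
  have hint : ∀ f g : TestFun d, Integrable (𝓕⁻ (f.conv g : Rd d → ℂ)) ν := by
    intro f g
    have h1 : 𝓕⁻ (f.conv g : Rd d → ℂ) = fun ξ => 𝓕⁻ (f : Rd d → ℂ) ξ * 𝓕⁻ (g : Rd d → ℂ) ξ :=
      funext (f.fourierInv_conv g)
    rw [h1]
    exact ((memLp_two_iff_integrable_sq_norm f.continuous_fourierInv.aestronglyMeasurable).mpr
      (hsq f)).integrable_mul
      ((memLp_two_iff_integrable_sq_norm g.continuous_fourierInv.aestronglyMeasurable).mpr (hsq g))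
  obtain ⟨T, hT⟩ := exists_isRep ν (w := fun _ => (1 : ℂ)) measurable_const ⟨1, fun _ => by simp⟩
  refine ⟨T, isFourierTransform_iff.mpr ⟨ν, _, hT, fun f g => ⟨hint f g, ?_⟩⟩⟩
  simp only [mul_one]
  set Φ : C(Rd d, ℂ) := ⟨𝓕⁻ (f.conv g : Rd d → ℂ), (f.conv g).continuous_fourierInv⟩ with hΦ
  have hlim1 : Tendsto (fun M : ℕ => ∫ ξ, cut M Φ ξ ∂ν) atTop
      (𝓝 (∫ ξ, 𝓕⁻ (f.conv g : Rd d → ℂ) ξ ∂ν)) := by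
    refine tendsto_integral_of_dominated_convergence (fun ξ => ‖𝓕⁻ (f.conv g : Rd d → ℂ) ξ‖)
      (fun M => (cut M Φ).continuous.aestronglyMeasurable) (hint f g).norm
      (fun M => Eventually.of_forall fun ξ => ?_) (Eventually.of_forall fun ξ => ?_)
    · rw [hcut, norm_mul, Complex.norm_real, Real.norm_of_nonneg (cutoff_nonneg _ _)]
      exact mul_le_of_le_one_left (norm_nonneg _) (cutoff_le_one _ _)
    · obtain ⟨M, hM⟩ := exists_nat_ge ‖ξ‖
      refine tendsto_const_nhds.congr' ?_
      filter_upwards [eventually_ge_atTop M] with M' hM'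
      rw [hcut, cutoff_eq_one (hM.trans (by exact_mod_cast hM'))]
      simp [hΦ]
  -- Both sides are limits of the truncated integrals against `ν` as `M → ∞`: the right one by
  -- dominated convergence, the left one by tightness.
  refine tendsto_nhds_unique (Metric.tendsto_atTop.mpr fun δ hδ => ?_) hlim1
  obtain ⟨M₀, hM₀⟩ := hU.norm_integral_cutoff_compl_le f g (half_pos hδ)
  obtain ⟨N, hN⟩ := exists_nat_ge M₀
  refine ⟨N, fun M hM => lt_of_le_of_lt ?_ (half_lt_self hδ)⟩
  rw [dist_comm, dist_eq_norm]
  refine le_of_tendsto (((hU.tendsto f g).sub (hlim (cut M Φ))).norm) ?_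
  filter_upwards [hM₀ M (hN.trans (by exact_mod_cast hM))] with i hi
  have := h.finite i
  rw [← integral_sub (h.integrable i f g) ((cut M Φ).integrable' _)]
  refine le_trans (le_of_eq ?_) hi
  congr 1
  refine integral_congr_ae (Eventually.of_forall fun ξ => ?_)
  simp only [hcut]
  push_cast
  change _ - (cutoff M ξ : ℂ) * 𝓕⁻ (f.conv g : Rd d → ℂ) ξ = _
  ring

end IsTransformLimit

end SAdic

end

noncomputable section

namespace SAdic

open FourierTransform Convolution
open scoped NNReal ENNReal

variable {d : ℕ}

/-! ### Densities of absolutely continuous parts -/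

/-- The polar measure is absolutely continuous with respect to `m`, hence still singular to Lebesgue
measure, so a bounded density suffices for the singular part too. -/
theorem isACDensity_iff {μ : RadonMeasure d} {h : Rd d → ℂ} : IsACDensity μ h ↔
    LocallyIntegrable h volume ∧ ∃ (μs : RadonMeasure d) (m : Measure (Rd d)) (w : Rd d → ℂ),
      IsRep μs m w ∧ m ⟂ₘ volume ∧ ∀ f : TestFun d, μ.1 f = μs.1 f + ∫ x, f x * h x := by
  constructor
  · rintro ⟨hl, μs, m, u, hp, hm, hf⟩
    exact ⟨hl, μs, m, u, hp.isRep, hm, hf⟩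
  · rintro ⟨hl, μs, m, w, hp, hm, hf⟩
    obtain ⟨m', u, hp', hac, -⟩ := hp.exists_polar
    exact ⟨hl, μs, m', u, hp', hm.mono_ac hac Measure.AbsolutelyContinuous.rfl, hf⟩

theorem TestFun.integrable_mul (f : TestFun d) {m : Measure (Rd d)} {h : Rd d → ℂ}
    (hh : LocallyIntegrable h m) : Integrable (fun x => f x * h x) m :=
  hh.integrable_smul_left_of_hasCompactSupport f.continuous f.hasCompactSupport

theorem locallyIntegrable_mul_of_bdd {m : Measure (Rd d)} {h w : Rd d → ℂ}
    (hh : LocallyIntegrable h m) (hw : Measurable w) (hb : ∃ C, ∀ x, ‖w x‖ ≤ C) :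
    LocallyIntegrable (fun x => h x * w x) m := by
  intro x
  obtain ⟨s, hs, hi⟩ := hh x
  exact ⟨s, hs, integrable_mul_of_bdd hi hw hb⟩

theorem locallyIntegrable_of_bdd {m : Measure (Rd d)} [IsLocallyFiniteMeasure m] {w : Rd d → ℂ}
    (hw : Measurable w) (hb : ∃ C, ∀ x, ‖w x‖ ≤ C) : LocallyIntegrable w m := by
  have := locallyIntegrable_mul_of_bdd (m := m) (h := fun _ => (1 : ℂ))
    (continuous_const.locallyIntegrable) hw hb
  simpa using this

/-- Lebesgue decomposition of the positive measure `m`, with the same bounded factor `w` on both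
pieces. The derivative is finite almost everywhere, so its `toNNReal` defines the same measure. -/
theorem IsRep.exists_isACDensity {μ : RadonMeasure d} {m : Measure (Rd d)} {w : Rd d → ℂ}
    (hr : IsRep μ m w) : ∃ h, IsACDensity μ h := by
  have := hr.finite
  set ms := m.singularPart volume with hms
  have hms_le : ms ≤ m := Measure.singularPart_le m volume
  have : IsLocallyFiniteMeasure ms := Measure.isLocallyFiniteMeasure_of_le hms_le
  set r : Rd d → ℝ≥0 := fun x => (m.rnDeriv volume x).toNNReal with hrdef
  have hrm : Measurable r := (Measure.measurable_rnDeriv m volume).ennreal_toNNReal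
  set ma := (volume : Measure (Rd d)).withDensity (fun x => (r x : ℝ≥0∞)) with hma
  have hma' : ma = volume.withDensity (m.rnDeriv volume) := by
    refine withDensity_congr_ae ?_
    filter_upwards [Measure.rnDeriv_lt_top m volume] with x hx
    exact ENNReal.coe_toNNReal hx.ne
  have hdecomp : m = ms + ma := by
    rw [hma']
    exact Measure.haveLebesgueDecomposition_add m volume
  have hma_le : ma ≤ m := by
    conv_rhs => rw [hdecomp]
    exact Measure.le_add_left le_rfl
  have : IsLocallyFiniteMeasure ma := Measure.isLocallyFiniteMeasure_of_le hma_le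
  set h : Rd d → ℂ := fun x => w x * (r x : ℂ) with hh
  have key : ∀ f : TestFun d, ∫ x, f x * w x ∂m = ∫ x, f x * w x ∂ms + ∫ x, f x * h x := by
    intro f
    have hi : Integrable (fun x => f x * w x) m :=
      integrable_mul_of_bdd (f.integrable' m) hr.meas hr.bdd
    have h1 : ∫ x, f x * w x ∂m = ∫ x, f x * w x ∂(ms + ma) := by rw [← hdecomp]
    rw [h1, integral_add_measure (hi.mono_measure hms_le) (hi.mono_measure hma_le),
      integral_density hrm hma]
    simp only [hh, mul_assoc]
  obtain ⟨μs, hμs⟩ := exists_isRep ms hr.meas hr.bdd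
  refine ⟨h, isACDensity_iff.mpr ⟨?_, μs, ms, w, hμs, ?_, fun f => ?_⟩⟩
  · rw [locallyIntegrable_iff]
    intro K hK
    rw [← integrable_indicator_iff hK.measurableSet]
    have h1 : Integrable (K.indicator w) ma := by
      rw [integrable_indicator_iff hK.measurableSet]
      exact (locallyIntegrable_of_bdd hr.meas hr.bdd).integrableOn_isCompact hK
    refine (integrable_density hrm hma h1).congr (Eventually.of_forall fun x => ?_)
    by_cases hx : x ∈ K <;> simp [hx, hh]
  · exact Measure.mutuallySingular_singularPart m volume
  · rw [hr.apply, key, hμs.apply]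

theorem IsFourierTransform.exists_isACDensity {μ ν : RadonMeasure d}
    (h : IsFourierTransform μ ν) : ∃ h, IsACDensity ν h := by
  obtain ⟨m, w, hr, -⟩ := isFourierTransform_iff.mp h
  exact hr.exists_isACDensity

theorem IsACDensity.zero : IsACDensity (0 : RadonMeasure d) 0 :=
  isACDensity_iff.mpr ⟨locallyIntegrable_zero, 0, 0, 0, IsRep.zero,
    Measure.MutuallySingular.zero_left, fun f => by simp⟩

theorem IsACDensity.add {μ₁ μ₂ : RadonMeasure d} {h₁ h₂ : Rd d → ℂ} (H₁ : IsACDensity μ₁ h₁)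
    (H₂ : IsACDensity μ₂ h₂) : IsACDensity (μ₁ + μ₂) (fun x => h₁ x + h₂ x) := by
  obtain ⟨hl₁, μs₁, m₁, w₁, hr₁, hm₁, hf₁⟩ := isACDensity_iff.mp H₁
  obtain ⟨hl₂, μs₂, m₂, w₂, hr₂, hm₂, hf₂⟩ := isACDensity_iff.mp H₂
  obtain ⟨w, hw, -⟩ := hr₁.add hr₂
  refine isACDensity_iff.mpr ⟨hl₁.add hl₂, μs₁ + μs₂, m₁ + m₂, w, hw, hm₁.add_left hm₂,
    fun f => ?_⟩
  simp only [mul_add]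
  rw [integral_add (f.integrable_mul hl₁) (f.integrable_mul hl₂), RadonMeasure.add_apply,
    RadonMeasure.add_apply, hf₁, hf₂]
  ring

theorem IsACDensity.smul {μ : RadonMeasure d} {h : Rd d → ℂ} (H : IsACDensity μ h) (c : ℂ) :
    IsACDensity (c • μ) (fun x => c * h x) := by
  obtain ⟨hl, μs, m, w, hr, hm, hf⟩ := isACDensity_iff.mp H
  refine isACDensity_iff.mpr ⟨hl.smul c, c • μs, m, _, hr.smul c, hm, fun f => ?_⟩
  simp only [mul_left_comm]
  rw [integral_const_mul, RadonMeasure.smul_apply, RadonMeasure.smul_apply, hf]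
  ring

theorem IsACDensity.sum {ι : Type*} (s : Finset ι) {μ : ι → RadonMeasure d} {h : ι → Rd d → ℂ}
    (H : ∀ i ∈ s, IsACDensity (μ i) (h i)) :
    IsACDensity (∑ i ∈ s, μ i) (fun x => ∑ i ∈ s, h i x) := by
  classical
  induction s using Finset.induction_on with
  | empty => exact IsACDensity.zero
  | insert a s ha ih =>
    simp only [Finset.sum_insert ha]
    exact (H a (Finset.mem_insert_self a s)).add
      (ih fun i hi => H i (Finset.mem_insert_of_mem hi))

theorem IsACDensity.mulFun {μ : RadonMeasure d} {h : Rd d → ℂ} (H : IsACDensity μ h)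
    {ξ : C(Rd d, ℂ)} (hξ : ∀ x, ‖ξ x‖ ≤ 1) :
    IsACDensity (RadonMeasure.mulFun ξ μ) (fun x => ξ x * h x) := by
  obtain ⟨hl, μs, m, w, hr, hm, hf⟩ := isACDensity_iff.mp H
  refine isACDensity_iff.mpr ⟨?_, RadonMeasure.mulFun ξ μs, m, _, hr.mulFun hξ, hm, fun f => ?_⟩
  · simp only [mul_comm (ξ _)]
    exact locallyIntegrable_mul_of_bdd hl ξ.continuous.measurable ⟨1, hξ⟩
  · change μ.1 (f.mulLeft ξ) = μs.1 (f.mulLeft ξ) + _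
    rw [hf]
    congr 1
    refine integral_congr_ae (Eventually.of_forall fun x => ?_)
    change ξ x * f x * h x = f x * (ξ x * h x)
    ring

/-- The image of Lebesgue measure under `ψ⁻¹` is `|det ψ|` times Lebesgue measure; this gives the
Jacobian, and equivalence of the two keeps the singular part singular. -/
theorem IsACDensity.push_symm {μ : RadonMeasure d} {h : Rd d → ℂ} (H : IsACDensity μ h)
    (ψ : Rd d ≃L[ℝ] Rd d) : IsACDensity (RadonMeasure.push ψ.symm.toHomeomorph μ)
      (fun x => (absDet ψ : ℂ) * h (ψ x)) := by
  obtain ⟨hl, μs, m, w, hr, hm, hf⟩ := isACDensity_iff.mp H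
  have hne : (absDet ψ : ℂ) ≠ 0 := by exact_mod_cast (absDet_pos ψ).ne'
  refine isACDensity_iff.mpr ⟨?_, RadonMeasure.push ψ.symm.toHomeomorph μs, _, _,
    hr.push ψ.symm.toHomeomorph, ?_, fun f => ?_⟩
  · refine LocallyIntegrable.smul ?_ (absDet ψ : ℂ)
    have h1 := (locallyIntegrable_map_homeomorph (μ := volume) ψ.toHomeomorph (f := h)).mp
    refine h1 ?_
    change LocallyIntegrable h (Measure.map ψ volume)
    rw [map_clEquiv_volume]
    intro x
    obtain ⟨s, hs, hi⟩ := hl x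
    refine ⟨s, hs, ?_⟩
    rw [IntegrableOn, Measure.restrict_smul]
    exact hi.smul_measure ENNReal.ofReal_ne_top
  · refine (ψ.symm.toHomeomorph.measurableEmbedding.mutuallySingular_map hm).mono_ac
      Measure.AbsolutelyContinuous.rfl ?_
    change volume ≪ Measure.map ψ.symm volume
    rw [map_clEquiv_volume]
    refine Measure.absolutelyContinuous_smul ?_
    simpa using absDet_pos _
  · change μ.1 (f.compHomeo _) = μs.1 (f.compHomeo _) + _
    rw [hf]
    congr 1
    have h1 := integral_comp_clEquiv ψ (fun x => f (ψ.symm x) * h x)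
    simp only [ContinuousLinearEquiv.symm_apply_apply] at h1
    simp only [mul_left_comm (f _)]
    rw [integral_const_mul, h1, mul_inv_cancel_left₀ hne]
    rfl

theorem integral_piecewise_add_of_mutuallySingular {μ ν : Measure (Rd d)} {S : Set (Rd d)}
    (hμ : μ Sᶜ = 0) (hν : ν S = 0) (F G : Rd d → ℂ)
    (hF : Integrable F μ) (hG : Integrable G ν) [DecidablePred (· ∈ S)] :
    ∫ x, S.piecewise F G x ∂(μ + ν) = ∫ x, F x ∂μ + ∫ x, G x ∂ν := by
  have h1 : S.piecewise F G =ᵐ[μ] F := by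
    filter_upwards [measure_eq_zero_iff_ae_notMem.mp hμ] with x hx
    exact Set.piecewise_eq_of_mem _ _ _ (not_not.mp hx)
  have h2 : S.piecewise F G =ᵐ[ν] G := by
    filter_upwards [measure_eq_zero_iff_ae_notMem.mp hν] with x hx
    exact Set.piecewise_eq_of_notMem _ _ _ hx
  rw [integral_add_measure (hF.congr h1.symm) (hG.congr h2.symm), integral_congr_ae h1,
    integral_congr_ae h2]

/-- A set separating `m` from Lebesgue measure allows `h` and `w` to be glued into one locally
integrable function for `volume + m`. It integrates all smooth test functions to zero, so it
vanishes almost everywhere. -/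
theorem IsACDensity.ae_eq_zero {h : Rd d → ℂ} (H : IsACDensity (0 : RadonMeasure d) h) :
    ∀ᵐ x, h x = 0 := by
  classical
  obtain ⟨hl, μs, m, w, hr, hm, hf⟩ := isACDensity_iff.mp H
  have := hr.finite
  have hlw : LocallyIntegrable w m := locallyIntegrable_of_bdd hr.meas hr.bdd
  obtain ⟨S, -, hmS, hvS⟩ := hm
  set G : Rd d → ℂ := S.piecewise h w with hG
  have h1 : h =ᵐ[volume] G := by
    filter_upwards [measure_eq_zero_iff_ae_notMem.mp hvS] with x hx
    exact (Set.piecewise_eq_of_mem _ _ _ (not_not.mp hx)).symm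
  have h2 : w =ᵐ[m] G := by
    filter_upwards [measure_eq_zero_iff_ae_notMem.mp hmS] with x hx
    exact (Set.piecewise_eq_of_notMem _ _ _ hx).symm
  have hGl : LocallyIntegrable G (volume + m) := by
    intro x
    obtain ⟨s, hs, hi⟩ := hl x
    obtain ⟨t, ht, hj⟩ := hlw x
    refine ⟨s ∩ t, inter_mem hs ht, IntegrableOn.add_measure ?_ ?_⟩
    · exact IntegrableOn.mono_set (Integrable.congr hi (ae_restrict_of_ae h1)) Set.inter_subset_left
    · exact IntegrableOn.mono_set (Integrable.congr hj (ae_restrict_of_ae h2)) Set.inter_subset_right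
  have hzero : ∀ᵐ x ∂(volume + m), G x = 0 := by
    refine ae_eq_zero_of_integral_contDiff_smul_eq_zero hGl fun g hg hgc => ?_
    have hgc' : HasCompactSupport (fun x => (g x : ℂ)) := hgc.comp_left Complex.ofReal_zero
    set f : TestFun d := ⟨⟨fun x => (g x : ℂ), Complex.continuous_ofReal.comp hg.continuous⟩, hgc'⟩
    have hfg : ∀ x, f x = (g x : ℂ) := fun x => rfl
    have h3 := integral_piecewise_add_of_mutuallySingular (μ := volume) (ν := m) hvS hmS
      (fun x => f x * h x) (fun x => f x * w x) (f.integrable_mul hl) (f.integrable_mul hlw)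
    have h4 := hf f
    rw [hr.apply, show (0 : RadonMeasure d).1 f = 0 from rfl, add_comm] at h4
    rw [← h4] at h3
    rw [← h3]
    refine integral_congr_ae (Eventually.of_forall fun x => ?_)
    by_cases hx : x ∈ S <;> simp [hG, hx, hfg]
  rw [ae_add_measure_iff] at hzero
  filter_upwards [h1, hzero.1] with x hx hx'
  rw [hx, hx']

theorem IsACDensity.unique {μ : RadonMeasure d} {h h' : Rd d → ℂ} (H : IsACDensity μ h)
    (H' : IsACDensity μ h') : ∀ᵐ x, h x = h' x := by
  have h1 := H.add (H'.smul (-1))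
  rw [neg_one_smul ℂ μ, add_neg_cancel] at h1
  filter_upwards [h1.ae_eq_zero] with x hx
  linear_combination hx

end SAdic

end

noncomputable section

namespace SAdic

/-! ### Translates of tiles and patches -/

section Tiles

variable {d : ℕ} {L : Type*}

theorem Tile.mem_supp_shift {T : Tile d L} {x y : Rd d} :
    y ∈ (T.shift x).supp ↔ y - x ∈ T.supp := by
  constructor
  · rintro ⟨z, hz, rfl⟩
    simpa using hz
  · exact fun h => ⟨y - x, h, sub_add_cancel y x⟩

theorem Tile.mem_interior_supp_shift {T : Tile d L} {x y : Rd d} :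
    y ∈ interior (T.shift x).supp ↔ y - x ∈ interior T.supp := by
  have h : interior (T.shift x).supp = Homeomorph.addRight x '' interior T.supp :=
    ((Homeomorph.addRight x).image_interior _).symm
  rw [h]
  constructor
  · rintro ⟨z, hz, rfl⟩
    simpa using hz
  · exact fun h => ⟨y - x, h, sub_add_cancel y x⟩

theorem Tile.shift_zero (T : Tile d L) : T.shift 0 = T := by
  refine Tile.ext_of ?_ rfl
  ext y
  rw [Tile.mem_supp_shift, sub_zero]

theorem Tile.shift_shift (T : Tile d L) (x y : Rd d) : (T.shift x).shift y = T.shift (x + y) := by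
  refine Tile.ext_of ?_ rfl
  ext z
  rw [Tile.mem_supp_shift, Tile.mem_supp_shift, Tile.mem_supp_shift, sub_sub, add_comm y x]

theorem mem_shiftPatch {P : Set (Tile d L)} {x : Rd d} {S : Tile d L} :
    S ∈ shiftPatch P x ↔ S.shift (-x) ∈ P := by
  constructor
  · rintro ⟨T, hT, rfl⟩
    simpa [Tile.shift_shift, Tile.shift_zero] using hT
  · intro h
    exact ⟨_, h, by simp [Tile.shift_shift, Tile.shift_zero]⟩

theorem shift_mem_shiftPatch {P : Set (Tile d L)} {x y : Rd d} {S : Tile d L} :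
    S.shift x ∈ shiftPatch P y ↔ S.shift (x - y) ∈ P := by
  rw [mem_shiftPatch, Tile.shift_shift, sub_eq_add_neg]

theorem IsPatch.eq_of_mem_interior {P : Set (Tile d L)} (hP : IsPatch P) {S T : Tile d L}
    (hS : S ∈ P) (hT : T ∈ P) {y : Rd d} (hyS : y ∈ interior S.supp) (hyT : y ∈ interior T.supp) :
    S = T := by
  by_contra h
  exact Set.disjoint_left.mp (hP hS hT h) hyS hyT

/-- A tile with arbitrarily small translates in a patch belongs to the patch. -/
theorem IsPatch.mem_of_forall_small {Q : Set (Tile d L)} (hQ : IsPatch Q) {S : Tile d L}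
    (h : ∀ ε > (0 : ℝ), ∃ z : Rd d, ‖z‖ < ε ∧ S.shift z ∈ Q) : S ∈ Q := by
  obtain ⟨p, hp⟩ := S.interior_nonempty
  obtain ⟨r, hr, hball⟩ := Metric.isOpen_iff.mp isOpen_interior p hp
  have hin : ∀ z : Rd d, ‖z‖ < r → p ∈ interior (S.shift z).supp := by
    intro z hz
    rw [Tile.mem_interior_supp_shift]
    exact hball (by simpa [dist_eq_norm] using hz)
  obtain ⟨z, hz, hzQ⟩ := h r hr
  by_cases hz0 : z = 0
  · rwa [hz0, Tile.shift_zero] at hzQ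
  -- A strictly smaller displacement gives another translate in `Q` with `p` in its interior; the
  -- patch property forces `z = z'`, a contradiction.
  · obtain ⟨z', hz', hzQ'⟩ := h ‖z‖ (norm_pos_iff.mpr hz0)
    have := S.shift_injective (hQ.eq_of_mem_interior hzQ hzQ' (hin z hz) (hin z' (hz'.trans hz)))
    rw [this] at hz'
    exact absurd hz' (lt_irrefl _)

/-- One matching moves both tiles by the same vector, so their relative position is preserved
exactly and not merely up to `ε`. -/
theorem TendsLocalMatching.exists_shift_pair_mem {P : ℕ → Set (Tile d L)} {Q : Set (Tile d L)}
    (h : TendsLocalMatching P Q) {S T : Tile d L} (hS : S ∈ Q) (hT : T ∈ Q) {ε : ℝ} (hε : 0 < ε) :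
    ∀ᶠ l in atTop, ∃ z : Rd d, ‖z‖ < ε ∧ S.shift z ∈ P l ∧ T.shift z ∈ P l := by
  obtain ⟨p, hp⟩ := S.nonempty
  obtain ⟨q, hq⟩ := T.nonempty
  have key : ∀ (l : ℕ) (x y : Rd d) (U : Tile d L) (u : Rd d), U ∈ Q → u ∈ U.supp → ‖y‖ < ε / 2 →
      ‖u‖ ≤ ‖p‖ + ‖q‖ →
      meets (shiftPatch (P l) x) (Metric.closedBall 0 (‖p‖ + ‖q‖ + ε)) =
        meets (shiftPatch Q y) (Metric.closedBall 0 (‖p‖ + ‖q‖ + ε)) → U.shift (y - x) ∈ P l := by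
    intro l x y U u hU hu hy hn heq
    have h1 : U.shift y ∈ meets (shiftPatch Q y) (Metric.closedBall 0 (‖p‖ + ‖q‖ + ε)) := by
      refine ⟨⟨U, hU, rfl⟩, u + y, ?_, ?_⟩
      · rw [Tile.mem_supp_shift]
        simpa using hu
      · rw [mem_closedBall_zero_iff]
        linarith [norm_add_le u y]
    rw [← heq] at h1
    exact shift_mem_shiftPatch.mp h1.1
  filter_upwards [h (‖p‖ + ‖q‖ + ε) (by positivity) (ε / 2) (by positivity)] with l hl
  obtain ⟨x, y, hx, hy, heq⟩ := hl
  refine ⟨y - x, by linarith [norm_sub_le y x], ?_, ?_⟩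
  · exact key l x y S p hS hp hy (by linarith [norm_nonneg q]) heq
  · exact key l x y T q hT hq hy (by linarith [norm_nonneg p]) heq

/-- The transfer back to the limit has to be uniform over the tiles near the origin, since the tile
it is applied to is found only after `l` is fixed. -/
theorem TendsLocalMatching.exists_shift_mem_limit {P : ℕ → Set (Tile d L)} {Q : Set (Tile d L)}
    (h : TendsLocalMatching P Q) {R ε : ℝ} (hR : 0 < R) (hε : 0 < ε) :
    ∀ᶠ l in atTop, ∀ S ∈ P l, (S.supp ∩ Metric.closedBall 0 R).Nonempty →
      ∃ z : Rd d, ‖z‖ < ε ∧ S.shift z ∈ Q := by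
  filter_upwards [h (R + ε) (by positivity) (ε / 2) (by positivity)] with l hl S hS hne
  obtain ⟨x, y, hx, hy, heq⟩ := hl
  obtain ⟨p, hp, hpR⟩ := hne
  have h1 : S.shift x ∈ meets (shiftPatch (P l) x) (Metric.closedBall 0 (R + ε)) := by
    refine ⟨⟨S, hS, rfl⟩, p + x, ?_, ?_⟩
    · rw [Tile.mem_supp_shift]
      simpa using hp
    · rw [mem_closedBall_zero_iff] at hpR ⊢
      linarith [norm_add_le p x]
  rw [heq] at h1
  exact ⟨x - y, by linarith [norm_sub_le x y], shift_mem_shiftPatch.mp h1.1⟩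

end Tiles

/-! ### Substitutions acting on patches -/

section Substitutions

variable {d n m : ℕ} {L : Type*} {A : Fin n → Tile d L}

theorem TranslationInequivalent.shift_eq (hA : TranslationInequivalent A) {i j : Fin n}
    {x y : Rd d} (h : (A i).shift x = (A j).shift y) : i = j ∧ x = y := by
  have h1 : (A i).shift (x - y) = A j := by
    have := congrArg (fun T => T.shift (-y)) h
    simpa [Tile.shift_shift, Tile.shift_zero, sub_eq_add_neg] using this
  obtain rfl := hA i j _ h1
  exact ⟨rfl, (A i).shift_injective h⟩

theorem Substitution.norm_le (σ : Substitution A) (v : Rd d) : ‖v‖ ≤ ‖σ.φ v‖ := by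
  by_cases hv : v = 0
  · simp [hv]
  · have hn : ‖v‖ ≠ 0 := norm_ne_zero_iff.mpr hv
    have h := σ.expanding (‖v‖⁻¹ • v) (by rw [norm_smul, norm_inv, norm_norm, inv_mul_cancel₀ hn])
    rw [map_smul, norm_smul, norm_inv, norm_norm, inv_mul_eq_div,
      one_lt_div (norm_pos_iff.mpr hv)] at h
    exact h.le

theorem Substitution.supp_subset (σ : Substitution A) {j : Fin n} {x : Rd d} {S : Tile d L}
    (hS : S ∈ shiftPatch (σ.rule j) (σ.φ x)) : S.supp ⊆ σ.φ '' ((A j).shift x).supp := by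
  obtain ⟨S₀, hS₀, rfl⟩ := hS
  intro y hy
  rw [Tile.mem_supp_shift] at hy
  have h1 : y - σ.φ x ∈ patchSupp (σ.rule j) := Set.mem_biUnion hS₀ hy
  rw [σ.rule_supp j] at h1
  obtain ⟨a, ha, hay⟩ := h1
  refine ⟨a + x, ?_, ?_⟩
  · rw [Tile.mem_supp_shift]
    simpa using ha
  · rw [map_add, hay, sub_add_cancel]

theorem Substitution.interior_supp_subset (σ : Substitution A) {j : Fin n} {x : Rd d}
    {S : Tile d L} (hS : S ∈ shiftPatch (σ.rule j) (σ.φ x)) :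
    interior S.supp ⊆ σ.φ '' interior ((A j).shift x).supp := by
  have h := interior_mono (σ.supp_subset hS)
  have h2 := σ.φ.toHomeomorph.image_interior ((A j).shift x).supp
  exact h.trans (le_of_eq h2.symm)

theorem Substitution.apply_mono (σ : Substitution A) {P Q : Set (Tile d L)} (h : P ⊆ Q) :
    σ.apply P ⊆ σ.apply Q := by
  rintro S ⟨j, x, hx, hS⟩
  exact ⟨j, x, h hx, hS⟩

theorem Substitution.shift_mem_apply (σ : Substitution A) {P : Set (Tile d L)} {j : Fin n}
    {x z : Rd d} {S : Tile d L} (hx : (A j).shift (x + z) ∈ P)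
    (hS : S ∈ shiftPatch (σ.rule j) (σ.φ x)) : S.shift (σ.φ z) ∈ σ.apply P := by
  refine ⟨j, x + z, hx, ?_⟩
  rw [shift_mem_shiftPatch, map_add, sub_add_cancel_right]
  exact mem_shiftPatch.mp hS

theorem Substitution.apply_shiftPatch_subset (σ : Substitution A) (P : Set (Tile d L)) (x : Rd d) :
    σ.apply (shiftPatch P x) ⊆ shiftPatch (σ.apply P) (σ.φ x) := by
  rintro S ⟨j, y, hy, hS⟩
  rw [mem_shiftPatch, ← map_neg]
  rw [shift_mem_shiftPatch, sub_eq_add_neg] at hy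
  exact σ.shift_mem_apply hy hS

/-- Pulled back by `φ`, the common point lies in the interiors of both parents. A patch has only one
tile there, and inequivalence of the alphabet recovers its type and position. -/
theorem Substitution.supertile_unique (σ : Substitution A) (hA : TranslationInequivalent A)
    {P : Set (Tile d L)} (hP : IsPatch P) {S T : Tile d L} {j j' : Fin n} {x x' : Rd d}
    (hx : (A j).shift x ∈ P) (hx' : (A j').shift x' ∈ P)
    (hS : S ∈ shiftPatch (σ.rule j) (σ.φ x)) (hT : T ∈ shiftPatch (σ.rule j') (σ.φ x'))
    {y : Rd d} (hyS : y ∈ interior S.supp) (hyT : y ∈ interior T.supp) : j = j' ∧ x = x' := by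
  obtain ⟨a, ha, hay⟩ := σ.interior_supp_subset hS hyS
  obtain ⟨b, hb, hby⟩ := σ.interior_supp_subset hT hyT
  obtain rfl := σ.φ.injective (hay.trans hby.symm)
  exact hA.shift_eq (hP.eq_of_mem_interior hx hx' ha hb)

theorem IsPatch.apply (hA : TranslationInequivalent A) {P : Set (Tile d L)} (hP : IsPatch P)
    (σ : Substitution A) : IsPatch (σ.apply P) := by
  rintro S ⟨j, x, hx, hS⟩ T ⟨j', x', hx', hT⟩ hne
  rw [Set.disjoint_left]
  intro y hyS hyT
  obtain ⟨rfl, rfl⟩ := σ.supertile_unique hA hP hx hx' hS hT hyS hyT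
  obtain ⟨S₀, hS₀, rfl⟩ := hS
  obtain ⟨T₀, hT₀, rfl⟩ := hT
  rw [Tile.mem_interior_supp_shift] at hyS hyT
  exact hne (by rw [(σ.rule_isPatch j).eq_of_mem_interior hS₀ hT₀ hyS hyT])

theorem Substitution.exists_eq_shift_of_mem_apply (σ : Substitution A) {P : Set (Tile d L)}
    {S : Tile d L} (hS : S ∈ σ.apply P) : ∃ i x, S = (A i).shift x := by
  obtain ⟨j, x, -, S₀, hS₀, rfl⟩ := hS
  obtain ⟨i, y, rfl⟩ := σ.rule_translates j S₀ hS₀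
  exact ⟨i, _, Tile.shift_shift _ _ _⟩

theorem IsPatch.applyWord (hA : TranslationInequivalent A) (ρ : Fin m → Substitution A)
    (w : List (Fin m)) {P : Set (Tile d L)} (hP : IsPatch P) : IsPatch (applyWord ρ w P) := by
  induction w with
  | nil => exact hP
  | cons a w ih => exact ih.apply hA (ρ a)

theorem applyWord_mono (ρ : Fin m → Substitution A) (w : List (Fin m)) {P Q : Set (Tile d L)}
    (h : P ⊆ Q) : applyWord ρ w P ⊆ applyWord ρ w Q := by
  induction w with
  | nil => exact h
  | cons a w ih => exact (ρ a).apply_mono ih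

theorem applyWord_shiftPatch_subset (ρ : Fin m → Substitution A) (w : List (Fin m))
    (P : Set (Tile d L)) (x : Rd d) :
    ∃ y, applyWord ρ w (shiftPatch P x) ⊆ shiftPatch (applyWord ρ w P) y := by
  induction w with
  | nil => exact ⟨x, subset_rfl⟩
  | cons a w ih =>
    obtain ⟨y, hy⟩ := ih
    exact ⟨(ρ a).φ y, ((ρ a).apply_mono hy).trans ((ρ a).apply_shiftPatch_subset _ _)⟩

theorem applyWord_append (ρ : Fin m → Substitution A) (w w' : List (Fin m)) (P : Set (Tile d L)) :
    applyWord ρ (w ++ w') P = applyWord ρ w (applyWord ρ w' P) :=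
  List.foldr_append

theorem exists_eq_shift_of_mem_applyWord (ρ : Fin m → Substitution A) {w : List (Fin m)}
    (hw : w ≠ []) {P : Set (Tile d L)} {S : Tile d L} (hS : S ∈ applyWord ρ w P) :
    ∃ i x, S = (A i).shift x := by
  cases w with
  | nil => exact absurd rfl hw
  | cons a w => exact (ρ a).exists_eq_shift_of_mem_apply hS

theorem segment_eq_cons (i : ℕ → Fin m) {k N : ℕ} (h : k < N) :
    segment i k N = i k :: segment i (k + 1) N := by
  unfold segment
  rw [show N - k = (N - (k + 1)) + 1 by omega, List.range'_succ, List.map_cons]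

end Substitutions

/-! ### The tower of de-substituted tilings -/

section Tower

variable {d n m : ℕ} {L : Type*} {A : Fin n → Tile d L} {ρ : Fin m → Substitution A}
  {i : ℕ → Fin m} {𝒯 : ℕ → Set (Tile d L)}

/-- The pair appears, moved by a common vector, in an approximant, which lies in a longer word
applied to one alphabet tile because `P l` is legal. Statements about pairs of tiles in the tower
are thereby inherited from iterates. -/
theorem IsSAdicTower.exists_word (h𝒯 : IsSAdicTower ρ i 𝒯) (k : ℕ) {S T : Tile d L}
    (hS : S ∈ 𝒯 k) (hT : T ∈ 𝒯 k) : ∃ (w : List (Fin m)) (a : Fin n) (v : Rd d), w ≠ [] ∧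
      S.shift v ∈ applyWord ρ w {A a} ∧ T.shift v ∈ applyWord ρ w {A a} := by
  obtain ⟨-, N, P, -, hleg, hlim⟩ := h𝒯
  obtain ⟨l, z, -, hzS, hzT⟩ := ((hlim k).exists_shift_pair_mem hS hT one_pos).exists
  obtain ⟨w, a, v, hw, hP⟩ := hleg l
  obtain ⟨y, hy⟩ := applyWord_shiftPatch_subset ρ (segment i k (N l)) (applyWord ρ w {A a}) v
  have hsub := (applyWord_mono ρ (segment i k (N l)) hP).trans hy
  rw [← applyWord_append] at hsub
  refine ⟨segment i k (N l) ++ w, a, z - y, by simp [hw], ?_, ?_⟩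
  · exact shift_mem_shiftPatch.mp (hsub hzS)
  · exact shift_mem_shiftPatch.mp (hsub hzT)

theorem isPatch_singleton (T : Tile d L) : IsPatch {T} := Set.pairwise_singleton _ _

theorem IsSAdicTower.isPatch (h𝒯 : IsSAdicTower ρ i 𝒯) (hA : TranslationInequivalent A) (k : ℕ) :
    IsPatch (𝒯 k) := by
  intro S hS T hT hne
  obtain ⟨w, a, v, -, hS', hT'⟩ := h𝒯.exists_word k hS hT
  rw [Set.disjoint_left]
  intro y hyS hyT
  have h1 := ((isPatch_singleton (A a)).applyWord hA ρ w).eq_of_mem_interior hS' hT' (y := y + v)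
    (by rw [Tile.mem_interior_supp_shift]; simpa using hyS)
    (by rw [Tile.mem_interior_supp_shift]; simpa using hyT)
  have h2 := congrArg (fun T => T.shift (-v)) h1
  simp only [Tile.shift_shift, add_neg_cancel, Tile.shift_zero] at h2
  exact hne h2

theorem IsSAdicTower.exists_eq_shift (h𝒯 : IsSAdicTower ρ i 𝒯) {k : ℕ} {S : Tile d L}
    (hS : S ∈ 𝒯 k) : ∃ j x, S = (A j).shift x := by
  obtain ⟨w, a, v, hw, hS', -⟩ := h𝒯.exists_word k hS hS
  obtain ⟨j, x, hjx⟩ := exists_eq_shift_of_mem_applyWord ρ hw hS'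
  refine ⟨j, x - v, ?_⟩
  have := congrArg (fun T => T.shift (-v)) hjx
  simpa [Tile.shift_shift, Tile.shift_zero, sub_eq_add_neg] using this

theorem norm_clEquiv_lt (φ : Rd d ≃L[ℝ] Rd d) {ε : ℝ} (hε : 0 < ε) :
    ∃ δ > (0 : ℝ), ∀ z, ‖z‖ < δ → ‖φ z‖ < ε := by
  obtain ⟨δ, hδ, h⟩ := Metric.continuous_iff.mp φ.continuous 0 ε hε
  exact ⟨δ, hδ, fun z hz => by simpa using h z (by simpa using hz)⟩

/-- Each tiling of the tower is the image of the next one under the substitution. -/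
theorem IsSAdicTower.eq_apply (h𝒯 : IsSAdicTower ρ i 𝒯) (hA : TranslationInequivalent A) (k : ℕ) :
    𝒯 k = (ρ (i k)).apply (𝒯 (k + 1)) := by
  have hP₀ := h𝒯.isPatch hA k
  have hP₁ := (h𝒯.isPatch hA (k + 1)).apply hA (ρ (i k))
  have hsh : ∀ S ∈ 𝒯 (k + 1), ∃ j x, S = (A j).shift x := fun S hS => h𝒯.exists_eq_shift hS
  obtain ⟨-, N, P, hN, hleg, hlim⟩ := h𝒯
  set σ := ρ (i k) with hσ
  have hseg : ∀ᶠ l in atTop, applyWord ρ (segment i k (N l)) (P l) =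
      σ.apply (applyWord ρ (segment i (k + 1) (N l)) (P l)) := by
    filter_upwards [hN.tendsto_atTop.eventually_gt_atTop k] with l hl
    rw [segment_eq_cons i hl]
    rfl
  apply Set.Subset.antisymm
  · intro S hS
    -- A nearby copy of `S` in an approximant has a parent in the approximant one level up. Moving
    -- the parent into `𝒯 (k + 1)` by `z'` moves the copy by `σ.φ z'`, again a small vector.
    refine hP₁.mem_of_forall_small fun ε hε => ?_
    obtain ⟨p, hp⟩ := S.nonempty
    obtain ⟨δ, hδ, hδφ⟩ := norm_clEquiv_lt σ.φ (half_pos hε)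
    obtain ⟨l, ⟨z, hz, hzS, -⟩, hl, hl'⟩ :=
      (((hlim k).exists_shift_pair_mem hS hS (half_pos hε)).and (hseg.and
        ((hlim (k + 1)).exists_shift_mem_limit (R := ‖p‖ + ε) (by positivity) hδ))).exists
    rw [hl] at hzS
    obtain ⟨j, x, hx, hSx⟩ := hzS
    obtain ⟨a, ha, hap⟩ := σ.supp_subset hSx (show p + z ∈ _ by
      rw [Tile.mem_supp_shift]; simpa using hp)
    obtain ⟨z', hz', hz'Q⟩ := hl' _ hx ⟨a, ha, by
      -- As `φ` does not shrink lengths, the preimage `a` of `p + z` has norm below `‖p‖ + ε`, so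
      -- the parent meets the ball on which the limit is controlled.
      rw [mem_closedBall_zero_iff]
      have h1 := σ.norm_le a
      rw [hap] at h1
      linarith [norm_add_le p z]⟩
    rw [Tile.shift_shift] at hz'Q
    have h2 := σ.shift_mem_apply hz'Q hSx
    rw [Tile.shift_shift] at h2
    exact ⟨z + σ.φ z', by linarith [norm_add_le z (σ.φ z'), hδφ z' hz'], h2⟩
  · rintro S ⟨j, x, hx, hS⟩
    refine hP₀.mem_of_forall_small fun ε hε => ?_
    obtain ⟨p, hp⟩ := S.nonempty
    obtain ⟨δ, hδ, hδφ⟩ := norm_clEquiv_lt σ.φ (half_pos hε)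
    obtain ⟨l, ⟨z, hz, hzS, -⟩, hl, hl'⟩ :=
      (((hlim (k + 1)).exists_shift_pair_mem hx hx hδ).and (hseg.and
        ((hlim k).exists_shift_mem_limit (R := ‖p‖ + ε) (by positivity) (half_pos hε)))).exists
    rw [Tile.shift_shift] at hzS
    have h2 := σ.shift_mem_apply hzS hS
    rw [← hl] at h2
    obtain ⟨z', hz', hz'Q⟩ := hl' _ h2 ⟨p + σ.φ z, by
      rw [Tile.mem_supp_shift]; simpa using hp, by
      rw [mem_closedBall_zero_iff]
      linarith [norm_add_le p (σ.φ z), hδφ z hz]⟩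
    rw [Tile.shift_shift] at hz'Q
    exact ⟨σ.φ z + z', by linarith [norm_add_le (σ.φ z) z', hδφ z hz], hz'Q⟩

/-! ### Local finiteness -/

/-- The tiles have disjoint interiors of equal positive volume inside one ball, so only finitely
many fit. -/
theorem IsPatch.finite_locations {P : Set (Tile d L)} (hP : IsPatch P) (j : Fin n)
    {K : Set (Rd d)} (hK : Bornology.IsBounded K) : (K ∩ locations A P j).Finite := by
  set U : Set (Rd d) := interior (A j).supp with hU
  let V : ↥(K ∩ locations A P j) → Set (Rd d) := fun x => interior ((A j).shift x.1).supp
  have hvol : ∀ x, volume (V x) = volume U := by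
    intro x
    have h1 : V x = (fun z => z + x.1) '' U :=
      ((Homeomorph.addRight x.1).image_interior _).symm
    rw [h1, Set.image_add_right, measure_preimage_add_right]
  obtain ⟨R, hR⟩ := hK.subset_closedBall 0
  obtain ⟨R', hR'⟩ := (A j).isCompact.isBounded.subset_closedBall 0
  have hsub : (⋃ x, V x) ⊆ Metric.closedBall 0 (R' + R) := by
    refine Set.iUnion_subset fun x y hy => ?_
    have hy' := hR' (interior_subset (Tile.mem_interior_supp_shift.mp hy))
    have hx := hR x.2.1
    rw [mem_closedBall_zero_iff] at *
    have := norm_add_le (y - x.1) x.1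
    rw [sub_add_cancel] at this
    linarith
  have hfin := Measure.finite_const_le_meas_of_disjoint_iUnion (volume : Measure (Rd d))
    (ε := volume U) (isOpen_interior.measure_pos _ (A j).interior_nonempty)
    (As := V) (fun x => isOpen_interior.measurableSet)
    (fun x y hxy => hP x.2.2 y.2.2 fun h =>
      hxy (Subtype.ext ((A j).shift_injective h)))
    (ne_top_of_le_ne_top (isCompact_closedBall 0 (R' + R)).measure_lt_top.ne (measure_mono hsub))
  have huniv : {x | volume U ≤ volume (V x)} = Set.univ := by
    ext x; simp [hvol]
  rw [huniv] at hfin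
  exact Set.finite_coe_iff.mp (Set.finite_univ_iff.mp hfin)

theorem finite_locations_meets {P : Set (Tile d L)} (hP : IsPatch P) (j : Fin n)
    {K : Set (Rd d)} (hK : IsCompact K) : (locations A (meets P K) j).Finite := by
  obtain ⟨R, hR⟩ := hK.isBounded.subset_closedBall 0
  obtain ⟨R', hR'⟩ := (A j).isCompact.isBounded.subset_closedBall 0
  refine (hP.finite_locations (A := A) j
    (Metric.isBounded_closedBall (x := (0 : Rd d)) (r := R + R'))).subset fun x hx => ?_
  obtain ⟨hxP, y, hy, hyK⟩ := hx
  refine ⟨?_, hxP⟩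
  have h1 := hR hyK
  have h2 := hR' (Tile.mem_supp_shift.mp hy)
  rw [mem_closedBall_zero_iff] at *
  have := norm_sub_le y (y - x)
  rw [sub_sub_cancel] at this
  linarith

theorem locations_shiftPatch (Q : Set (Tile d L)) (v : Rd d) (j : Fin n) :
    locations A (shiftPatch Q v) j = (fun x => x + v) '' locations A Q j := by
  ext x
  rw [Set.image_add_right]
  exact shift_mem_shiftPatch.trans (by rw [sub_eq_add_neg]; rfl)

/-- The compact set `{p} ∪ (q + K₀)`, suitably translated, meets both tiles of any pair with
difference in `K₀`. Up to translation it sees finitely many patches, each with finitely many tiles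
of the two types, hence finitely many differences. Members of `F` with infinitely many such tiles
never occur and are discarded in `good`. -/
theorem IsSAdicTower.isLocallyFiniteSet_differences (h𝒯 : IsSAdicTower ρ i 𝒯)
    (hA : TranslationInequivalent A) (hFLC : HasFLC ρ) (k : ℕ) (a b : Fin n) :
    IsLocallyFiniteSet (differences A (𝒯 k) a b) := by
  intro K₀ hK₀
  obtain ⟨p, hp⟩ := (A a).nonempty
  obtain ⟨q, hq⟩ := (A b).nonempty
  set K : Set (Rd d) := {p} ∪ (fun z => q + z) '' K₀ with hK
  have hKc : IsCompact K := isCompact_singleton.union (hK₀.image (by fun_prop))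
  obtain ⟨F, hF, hFK⟩ := hFLC K hKc
  set good : Set (Set (Tile d L)) :=
    {Q | Q ∈ F ∧ (locations A Q a).Finite ∧ (locations A Q b).Finite} with hgood
  have hgf : good.Finite := hF.subset fun Q hQ => hQ.1
  refine (hgf.biUnion (t := fun Q => Set.image2 (fun s t => s - t) (locations A Q b)
    (locations A Q a)) fun Q hQ => Set.Finite.image2 _ hQ.2.2 hQ.2.1).subset ?_
  rintro z ⟨hzK, s, hs, t, ht, rfl⟩
  obtain ⟨w, c, v, hw, hS, hT⟩ := h𝒯.exists_word k ht hs
  rw [Tile.shift_shift] at hS hT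
  obtain ⟨Q, hQF, v', hQ⟩ := hFK c w (t + v) hw
  have hpatch : IsPatch (applyWord ρ w {A c}) := (isPatch_singleton (A c)).applyWord hA ρ w
  have hKc' : IsCompact ((fun y => y + (t + v)) '' K) := hKc.image (by fun_prop)
  have hfin : ∀ j, (locations A Q j).Finite := by
    intro j
    have h1 := finite_locations_meets (A := A) hpatch j hKc'
    rw [hQ, locations_shiftPatch] at h1
    exact Set.Finite.of_finite_image h1 (add_left_injective v').injOn
  have hmS : (A a).shift (t + v) ∈ shiftPatch Q v' := by
    rw [← hQ]
    refine ⟨hS, p + (t + v), ?_, p, Or.inl rfl, rfl⟩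
    rw [Tile.mem_supp_shift]
    simpa using hp
  have hmT : (A b).shift (s + v) ∈ shiftPatch Q v' := by
    rw [← hQ]
    refine ⟨hT, q + (s + v), ?_, q + (s - t), Or.inr ⟨s - t, hzK, rfl⟩, ?_⟩
    · rw [Tile.mem_supp_shift]
      simpa using hq
    · simp only
      abel
  rw [shift_mem_shiftPatch] at hmS hmT
  refine Set.mem_biUnion (x := Q) ⟨hQF, hfin a, hfin b⟩ ⟨_, hmT, _, hmS, ?_⟩
  simp only
  abel

end Tower

end SAdic

end

noncomputable section

namespace SAdic

/-! ### Counting along balls -/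

section Counting

variable {d : ℕ}

theorem volume_real_closedBall_pos {R : ℝ} (hR : 0 < R) :
    0 < volume.real (Metric.closedBall (0 : Rd d) R) := by
  rw [measureReal_def]
  exact ENNReal.toReal_pos (Metric.measure_closedBall_pos volume _ hR).ne'
    (isCompact_closedBall _ _).measure_lt_top.ne

theorem tendsto_volume_closedBall_ratio (a : ℝ) :
    Tendsto (fun R : ℝ => volume.real (Metric.closedBall (0 : Rd d) (R + a)) /
      volume.real (Metric.closedBall (0 : Rd d) R)) atTop (𝓝 1) := by
  have h1 : Tendsto (fun R : ℝ => (1 + a / R) ^ Module.finrank ℝ (Rd d)) atTop (𝓝 1) := by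
    have := ((tendsto_const_nhds (x := a)).div_atTop tendsto_id).const_add 1
    simpa using this.pow (Module.finrank ℝ (Rd d))
  refine h1.congr' ?_
  filter_upwards [eventually_gt_atTop 0, eventually_ge_atTop (-a)] with R hR hRa
  have hV := (volume_real_closedBall_pos (d := d) one_pos).ne'
  rw [Measure.addHaar_real_closedBall' volume _ (by linarith : 0 ≤ R + a),
    Measure.addHaar_real_closedBall' volume _ hR.le, mul_div_mul_right _ _ hV, ← div_pow]
  congr 1
  field_simp

/-- A shell of fixed thickness is negligible in volume. This absorbs translations by digits and the
displacement between the tiles of a pair. -/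
theorem tendsto_div_volume_closedBall_of_sandwich {N g : ℝ → ℝ} {a c : ℝ}
    (hN : Tendsto (fun R => N R / volume.real (Metric.closedBall (0 : Rd d) R)) atTop (𝓝 c))
    (hl : ∀ R, N (R - a) ≤ g R) (hu : ∀ R, g R ≤ N (R + a)) :
    Tendsto (fun R => g R / volume.real (Metric.closedBall (0 : Rd d) R)) atTop (𝓝 c) := by
  have key : ∀ b : ℝ, Tendsto (fun R => N (R + b) / volume.real (Metric.closedBall (0 : Rd d) R))
      atTop (𝓝 c) := by
    intro b
    have h1 := (hN.comp (tendsto_atTop_add_const_right atTop b tendsto_id)).mul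
      (tendsto_volume_closedBall_ratio (d := d) b)
    rw [mul_one] at h1
    refine h1.congr' ?_
    filter_upwards [eventually_gt_atTop (-b)] with R hR
    have hV := (volume_real_closedBall_pos (d := d) (by linarith : 0 < R + b)).ne'
    simp only [Function.comp, id]
    exact div_mul_div_cancel₀ hV
  refine tendsto_of_tendsto_of_tendsto_of_le_of_le (key (-a)) (key a) (fun R => ?_) fun R => ?_
  · simp only [← sub_eq_add_neg]
    exact div_le_div_of_nonneg_right (hl R) measureReal_nonneg
  · exact div_le_div_of_nonneg_right (hu R) measureReal_nonneg

end Counting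

/-! ### Frequencies of pairs of tiles -/

section Frequencies

variable {d n m : ℕ} {L : Type*} {A : Fin n → Tile d L} {T : Set (Tile d L)}

/-- The set of all `t` such that `T_a + t` and `T_b + z + t` belong to `T`. -/
def pairLocations (A : Fin n → Tile d L) (T : Set (Tile d L)) (a b : Fin n) (z : Rd d) :
    Set (Rd d) := {t | t ∈ locations A T a ∧ t + z ∈ locations A T b}

theorem shiftPatch_pair_subset_iff {a b : Fin n} {z t : Rd d} :
    shiftPatch {A a, (A b).shift z} t ⊆ T ↔ t ∈ pairLocations A T a b z := by
  unfold shiftPatch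
  rw [Set.image_pair, Set.insert_subset_iff, Set.singleton_subset_iff, Tile.shift_shift,
    add_comm z t]
  rfl

theorem patchAverage_pair {a b : Fin n} {z : Rd d} (W : Set (Rd d)) :
    patchAverage T {A a, (A b).shift z} W =
      ((W ∩ pairLocations A T a b z).ncard : ℝ) / volume.real W := by
  unfold patchAverage
  congr 3
  ext t
  simp only [shiftPatch_pair_subset_iff]
  rfl

/-- Convergence of frequencies is assumed for patches only. A pair that occurs in `T` is one; a pair
that does not occur has frequency zero by `pairFreq_eq_zero`. -/
theorem IsPatch.pair_of_mem_pairLocations (hT : IsPatch T) {a b : Fin n} {z t : Rd d}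
    (ht : t ∈ pairLocations A T a b z) : IsPatch ({A a, (A b).shift z} : Set (Tile d L)) := by
  intro S hS S' hS' hne
  rw [Set.disjoint_left]
  intro y hy hy'
  have hsub := shiftPatch_pair_subset_iff.mpr ht
  refine hne ?_
  have h1 := hT.eq_of_mem_interior (hsub ⟨S, hS, rfl⟩) (hsub ⟨S', hS', rfl⟩) (y := y + t)
    (by rw [Tile.mem_interior_supp_shift]; simpa using hy)
    (by rw [Tile.mem_interior_supp_shift]; simpa using hy')
  have h2 := congrArg (fun T => T.shift (-t)) h1
  simpa [Tile.shift_shift, Tile.shift_zero] using h2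

theorem pairFreq_eq_zero {a b : Fin n} {z : Rd d} (h : pairLocations A T a b z = ∅) :
    pairFreq A T a b z = 0 := by
  unfold pairFreq freq
  refine Tendsto.limUnder_eq (tendsto_const_nhds.congr fun R => ?_)
  rw [patchAverage_pair, h]
  simp

theorem pairFreq_eq_zero_of_notMem {a b : Fin n} {z : Rd d} (h : z ∉ differences A T a b) :
    pairFreq A T a b z = 0 := by
  refine pairFreq_eq_zero (Set.eq_empty_of_forall_notMem fun t ht => h ?_)
  exact ⟨t + z, ht.2, t, ht.1, by abel⟩

theorem tendsto_pairFreq (hT : IsPatch T) (hfreq : HasPatchFrequencies T) (a b : Fin n) (z : Rd d) :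
    Tendsto (fun R : ℝ => ((Metric.closedBall 0 R ∩ pairLocations A T a b z).ncard : ℝ) /
      volume.real (Metric.closedBall (0 : Rd d) R)) atTop (𝓝 (pairFreq A T a b z)) := by
  rcases Set.eq_empty_or_nonempty (pairLocations A T a b z) with h | ⟨t, ht⟩
  · rw [pairFreq_eq_zero h, h]
    simp
  · obtain ⟨c, hc⟩ := hfreq {A a, (A b).shift z} (by simp) (by simp)
      (hT.pair_of_mem_pairLocations ht)
    have h1 : pairFreq A T a b z = c := hc.limUnder_eq
    rw [h1]
    simpa only [patchAverage_pair] using hc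

theorem tendsto_pairFreq_along (hT : IsPatch T) {g : Rd d → Rd d} (hg : FrequenciesAlong T g)
    (a b : Fin n) (z : Rd d) :
    Tendsto (fun R : ℝ => ((g ⁻¹' Metric.closedBall 0 R ∩ pairLocations A T a b z).ncard : ℝ) /
      volume.real (g ⁻¹' Metric.closedBall (0 : Rd d) R)) atTop (𝓝 (pairFreq A T a b z)) := by
  rcases Set.eq_empty_or_nonempty (pairLocations A T a b z) with h | ⟨t, ht⟩
  · rw [pairFreq_eq_zero h, h]
    simp
  · have hc := hg {A a, (A b).shift z} (by simp) (by simp) (hT.pair_of_mem_pairLocations ht)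
    simp only [patchAverage_pair] at hc
    exact hc

theorem IsPatch.finite_pairLocations (hT : IsPatch T) (a b : Fin n) (z : Rd d) {W : Set (Rd d)}
    (hW : Bornology.IsBounded W) : (W ∩ pairLocations A T a b z).Finite :=
  (hT.finite_locations (A := A) a hW).subset fun _ ht => ⟨ht.1, ht.2.1⟩

/-! ### Supertiles -/

/-- The pairs `(p, x)` with `x` in the digit set `T_{a,p}`. -/
def Substitution.digitPairs (σ : Substitution A) (a : Fin n) : Finset (Σ _ : Fin n, Rd d) :=
  Finset.univ.sigma fun p => σ.digits a p

theorem Substitution.mem_digits {σ : Substitution A} {a p : Fin n} {x : Rd d} :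
    x ∈ σ.digits a p ↔ (A a).shift x ∈ σ.rule p := by
  unfold Substitution.digits
  rw [Set.Finite.mem_toFinset]
  rfl

theorem Substitution.sum_digitPairs {M : Type*} [AddCommMonoid M] (σ : Substitution A)
    (a b : Fin n) (F : Fin n → Fin n → Rd d → Rd d → M) :
    ∑ p, ∑ q, ∑ x ∈ σ.digits a p, ∑ y ∈ σ.digits b q, F p q x y =
      ∑ c ∈ σ.digitPairs a ×ˢ σ.digitPairs b, F c.1.1 c.2.1 c.1.2 c.2.2 := by
  rw [Finset.sum_product]
  unfold Substitution.digitPairs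
  rw [Finset.sum_sigma]
  refine Finset.sum_congr rfl fun p _ => ?_
  rw [Finset.sum_comm]
  refine Finset.sum_congr rfl fun x _ => ?_
  rw [Finset.sum_sigma]

theorem mem_locations_apply (σ : Substitution A) {P : Set (Tile d L)} {a : Fin n} {t : Rd d} :
    t ∈ locations A (σ.apply P) a ↔
      ∃ c ∈ σ.digitPairs a, ∃ u ∈ locations A P c.1, t = c.2 + σ.φ u := by
  constructor
  · rintro ⟨p, u, hu, ht⟩
    refine ⟨⟨p, t - σ.φ u⟩, ?_, u, hu, (sub_add_cancel _ _).symm⟩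
    rw [Substitution.digitPairs, Finset.mem_sigma]
    exact ⟨Finset.mem_univ _, Substitution.mem_digits.mpr (shift_mem_shiftPatch.mp ht)⟩
  · rintro ⟨⟨p, x⟩, hc, u, hu, rfl⟩
    rw [Substitution.digitPairs, Finset.mem_sigma] at hc
    refine ⟨p, u, hu, ?_⟩
    rw [shift_mem_shiftPatch, add_sub_cancel_right]
    exact Substitution.mem_digits.mp hc.2

theorem supertile_location_unique (hA : TranslationInequivalent A) (σ : Substitution A)
    {P : Set (Tile d L)} (hP : IsPatch P) {a : Fin n} {c c' : Σ _ : Fin n, Rd d}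
    (hc : c ∈ σ.digitPairs a) (hc' : c' ∈ σ.digitPairs a) {u u' : Rd d}
    (hu : u ∈ locations A P c.1) (hu' : u' ∈ locations A P c'.1)
    (h : c.2 + σ.φ u = c'.2 + σ.φ u') : c = c' := by
  obtain ⟨p, x⟩ := c
  obtain ⟨p', x'⟩ := c'
  rw [Substitution.digitPairs, Finset.mem_sigma] at hc hc'
  have hS : (A a).shift (x + σ.φ u) ∈ shiftPatch (σ.rule p) (σ.φ u) := by
    rw [shift_mem_shiftPatch, add_sub_cancel_right]
    exact Substitution.mem_digits.mp hc.2
  have hS' : (A a).shift (x + σ.φ u) ∈ shiftPatch (σ.rule p') (σ.φ u') := by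
    rw [show x + σ.φ u = x' + σ.φ u' from h, shift_mem_shiftPatch, add_sub_cancel_right]
    exact Substitution.mem_digits.mp hc'.2
  obtain ⟨y, hy⟩ := ((A a).shift (x + σ.φ u)).interior_nonempty
  obtain ⟨rfl, rfl⟩ := σ.supertile_unique hA hP hu hu' hS hS' hy hy
  obtain rfl : x = x' := add_right_cancel h
  rfl

/-- The part of the pair locations of a substituted patch that comes from a given pair of digits. -/
theorem pairLocations_apply (σ : Substitution A) (P : Set (Tile d L)) (a b : Fin n) (z : Rd d) :
    pairLocations A (σ.apply P) a b z =
      ⋃ c ∈ σ.digitPairs a ×ˢ σ.digitPairs b, (fun u => c.1.2 + σ.φ u) ''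
        pairLocations A P c.1.1 c.2.1 (σ.φ.symm (z - (c.2.2 - c.1.2))) := by
  ext t
  simp only [Set.mem_iUnion, Set.mem_image, Finset.mem_product, exists_prop]
  constructor
  · rintro ⟨h1, h2⟩
    obtain ⟨c, hc, u, hu, rfl⟩ := (mem_locations_apply σ).mp h1
    obtain ⟨c', hc', v, hv, hcv⟩ := (mem_locations_apply σ).mp h2
    refine ⟨(c, c'), ⟨hc, hc'⟩, u, ⟨hu, ?_⟩, rfl⟩
    have h3 : z - (c'.2 - c.2) = σ.φ (v - u) := by
      rw [map_sub]
      rw [show z = c'.2 + σ.φ v - (c.2 + σ.φ u) from eq_sub_of_add_eq' hcv]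
      abel
    simp only [h3, ContinuousLinearEquiv.symm_apply_apply, add_sub_cancel]
    exact hv
  · rintro ⟨⟨c, c'⟩, ⟨hc, hc'⟩, u, ⟨hu, hv⟩, rfl⟩
    refine ⟨(mem_locations_apply σ).mpr ⟨c, hc, u, hu, rfl⟩,
      (mem_locations_apply σ).mpr ⟨c', hc', _, hv, ?_⟩⟩
    simp only [map_add, ContinuousLinearEquiv.apply_symm_apply]
    abel

/-- The pieces in `pairLocations_apply` are disjoint: the tile at `t` determines its parent and
digit, and then the tile at `t + z` does the same for the second component. -/
theorem ncard_pairLocations_apply (hA : TranslationInequivalent A) (σ : Substitution A)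
    {P : Set (Tile d L)} (hP : IsPatch P) (a b : Fin n) (z : Rd d) {W : Set (Rd d)}
    (hW : Bornology.IsBounded W) :
    (W ∩ pairLocations A (σ.apply P) a b z).ncard =
      ∑ c ∈ σ.digitPairs a ×ˢ σ.digitPairs b, ((fun u => c.1.2 + σ.φ u) ⁻¹' W ∩
        pairLocations A P c.1.1 c.2.1 (σ.φ.symm (z - (c.2.2 - c.1.2)))).ncard := by
  classical
  set E : (Σ _ : Fin n, Rd d) × (Σ _ : Fin n, Rd d) → Set (Rd d) := fun c =>
    pairLocations A P c.1.1 c.2.1 (σ.φ.symm (z - (c.2.2 - c.1.2))) with hE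
  set f : (Σ _ : Fin n, Rd d) × (Σ _ : Fin n, Rd d) → Rd d → Rd d := fun c u =>
    c.1.2 + σ.φ u with hf
  have hinj : ∀ c, Function.Injective (f c) := fun c u v h => σ.φ.injective (add_left_cancel h)
  have hfin : (W ∩ pairLocations A (σ.apply P) a b z).Finite :=
    (hP.apply hA σ).finite_pairLocations a b z hW
  have hsub : ∀ c ∈ σ.digitPairs a ×ˢ σ.digitPairs b, W ∩ f c '' E c ⊆
      W ∩ pairLocations A (σ.apply P) a b z := by
    intro c hc t ht
    refine ⟨ht.1, ?_⟩
    rw [pairLocations_apply]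
    exact Set.mem_biUnion (t := fun c => f c '' E c) hc ht.2
  have hncard : ∀ c, (f c ⁻¹' W ∩ E c).ncard = (W ∩ f c '' E c).ncard := by
    intro c
    rw [← Set.ncard_image_of_injective _ (hinj c), Set.inter_comm, Set.image_inter_preimage,
      Set.inter_comm]
  have hW' : W ∩ pairLocations A (σ.apply P) a b z =
      ⋃ c ∈ σ.digitPairs a ×ˢ σ.digitPairs b, W ∩ f c '' E c := by
    rw [pairLocations_apply, Set.inter_iUnion₂]
  have hfin' : ∀ c : ↥(σ.digitPairs a ×ˢ σ.digitPairs b), (W ∩ f c '' E c).Finite := fun c =>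
    hfin.subset (hsub c c.2)
  simp only [hf, hE] at hncard
  simp only [hncard]
  rw [hW', ← Finset.sum_coe_sort, ← finsum_eq_sum_of_fintype, ← Set.ncard_iUnion_of_finite hfin']
  · congr 1
    ext t
    simp only [Set.mem_iUnion, Subtype.exists, exists_prop]
  · rintro ⟨c, hc⟩ ⟨c', hc'⟩ hne
    refine Set.disjoint_left.mpr fun t ht ht' => hne (Subtype.ext ?_)
    obtain ⟨-, u, hu, rfl⟩ := ht
    obtain ⟨-, u', hu', huu'⟩ := ht'
    rw [Finset.mem_product] at hc hc'
    have h1 : c.1 = c'.1 :=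
      supertile_location_unique hA σ hP hc.1 hc'.1 hu.1 hu'.1 huu'.symm
    have h2 : u = u' := by
      have huu'' : c'.1.2 + σ.φ u' = c.1.2 + σ.φ u := huu'
      rw [h1] at huu''
      exact (σ.φ.injective (add_left_cancel huu'')).symm
    refine Prod.ext h1 (supertile_location_unique hA σ hP hc.2 hc'.2 hu.2 hu'.2 ?_)
    simp only [map_add, ContinuousLinearEquiv.apply_symm_apply, h1, h2]
    abel

theorem volume_real_preimage_closedBall (φ : Rd d ≃L[ℝ] Rd d) (R : ℝ) :
    volume.real (φ ⁻¹' Metric.closedBall (0 : Rd d) R) =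
      (absDet φ)⁻¹ * volume.real (Metric.closedBall (0 : Rd d) R) := by
  have h := congrArg (fun μ : Measure (Rd d) => μ (Metric.closedBall 0 R)) (map_clEquiv_volume φ)
  simp only [Measure.smul_apply, smul_eq_mul] at h
  change Measure.map φ.toHomeomorph volume _ = _ at h
  rw [φ.toHomeomorph.measurableEmbedding.map_apply] at h
  rw [measureReal_def, measureReal_def]
  change (volume (φ.toHomeomorph ⁻¹' _)).toReal = _
  rw [h, ENNReal.toReal_mul, ENNReal.toReal_ofReal (inv_nonneg.mpr (absDet_pos φ).le)]

/-- The renormalization equation for the pair frequencies. -/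
theorem pairFreq_apply (hA : TranslationInequivalent A) (σ : Substitution A)
    {P : Set (Tile d L)} (hP : IsPatch P) (hfreq : HasPatchFrequencies (σ.apply P))
    (hell : FrequenciesAlong P σ.φ) (a b : Fin n) (z : Rd d) :
    pairFreq A (σ.apply P) a b z = (absDet σ.φ)⁻¹ * ∑ c ∈ σ.digitPairs a ×ˢ σ.digitPairs b,
      pairFreq A P c.1.1 c.2.1 (σ.φ.symm (z - (c.2.2 - c.1.2))) := by
  refine tendsto_nhds_unique (tendsto_pairFreq (hP.apply hA σ) hfreq a b z) ?_
  have h1 : ∀ c ∈ σ.digitPairs a ×ˢ σ.digitPairs b,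
      Tendsto (fun R : ℝ => (((fun u => c.1.2 + σ.φ u) ⁻¹' Metric.closedBall 0 R ∩
        pairLocations A P c.1.1 c.2.1 (σ.φ.symm (z - (c.2.2 - c.1.2)))).ncard : ℝ) /
          volume.real (Metric.closedBall (0 : Rd d) R)) atTop
        (𝓝 ((absDet σ.φ)⁻¹ *
          pairFreq A P c.1.1 c.2.1 (σ.φ.symm (z - (c.2.2 - c.1.2))))) := by
    intro c _
    set E := pairLocations A P c.1.1 c.2.1 (σ.φ.symm (z - (c.2.2 - c.1.2))) with hE
    have hbdd : ∀ R, Bornology.IsBounded (σ.φ ⁻¹' Metric.closedBall (0 : Rd d) R) := fun R =>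
      (σ.φ.toHomeomorph.isCompact_preimage.mpr (isCompact_closedBall 0 R)).isBounded
    have hfin : ∀ R, (σ.φ ⁻¹' Metric.closedBall (0 : Rd d) R ∩ E).Finite := fun R =>
      hP.finite_pairLocations _ _ _ (hbdd R)
    have hadd : ∀ R, (fun u => c.1.2 + σ.φ u) ⁻¹' Metric.closedBall (0 : Rd d) R ∩ E ⊆
        σ.φ ⁻¹' Metric.closedBall (0 : Rd d) (R + ‖c.1.2‖) ∩ E := by
      rintro R u ⟨hu, huE⟩
      refine ⟨?_, huE⟩
      rw [Set.mem_preimage, mem_closedBall_zero_iff] at hu ⊢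
      have := norm_sub_le (c.1.2 + σ.φ u) c.1.2
      rw [add_sub_cancel_left] at this
      linarith
    -- The window lies between the ellipsoids `φ⁻¹(B_{R ± ‖c.1.2‖})`. Averages along ellipsoids are
    -- the assumed ones, and the volume of an ellipsoid supplies `|det φ|⁻¹`.
    refine tendsto_div_volume_closedBall_of_sandwich (a := ‖c.1.2‖)
      (N := fun R => ((σ.φ ⁻¹' Metric.closedBall (0 : Rd d) R ∩ E).ncard : ℝ)) ?_ ?_ ?_
    · have h2 := (tendsto_pairFreq_along (A := A) hP hell c.1.1 c.2.1
        (σ.φ.symm (z - (c.2.2 - c.1.2)))).const_mul (absDet σ.φ)⁻¹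
      refine h2.congr fun R => ?_
      rw [volume_real_preimage_closedBall, ← hE]
      have := (absDet_pos σ.φ).ne'
      field_simp
    · intro R
      refine Nat.cast_le.mpr (Set.ncard_le_ncard ?_ ((hfin _).subset (hadd R)))
      rintro u ⟨hu, huE⟩
      refine ⟨?_, huE⟩
      rw [Set.mem_preimage, mem_closedBall_zero_iff] at hu ⊢
      linarith [norm_add_le c.1.2 (σ.φ u)]
    · intro R
      exact Nat.cast_le.mpr (Set.ncard_le_ncard (hadd R) (hfin _))
  rw [Finset.mul_sum]
  refine (tendsto_finsetSum _ h1).congr fun R => ?_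
  rw [ncard_pairLocations_apply hA σ hP a b z Metric.isBounded_closedBall, Nat.cast_sum,
    Finset.sum_div]

/-! ### The renormalization equation for the pair-correlation measures -/

theorem finite_support_mul {S : Set (Rd d)} (hS : IsLocallyFiniteSet S) {c : Rd d → ℂ}
    (hc : ∀ z, z ∉ S → c z = 0) (f : TestFun d) :
    (Function.support fun z => c z * f z).Finite := by
  refine (hS (tsupport f) f.hasCompactSupport).subset fun z hz => ?_
  refine ⟨subset_tsupport _ (right_ne_zero_of_mul hz), ?_⟩
  by_contra h
  exact left_ne_zero_of_mul hz (hc z h)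

theorem diracComb_apply {S : Set (Rd d)} (hS : IsLocallyFiniteSet S) (c : Rd d → ℂ)
    (f : TestFun d) : (diracComb S c).1 f =
      ∑ z ∈ (hS (tsupport f) f.hasCompactSupport).toFinset, c z * f z := by
  unfold diracComb
  rw [dif_pos hS]
  rfl

/-- A sum over all of `ℝᵈ` depends neither on `S` nor on the support of `f`, so translations and
linear maps become plain reindexings. -/
theorem diracComb_apply_eq_finsum {S : Set (Rd d)} (hS : IsLocallyFiniteSet S) {c : Rd d → ℂ}
    (hc : ∀ z, z ∉ S → c z = 0) (f : TestFun d) : (diracComb S c).1 f = ∑ᶠ z, c z * f z := by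
  rw [diracComb_apply hS]
  refine (finsum_eq_sum_of_support_subset _ fun z hz => ?_).symm
  rw [Set.Finite.coe_toFinset]
  refine ⟨subset_tsupport _ (right_ne_zero_of_mul hz), ?_⟩
  by_contra h
  exact left_ne_zero_of_mul hz (hc z h)

theorem pairFreq_cast_eq_zero (T : Set (Tile d L)) (a b : Fin n) (z : Rd d)
    (h : z ∉ differences A T a b) : (pairFreq A T a b z : ℂ) = 0 := by
  rw [pairFreq_eq_zero_of_notMem h, Complex.ofReal_zero]

/-- The substitution `w ↦ (y - x) + φ w` turns each term on the right into a sum over the atoms `z`;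
the coefficients of `f z` then agree by `pairFreq_apply`. -/
theorem pairCorrelation_apply (hA : TranslationInequivalent A) (σ : Substitution A)
    {P : Set (Tile d L)} (hP : IsPatch P) (hfreq : HasPatchFrequencies (σ.apply P))
    (hell : FrequenciesAlong P σ.φ) (a b : Fin n)
    (hS : IsLocallyFiniteSet (differences A (σ.apply P) a b))
    (hS' : ∀ p q, IsLocallyFiniteSet (differences A P p q)) :
    pairCorrelation A (σ.apply P) a b = ((absDet σ.φ : ℂ)⁻¹) • ∑ p, ∑ q,
      ∑ x ∈ σ.digits a p, ∑ y ∈ σ.digits b q, RadonMeasure.diracConv (y - x)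
        (RadonMeasure.push σ.φ.toHomeomorph (pairCorrelation A P p q)) := by
  refine RadonMeasure.ext fun f => ?_
  rw [Substitution.sum_digitPairs, RadonMeasure.smul_apply, RadonMeasure.sum_apply]
  unfold pairCorrelation
  rw [diracComb_apply_eq_finsum hS (pairFreq_cast_eq_zero _ a b)]
  have h1 : ∀ c : (Σ _ : Fin n, Rd d) × (Σ _ : Fin n, Rd d),
      (RadonMeasure.diracConv (c.2.2 - c.1.2) (RadonMeasure.push σ.φ.toHomeomorph
        (diracComb (differences A P c.1.1 c.2.1) fun z => (pairFreq A P c.1.1 c.2.1 z : ℂ)))).1 f =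
      ∑ᶠ z, (pairFreq A P c.1.1 c.2.1 (σ.φ.symm (z - (c.2.2 - c.1.2))) : ℂ) * f z := by
    intro c
    change (diracComb _ _).1
      ((f.compHomeo (Homeomorph.addLeft (c.2.2 - c.1.2))).compHomeo σ.φ.toHomeomorph) = _
    rw [diracComb_apply_eq_finsum (hS' _ _) (pairFreq_cast_eq_zero _ _ _)]
    refine (finsum_congr fun w => ?_).trans
      (finsum_comp_equiv (σ.φ.toEquiv.trans (Equiv.addLeft (c.2.2 - c.1.2))))
    have h2 : (σ.φ.toEquiv.trans (Equiv.addLeft (c.2.2 - c.1.2))) w =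
      c.2.2 - c.1.2 + σ.φ w := rfl
    rw [h2, add_sub_cancel_left, ContinuousLinearEquiv.symm_apply_apply]
    rfl
  simp only [h1]
  rw [← finsum_sum_comm, mul_finsum]
  · refine finsum_congr fun z => ?_
    rw [pairFreq_apply hA σ hP hfreq hell, ← Finset.sum_mul]
    push_cast
    ring
  · intro c _
    set e := σ.φ.toEquiv.trans (Equiv.addLeft (c.2.2 - c.1.2))
    have h2 := (finite_support_mul (hS' c.1.1 c.2.1) (pairFreq_cast_eq_zero P c.1.1 c.2.1)
      ((f.compHomeo (Homeomorph.addLeft (c.2.2 - c.1.2))).compHomeo σ.φ.toHomeomorph)).image e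
    refine h2.subset fun z hz => ⟨e.symm z, ?_, e.apply_symm_apply z⟩
    have h3 : e.symm z = σ.φ.symm (z - (c.2.2 - c.1.2)) := by
      rw [Equiv.symm_apply_eq]
      change z = c.2.2 - c.1.2 + σ.φ _
      rw [ContinuousLinearEquiv.apply_symm_apply]
      abel
    rw [Function.mem_support, h3]
    refine mul_ne_zero (left_ne_zero_of_mul hz) ?_
    change f (c.2.2 - c.1.2 + σ.φ (σ.φ.symm _)) ≠ 0
    rw [ContinuousLinearEquiv.apply_symm_apply, add_sub_cancel]
    exact right_ne_zero_of_mul hz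

end Frequencies

end SAdic

end

noncomputable section

namespace SAdic

open FourierTransform
open scoped NNReal ENNReal ComplexConjugate

/-! ### Fourier transformability of the pair-correlation measures -/

section ExponentialSums

variable {d : ℕ}

/-- The exponential sum of a finite set. -/
def expSum (s : Finset (Rd d)) (ξ : Rd d) : ℂ :=
  ∑ x ∈ s, Complex.exp (-(2 * Real.pi * Complex.I * (inner ℝ x ξ : ℝ)))

theorem continuous_expSum (s : Finset (Rd d)) : Continuous (expSum s) := by
  unfold expSum
  fun_prop

theorem norm_expSum_le (s : Finset (Rd d)) (ξ : Rd d) : ‖expSum s ξ‖ ≤ s.card := by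
  refine (norm_sum_le _ _).trans ?_
  rw [Finset.card_eq_sum_ones, Nat.cast_sum]
  refine Finset.sum_le_sum fun x _ => ?_
  rw [show (-(2 * Real.pi * Complex.I * (inner ℝ x ξ : ℝ)) : ℂ) =
    ((-(2 * Real.pi * inner ℝ x ξ) : ℝ) : ℂ) * Complex.I by push_cast; ring,
    Complex.norm_exp_ofReal_mul_I, Nat.cast_one]

theorem expSum_mul_conj (s t : Finset (Rd d)) (ξ : Rd d) : expSum s ξ * conj (expSum t ξ) =
    ∑ x ∈ s, ∑ y ∈ t, Complex.exp (-(2 * Real.pi * Complex.I * (inner ℝ (x - y) ξ : ℝ))) := by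
  unfold expSum
  rw [map_sum, Finset.sum_mul_sum]
  refine Finset.sum_congr rfl fun x _ => Finset.sum_congr rfl fun y _ => ?_
  rw [← Complex.exp_conj, ← Complex.exp_add, inner_sub_left]
  congr 1
  simp only [map_neg, map_mul, Complex.conj_I, Complex.conj_ofReal, Complex.conj_ofNat]
  push_cast
  ring

theorem TestFun.integrable_fourierInv_conv_mul (f g : TestFun d) {E : Rd d → ℂ}
    (hE : Continuous E) {C : ℝ} (hC : ∀ ξ, ‖E ξ‖ ≤ C) :
    Integrable (fun ξ => 𝓕⁻ (f.conv g : Rd d → ℂ) ξ * E ξ) :=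
  integrable_mul_of_bdd (f.integrable_fourierInv_conv g) hE.measurable ⟨C, hC⟩

theorem norm_expSum_mul_conj_le (s t : Finset (Rd d)) (ξ : Rd d) :
    ‖expSum s ξ * conj (expSum t ξ)‖ ≤ s.card * t.card := by
  rw [norm_mul, RCLike.norm_conj]
  exact mul_le_mul (norm_expSum_le s ξ) (norm_expSum_le t ξ) (norm_nonneg _) (Nat.cast_nonneg _)

theorem continuous_expSum_mul_conj (s t : Finset (Rd d)) :
    Continuous fun ξ => expSum s ξ * conj (expSum t ξ) :=
  (continuous_expSum s).mul (Complex.continuous_conj.comp (continuous_expSum t))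

/-- The product of exponential sums is a double sum of characters, and Fourier inversion evaluates
each term. -/
theorem integral_fourierInv_conv_mul_expSum (f g : TestFun d) (s t : Finset (Rd d)) :
    ∫ ξ, 𝓕⁻ (f.conv g : Rd d → ℂ) ξ * (expSum s ξ * conj (expSum t ξ)) =
      ∑ x ∈ s, ∑ y ∈ t, f.conv g (x - y) := by
  have hi : ∀ z : Rd d, Integrable fun ξ =>
      Complex.exp (-(2 * Real.pi * Complex.I * (inner ℝ z ξ : ℝ))) *
        𝓕⁻ (f.conv g : Rd d → ℂ) ξ := by
    intro z
    have := f.integrable_fourierInv_conv_mul g (continuous_expSum {z}) (norm_expSum_le {z})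
    refine this.congr (Eventually.of_forall fun ξ => ?_)
    simp [expSum, mul_comm]
  simp only [expSum_mul_conj, Finset.mul_sum]
  rw [integral_finsetSum]
  · refine Finset.sum_congr rfl fun x _ => ?_
    rw [integral_finsetSum]
    · refine Finset.sum_congr rfl fun y _ => ?_
      rw [← TestFun.integral_exp_mul_fourierInv_conv]
      simp only [mul_comm]
    · intro y _
      exact (hi (x - y)).congr (Eventually.of_forall fun ξ => mul_comm _ _)
  · intro x _
    refine integrable_finsetSum _ fun y _ => ?_
    exact (hi (x - y)).congr (Eventually.of_forall fun ξ => mul_comm _ _)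

/-- The positive measure with density `‖∑_{x ∈ s} e(-⟨x, ξ⟩) + w ∑_{x ∈ t} e(-⟨x, ξ⟩)‖² / V`. -/
def expSumMeasure (s t : Finset (Rd d)) (w : ℂ) (V : ℝ≥0) : Measure (Rd d) :=
  volume.withDensity fun ξ => ((‖expSum s ξ + w * expSum t ξ‖₊ ^ 2 / V : ℝ≥0) : ℝ≥0∞)

theorem continuous_expSumDensity (s t : Finset (Rd d)) (w : ℂ) (V : ℝ≥0) :
    Continuous fun ξ => ‖expSum s ξ + w * expSum t ξ‖₊ ^ 2 / V :=
  ((((continuous_expSum s).add (continuous_const.mul (continuous_expSum t))).nnnorm).pow 2).div_const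
    V

theorem expSumDensity_eq (s t : Finset (Rd d)) (w : ℂ) (V : ℝ≥0) (ξ : Rd d) :
    ((‖expSum s ξ + w * expSum t ξ‖₊ ^ 2 / V : ℝ≥0) : ℂ) = (V : ℂ)⁻¹ *
      (expSum s ξ * conj (expSum s ξ) + w * conj w * (expSum t ξ * conj (expSum t ξ)) +
        conj w * (expSum s ξ * conj (expSum t ξ)) + w * (expSum t ξ * conj (expSum s ξ))) := by
  have h : ((‖expSum s ξ + w * expSum t ξ‖ ^ 2 : ℝ) : ℂ) =
      (expSum s ξ + w * expSum t ξ) * conj (expSum s ξ + w * expSum t ξ) := by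
    rw [Complex.mul_conj, Complex.normSq_eq_norm_sq]
  push_cast at h
  push_cast
  rw [h, map_add, map_mul, div_eq_inv_mul]
  ring

theorem integrable_expSumMeasure (f g : TestFun d) (s t : Finset (Rd d)) (w : ℂ) (V : ℝ≥0) :
    Integrable (𝓕⁻ (f.conv g : Rd d → ℂ)) (expSumMeasure s t w V) := by
  unfold expSumMeasure
  rw [integrable_withDensity_iff_integrable_smul (continuous_expSumDensity s t w V).measurable]
  have hb : ∀ ξ, ‖((‖expSum s ξ + w * expSum t ξ‖₊ ^ 2 / V : ℝ≥0) : ℂ)‖ ≤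
      (s.card + ‖w‖ * t.card) ^ 2 / V := by
    intro ξ
    rw [Complex.norm_real, Real.norm_of_nonneg NNReal.zero_le_coe]
    push_cast
    gcongr
    refine (norm_add_le _ _).trans (add_le_add (norm_expSum_le s ξ) ?_)
    rw [norm_mul]
    exact mul_le_mul_of_nonneg_left (norm_expSum_le t ξ) (norm_nonneg _)
  have := f.integrable_fourierInv_conv_mul g (Complex.continuous_ofReal.comp
    (NNReal.continuous_coe.comp (continuous_expSumDensity s t w V))) hb
  refine this.congr (Eventually.of_forall fun ξ => ?_)
  simp only [Function.comp, NNReal.smul_def, Complex.real_smul]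
  exact mul_comm _ _

theorem integral_expSumMeasure (f g : TestFun d) (s t : Finset (Rd d)) (w : ℂ) (V : ℝ≥0) :
    ∫ ξ, 𝓕⁻ (f.conv g : Rd d → ℂ) ξ ∂(expSumMeasure s t w V) = (V : ℂ)⁻¹ *
      ((∑ x ∈ s, ∑ y ∈ s, f.conv g (x - y)) + w * conj w * (∑ x ∈ t, ∑ y ∈ t, f.conv g (x - y)) +
        conj w * (∑ x ∈ s, ∑ y ∈ t, f.conv g (x - y)) +
        w * (∑ x ∈ t, ∑ y ∈ s, f.conv g (x - y))) := by
  have hi : ∀ s t : Finset (Rd d), ∀ c : ℂ, Integrable fun ξ =>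
      c * (𝓕⁻ (f.conv g : Rd d → ℂ) ξ * (expSum s ξ * conj (expSum t ξ))) := fun s t c =>
    (f.integrable_fourierInv_conv_mul g (continuous_expSum_mul_conj s t)
      (norm_expSum_mul_conj_le s t)).const_mul c
  rw [integral_density (continuous_expSumDensity s t w V).measurable (m := expSumMeasure s t w V)
    rfl]
  simp only [expSumDensity_eq]
  have h1 : ∀ ξ, 𝓕⁻ (f.conv g : Rd d → ℂ) ξ * ((V : ℂ)⁻¹ *
      (expSum s ξ * conj (expSum s ξ) + w * conj w * (expSum t ξ * conj (expSum t ξ)) +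
        conj w * (expSum s ξ * conj (expSum t ξ)) + w * (expSum t ξ * conj (expSum s ξ)))) =
      (V : ℂ)⁻¹ * (1 * (𝓕⁻ (f.conv g : Rd d → ℂ) ξ * (expSum s ξ * conj (expSum s ξ))) +
        w * conj w * (𝓕⁻ (f.conv g : Rd d → ℂ) ξ * (expSum t ξ * conj (expSum t ξ))) +
        conj w * (𝓕⁻ (f.conv g : Rd d → ℂ) ξ * (expSum s ξ * conj (expSum t ξ))) +
        w * (𝓕⁻ (f.conv g : Rd d → ℂ) ξ * (expSum t ξ * conj (expSum s ξ)))) := by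
    intro ξ
    ring
  simp only [h1]
  have i2 : Integrable fun ξ =>
      1 * (𝓕⁻ (f.conv g : Rd d → ℂ) ξ * (expSum s ξ * conj (expSum s ξ))) +
        w * conj w * (𝓕⁻ (f.conv g : Rd d → ℂ) ξ * (expSum t ξ * conj (expSum t ξ))) :=
    (hi s s 1).add (hi t t _)
  have i3 : Integrable fun ξ =>
      1 * (𝓕⁻ (f.conv g : Rd d → ℂ) ξ * (expSum s ξ * conj (expSum s ξ))) +
        w * conj w * (𝓕⁻ (f.conv g : Rd d → ℂ) ξ * (expSum t ξ * conj (expSum t ξ))) +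
        conj w * (𝓕⁻ (f.conv g : Rd d → ℂ) ξ * (expSum s ξ * conj (expSum t ξ))) :=
    i2.add (hi s t _)
  rw [integral_const_mul, integral_add i3 (hi t s _), integral_add i2 (hi s t _),
    integral_add (hi s s 1) (hi t t _),
    integral_const_mul, integral_const_mul, integral_const_mul, integral_const_mul,
    integral_fourierInv_conv_mul_expSum, integral_fourierInv_conv_mul_expSum,
    integral_fourierInv_conv_mul_expSum, integral_fourierInv_conv_mul_expSum, one_mul]

end ExponentialSums

/-! ### Finite-window correlations and polarization -/

section Transformability

variable {d n : ℕ} {L : Type*} {A : Fin n → Tile d L} {T : Set (Tile d L)}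

/-- The locations of the tiles of type `a` in the ball of radius `R`. -/
def IsPatch.locationsIn (hT : IsPatch T) (A : Fin n → Tile d L) (a : Fin n) (R : ℝ) :
    Finset (Rd d) :=
  (hT.finite_locations (A := A) a (Metric.isBounded_closedBall (x := (0 : Rd d)) (r := R))).toFinset

theorem IsPatch.mem_locationsIn (hT : IsPatch T) {a : Fin n} {R : ℝ} {x : Rd d} :
    x ∈ hT.locationsIn A a R ↔ ‖x‖ ≤ R ∧ x ∈ locations A T a := by
  unfold IsPatch.locationsIn
  rw [Set.Finite.mem_toFinset, Set.mem_inter_iff, mem_closedBall_zero_iff]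

-- Here both tiles must be located in the ball, whereas `pairFreq` restricts only the first;
-- changing the radius by `‖z‖` makes up for the difference.
open scoped Classical in
theorem tendsto_card_pairs (hT : IsPatch T) (hfreq : HasPatchFrequencies T) (a b : Fin n)
    (z : Rd d) : Tendsto (fun R : ℝ =>
      (((hT.locationsIn A a R ×ˢ hT.locationsIn A b R).filter fun c => c.1 - c.2 = z).card : ℝ) /
        volume.real (Metric.closedBall (0 : Rd d) R)) atTop (𝓝 (pairFreq A T b a z)) := by
  have hfin : ∀ R : ℝ, (Metric.closedBall 0 R ∩ pairLocations A T b a z).Finite := fun R =>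
    hT.finite_pairLocations b a z Metric.isBounded_closedBall
  refine tendsto_div_volume_closedBall_of_sandwich (a := ‖z‖)
    (tendsto_pairFreq hT hfreq b a z) (fun R => Nat.cast_le.mpr ?_) fun R => Nat.cast_le.mpr ?_
  · rw [← Set.ncard_coe_finset]
    refine Set.ncard_le_ncard_of_injOn (fun t => (t + z, t)) ?_
      (fun t _ t' _ h => (Prod.ext_iff.mp h).2) (Finset.finite_toSet _)
    rintro t ⟨htR, htb, hta⟩
    rw [mem_closedBall_zero_iff] at htR
    simp only [Finset.coe_filter, Finset.mem_product, Set.mem_ofPred_eq, hT.mem_locationsIn]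
    refine ⟨⟨⟨?_, hta⟩, ?_, htb⟩, by abel⟩
    · linarith [norm_add_le t z]
    · linarith [norm_nonneg z]
  · rw [← Set.ncard_coe_finset]
    refine Set.ncard_le_ncard_of_injOn (fun c => c.2) ?_ ?_ (hfin _)
    · rintro ⟨s, t⟩ hc
      simp only [Finset.coe_filter, Finset.mem_product, Set.mem_ofPred_eq, hT.mem_locationsIn] at hc
      obtain ⟨⟨⟨hs, hsa⟩, ht, htb⟩, rfl⟩ := hc
      refine ⟨?_, htb, ?_⟩
      · rw [mem_closedBall_zero_iff]
        linarith [norm_nonneg (s - t)]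
      · rwa [add_sub_cancel]
    · rintro ⟨s, t⟩ hc ⟨s', t'⟩ hc' h
      simp only [Finset.coe_filter, Set.mem_ofPred_eq] at hc hc' h
      obtain rfl := h
      refine Prod.ext (sub_left_injective (hc.2.trans hc'.2.symm)) rfl

/-- Pairs are sorted by their difference, and only the finitely many differences in the support of
`h` contribute. -/
theorem tendsto_pairSum (hT : IsPatch T) (hfreq : HasPatchFrequencies T) (a b : Fin n)
    (hS : IsLocallyFiniteSet (differences A T b a)) (h : TestFun d) :
    Tendsto (fun R : ℝ => ((volume.real (Metric.closedBall (0 : Rd d) R) : ℝ) : ℂ)⁻¹ *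
      ∑ x ∈ hT.locationsIn A a R, ∑ y ∈ hT.locationsIn A b R, h (x - y)) atTop
      (𝓝 ((pairCorrelation A T b a).1 h)) := by
  classical
  unfold pairCorrelation
  rw [diracComb_apply hS]
  set Z := (hS (tsupport h) h.hasCompactSupport).toFinset with hZ
  have h1 : ∀ R : ℝ, ∑ x ∈ hT.locationsIn A a R, ∑ y ∈ hT.locationsIn A b R, h (x - y) =
      ∑ z ∈ Z, (((hT.locationsIn A a R ×ˢ hT.locationsIn A b R).filter
        fun c => c.1 - c.2 = z).card : ℂ) * h z := by
    intro R
    rw [← Finset.sum_product' (f := fun x y => h (x - y))]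
    have h2 : ∑ c ∈ hT.locationsIn A a R ×ˢ hT.locationsIn A b R, h (c.1 - c.2) =
        ∑ c ∈ (hT.locationsIn A a R ×ˢ hT.locationsIn A b R).filter (fun c => c.1 - c.2 ∈ Z),
          h (c.1 - c.2) := by
      refine (Finset.sum_filter_of_ne fun c hc hne => ?_).symm
      rw [hZ, Set.Finite.mem_toFinset]
      rw [Finset.mem_product, hT.mem_locationsIn, hT.mem_locationsIn] at hc
      exact ⟨subset_tsupport _ hne, c.1, hc.1.2, c.2, hc.2.2, rfl⟩
    rw [h2, ← Finset.sum_fiberwise_of_maps_to (t := Z)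
      (g := fun c : Rd d × Rd d => c.1 - c.2)
      (fun c hc => (Finset.mem_filter.mp hc).2)]
    refine Finset.sum_congr rfl fun z hz => ?_
    rw [Finset.filter_filter, ← nsmul_eq_mul, ← Finset.sum_const]
    refine Finset.sum_congr ?_ fun c hc => ?_
    · ext c
      simp only [Finset.mem_filter]
      constructor
      · exact fun h => ⟨h.1, h.2.2⟩
      · exact fun h => ⟨h.1, h.2 ▸ hz, h.2⟩
    · rw [(Finset.mem_filter.mp hc).2]
  simp only [h1, Finset.mul_sum]
  refine tendsto_finsetSum _ fun z _ => ?_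
  refine (((Complex.continuous_ofReal.tendsto _).comp
    (tendsto_card_pairs (A := A) hT hfreq a b z)).mul_const (h z)).congr fun R => ?_
  simp only [Function.comp]
  push_cast
  ring

/-- Expanding `|S_a + w S_b|²` gives four pair sums over the ball. The term with `conj w` runs over
`x` of type `a` and `y` of type `b`, so its differences lie in `D_a - D_b`, the index pair `b a`. -/
theorem isTransformLimit_pairCorrelation (hT : IsPatch T) (hfreq : HasPatchFrequencies T)
    (hS : ∀ a b, IsLocallyFiniteSet (differences A T a b)) (a b : Fin n) (w : ℂ) :
    IsTransformLimit (pairCorrelation A T a a + (w * conj w) • pairCorrelation A T b b +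
        conj w • pairCorrelation A T b a + w • pairCorrelation A T a b) atTop
      (fun R : ℝ => expSumMeasure (hT.locationsIn A a R) (hT.locationsIn A b R) w
        (volume.real (Metric.closedBall (0 : Rd d) R)).toNNReal) where
  finite R := IsLocallyFiniteMeasure.withDensity_coe (continuous_expSumDensity _ _ _ _)
  integrable R f g := integrable_expSumMeasure f g _ _ _ _
  tendsto f g := by
    simp only [integral_expSumMeasure, Real.coe_toNNReal _ measureReal_nonneg]
    have key := fun a b => tendsto_pairSum (A := A) hT hfreq a b (hS b a) (f.conv g)
    refine ((((key a a).add ((key b b).const_mul (w * conj w))).add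
      ((key a b).const_mul (conj w))).add ((key b a).const_mul w)).congr fun R => ?_
    ring

theorem FourierTransformable.add {μ ν : RadonMeasure d} (h : FourierTransformable μ)
    (h' : FourierTransformable ν) : FourierTransformable (μ + ν) := by
  obtain ⟨_, h⟩ := h
  obtain ⟨_, h'⟩ := h'
  exact ⟨_, h.add h'⟩

theorem FourierTransformable.smul {μ : RadonMeasure d} (h : FourierTransformable μ) (c : ℂ) :
    FourierTransformable (c • μ) := by
  obtain ⟨_, h⟩ := h
  exact ⟨_, h.smul c⟩

theorem fourierTransformable_pairCorrelation (hT : IsPatch T) (hfreq : HasPatchFrequencies T)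
    (hS : ∀ a b, IsLocallyFiniteSet (differences A T a b)) (a b : Fin n) :
    FourierTransformable (pairCorrelation A T a b) := by
  have key := fun w => (isTransformLimit_pairCorrelation hT hfreq hS a b w).fourierTransformable
  -- The coefficients are `conj w / 4` for the four values of `w`: their sum and their sum against
  -- `conj w` vanish, while their sum against `w` is one, so only the measure with indices `a b`
  -- survives.
  have h := (((key 1).smul (1 / 4)).add ((key (-1)).smul (-1 / 4))).add
    (((key Complex.I).smul (-Complex.I / 4)).add ((key (-Complex.I)).smul (Complex.I / 4)))
  convert h using 1
  simp only [map_one, map_neg, Complex.conj_I, smul_add, smul_smul]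
  match_scalars <;> ring_nf <;> norm_num [Complex.I_sq]

end Transformability

end SAdic

end

/-! ### Renormalization of Fourier transforms and densities -/

noncomputable section

namespace SAdic

open scoped ComplexConjugate

variable {d n : ℕ} {L : Type*} {A : Fin n → Tile d L}

theorem RadonMeasure.mulFun_smul (ξ : C(Rd d, ℂ)) (c : ℂ) (μ : RadonMeasure d) :
    RadonMeasure.mulFun ξ (c • μ) = c • RadonMeasure.mulFun ξ μ := rfl

/-- The rule for linear images contributes a second factor `|det φ|⁻¹`, whence the square; the rule
for translations turns `y - x` into the exponent `x - y`. -/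
theorem IsFourierTransform.renormalization (σ : Substitution A) (a b : Fin n)
    {μ ν : Fin n → Fin n → RadonMeasure d} (h : ∀ p q, IsFourierTransform (μ p q) (ν p q)) :
    IsFourierTransform
      (((σ.absDet : ℂ)⁻¹) • ∑ p, ∑ q, ∑ x ∈ σ.digits a p, ∑ y ∈ σ.digits b q,
        RadonMeasure.diracConv (y - x) (RadonMeasure.push σ.φ.toHomeomorph (μ p q)))
      ((((σ.absDet : ℂ) ^ 2)⁻¹) • ∑ p, ∑ q, ∑ x ∈ σ.digits a p, ∑ y ∈ σ.digits b q,
        RadonMeasure.mulFun (expFun (x - y))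
          (RadonMeasure.push (adjointEquiv σ.φ).symm.toHomeomorph (ν p q))) := by
  have key := (IsFourierTransform.sum Finset.univ fun p _ =>
    IsFourierTransform.sum Finset.univ fun q _ =>
    IsFourierTransform.sum (σ.digits a p) fun x _ =>
    IsFourierTransform.sum (σ.digits b q) fun y _ =>
      ((h p q).push σ.φ).diracConv (y - x)).smul ((σ.absDet : ℂ)⁻¹)
  simp only [RadonMeasure.mulFun_smul, neg_sub, ← Finset.smul_sum] at key
  rw [smul_smul] at key
  rw [pow_two, mul_inv]
  exact key

theorem expFun_sub_apply (x y t : Rd d) : expFun (x - y) t =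
    Complex.exp (2 * Real.pi * Complex.I * (inner ℝ x t : ℝ)) *
      conj (Complex.exp (2 * Real.pi * Complex.I * (inner ℝ y t : ℝ))) := by
  change Complex.exp _ = _
  rw [← Complex.exp_conj, ← Complex.exp_add]
  congr 1
  simp only [map_mul, Complex.conj_ofReal, Complex.conj_I, map_ofNat, inner_sub_right,
    real_inner_comm t]
  push_cast
  ring

/-- Since `expFun (x - y)` is the character of `x` times the conjugate character of `y`, the two
digit sums separate into entries of `B` and of its adjoint. -/
theorem Substitution.fourierMatrix_mul_mul_conjTranspose (σ : Substitution A) (t : Rd d)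
    (M : Matrix (Fin n) (Fin n) ℂ) (a b : Fin n) :
    (σ.fourierMatrix t * M * (σ.fourierMatrix t).conjTranspose) a b =
      ∑ p, ∑ q, ∑ x ∈ σ.digits a p, ∑ y ∈ σ.digits b q, expFun (x - y) t * M p q := by
  simp only [Matrix.mul_apply, Matrix.conjTranspose_apply, Substitution.fourierMatrix,
    expFun_sub_apply, Finset.sum_mul]
  rw [Finset.sum_comm]
  refine Finset.sum_congr rfl fun p _ => Finset.sum_congr rfl fun q _ =>
    Finset.sum_congr rfl fun x _ => ?_
  rw [star_sum, Finset.mul_sum]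
  refine Finset.sum_congr rfl fun y _ => ?_
  rw [RCLike.star_def]
  ring

/-- The Jacobian of `φ*` equals `|det φ|` and cancels one of the two factors `|det φ|⁻¹`. -/
theorem IsACDensity.renormalization (σ : Substitution A) (a b : Fin n)
    {ν : Fin n → Fin n → RadonMeasure d} {H : Rd d → Matrix (Fin n) (Fin n) ℂ}
    (h : ∀ p q, IsACDensity (ν p q) fun t => H t p q) :
    IsACDensity
      ((((σ.absDet : ℂ) ^ 2)⁻¹) • ∑ p, ∑ q, ∑ x ∈ σ.digits a p, ∑ y ∈ σ.digits b q,
        RadonMeasure.mulFun (expFun (x - y))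
          (RadonMeasure.push (adjointEquiv σ.φ).symm.toHomeomorph (ν p q)))
      fun t => (((σ.absDet : ℂ)⁻¹) • (σ.fourierMatrix t * H (adjointEquiv σ.φ t) *
        (σ.fourierMatrix t).conjTranspose)) a b := by
  have key := (IsACDensity.sum Finset.univ fun p _ =>
    IsACDensity.sum Finset.univ fun q _ =>
    IsACDensity.sum (σ.digits a p) fun x _ =>
    IsACDensity.sum (σ.digits b q) fun y _ =>
      ((h p q).push_symm (adjointEquiv σ.φ)).mulFun (ξ := expFun (x - y))
        fun t => (norm_expFun _ t).le).smul (((σ.absDet : ℂ) ^ 2)⁻¹)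
  convert key using 2 with t
  have hne : (σ.absDet : ℂ) ≠ 0 := by exact_mod_cast (absDet_pos σ.φ).ne'
  rw [Matrix.smul_apply, Substitution.fourierMatrix_mul_mul_conjTranspose, absDet_adjointEquiv,
    show absDet σ.φ = σ.absDet from rfl]
  simp only [mul_left_comm _ (σ.absDet : ℂ), ← Finset.mul_sum]
  rw [smul_eq_mul]
  field_simp

end SAdic

end

theorem mainTheorem4 {d n m : ℕ} {L : Type*} (hd : 0 < d)
    -- the alphabet, the family of substitution rules, the directive sequence
    (A : Fin n → Tile d L) (hA : TranslationInequivalent A)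
    (ρ : Fin m → Substitution A) (hFLC : HasFLC ρ) (i : ℕ → Fin m)
    -- the S-adic tiling and its de-substituted tilings
    (𝒯 : ℕ → Set (Tile d L)) (h𝒯 : IsSAdicTower ρ i 𝒯)
    -- convergence of patch frequencies
    (hfreq : ∀ k, HasPatchFrequencies (𝒯 k))
    (hell : ∀ k, FrequenciesAlong (𝒯 (k + 1)) (ρ (i k)).φ) :
    -- the sums defining the pair-correlation measures are locally finite
    (∀ k a b, IsLocallyFiniteSet (differences A (𝒯 k) a b)) ∧
    -- the renormalization equation
    (∀ k a b, pairCorrelation A (𝒯 k) a b =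
      (((ρ (i k)).absDet : ℂ)⁻¹) • ∑ p, ∑ q,
        ∑ x ∈ (ρ (i k)).digits a p, ∑ y ∈ (ρ (i k)).digits b q,
          RadonMeasure.diracConv (y - x)
            (RadonMeasure.push (ρ (i k)).φ.toHomeomorph
              (pairCorrelation A (𝒯 (k + 1)) p q))) ∧
    -- Fourier transformability, and the renormalization equation for the Fourier transforms
    (∀ k a b, FourierTransformable (pairCorrelation A (𝒯 k) a b)) ∧
    (∀ k a b, fourierTransform (pairCorrelation A (𝒯 k) a b) =
      ((((ρ (i k)).absDet : ℂ) ^ 2)⁻¹) • ∑ p, ∑ q,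
        ∑ x ∈ (ρ (i k)).digits a p, ∑ y ∈ (ρ (i k)).digits b q,
          RadonMeasure.mulFun (expFun (x - y))
            (RadonMeasure.push (adjointEquiv (ρ (i k)).φ).symm.toHomeomorph
              (fourierTransform (pairCorrelation A (𝒯 (k + 1)) p q)))) ∧
    -- the Radon--Nikodym derivatives of the absolutely continuous parts exist
    (∀ k a b, ∃ h, IsACDensity (fourierTransform (pairCorrelation A (𝒯 k) a b)) h) ∧
    -- the renormalization equation for the Radon--Nikodym matrices
    (∀ H : ℕ → Rd d → Matrix (Fin n) (Fin n) ℂ,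
      (∀ k a b, IsACDensity (fourierTransform (pairCorrelation A (𝒯 k) a b))
        (fun t => H k t a b)) →
      ∀ k, ∀ᵐ t : Rd d, H k t = (((ρ (i k)).absDet : ℂ)⁻¹) •
        ((ρ (i k)).fourierMatrix t * H (k + 1) (adjointEquiv (ρ (i k)).φ t) *
          ((ρ (i k)).fourierMatrix t).conjTranspose)) := by
  have hP := fun k => h𝒯.isPatch hA k
  have hS := fun k a b => h𝒯.isLocallyFiniteSet_differences hA hFLC k a b
  have hT := fun k a b => fourierTransformable_pairCorrelation (hP k) (hfreq k) (hS k) a b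
  have h1 : ∀ k a b, pairCorrelation A (𝒯 k) a b =
      (((ρ (i k)).absDet : ℂ)⁻¹) • ∑ p, ∑ q,
        ∑ x ∈ (ρ (i k)).digits a p, ∑ y ∈ (ρ (i k)).digits b q,
          RadonMeasure.diracConv (y - x)
            (RadonMeasure.push (ρ (i k)).φ.toHomeomorph
              (pairCorrelation A (𝒯 (k + 1)) p q)) := by
    intro k a b
    have he := h𝒯.eq_apply hA k
    have := pairCorrelation_apply hA (ρ (i k)) (hP (k + 1)) (he ▸ hfreq k) (hell k) a b
      (he ▸ hS k a b) (hS (k + 1))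
    rwa [← he] at this
  -- The right side of `h1` is transformed term by term, and uniqueness identifies the result with
  -- `fourierTransform`.
  have h2 := fun k a b => (IsFourierTransform.renormalization (ρ (i k)) a b fun p q =>
    (hT (k + 1) p q).isFourierTransform).fourierTransform_eq
  simp only [← h1] at h2
  refine ⟨hS, h1, hT, h2, fun k a b => (hT k a b).isFourierTransform.exists_isACDensity,
    fun H hH k => ?_⟩
  -- Each entry of the matrix equation compares two densities of the same measure, which agree off a
  -- null set; finitely many null sets are then combined.
  have h3 : ∀ a b, ∀ᵐ t : Rd d, H k t a b = _ := fun a b =>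
    (hH k a b).unique (h2 k a b ▸ IsACDensity.renormalization (ρ (i k)) a b (hH (k + 1)))
  filter_upwards [ae_all_iff.mpr fun a => ae_all_iff.mpr (h3 a)] with t ht
  exact Matrix.ext ht
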